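/- **Weighted semi-matching ($R||\sum C_j$).** Let $G=(U\cup V,E)$ be a bipartite graph with a finite set $U$ of jobs, a finite set $V$ of machines, and real edge weights $w_{uv}\ge 0$ (the time machine $v$ needs for job $u$). A set $M\subseteq E$ is a *semi-matching* if every job is incident with exactly one edge of $M$. For a machine $v$ let $w_1\le w_2\le\dots\le w_d$ be the weights of the $d=\deg_M(v)$ edges of $M$ at $v$ and put $$\mathrm{cost}_M(v)=\sum_{i=1}^{d}(d-i+1)\,w_i,\qquad \mathrm{cost}(M)=\sum_{v\in V}\mathrm{cost}_M(v).$$ A semi-matching is *optimal* if its cost is minimum among all semi-matchings of $G$. There are one algorithm and a constant $C$ such that, for every such $G$ with $n=|U|+|V|$ vertices and $m=|E|\ge 1$ edges, given as a list of its edges with their weights (in any order), the algorithm halts after at most $C\,nm\log n$ steps and outputs an optimal semi-matching of $G$ if $G$ has a semi-matching, and otherwise reports that there is none. The algorithm runs on a random access machine with words of $O(\log (n+m))$ bits and unit-cost operations: addition, subtraction, multiplication, integer division and comparison of words, indexed memory access, and, on exact real numbers, addition, subtraction, multiplication by a word, and comparison. -/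

import Mathlib

namespace SemiMatching

/-! ## Weighted bipartite graphs and semi-matchings -/

/-- A bipartite graph with jobs `U`, machines `V`, and nonnegative edge weights: `weight (u, v)`
is the time machine `v` needs to process job `u` (it matters only on edges). -/
structure WeightedGraph (U V : Type*) where
  edges : Finset (U × V)
  weight : U × V → ℝ
  weight_nonneg : ∀ e ∈ edges, 0 ≤ weight e

variable {U V : Type*}

/-- A set of edges such that every job is incident with exactly one of them. -/
def WeightedGraph.IsSemiMatching (G : WeightedGraph U V) (M : Finset (U × V)) : Prop :=
  M ⊆ G.edges ∧ ∀ u : U, ∃! e : U × V, e ∈ M ∧ e.1 = u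

/-- The weights of the edges of `M` at the machine `v`, with multiplicity, in increasing order. -/
noncomputable def WeightedGraph.sortedWeights [DecidableEq V] (G : WeightedGraph U V)
    (M : Finset (U × V)) (v : V) : List ℝ :=
  ((M.filter fun e => e.2 = v).val.map G.weight).sort (· ≤ ·)

/-- `w₁ + (w₁ + w₂) + ⋯ + (w₁ + ⋯ + w_d) = ∑ i = 1..d, (d - i + 1) * wᵢ`, where `w₁ ≤ ⋯ ≤ w_d`
are the weights of the edges of `M` at `v` (below the index starts at `0`). -/
noncomputable def WeightedGraph.machineCost [DecidableEq V] (G : WeightedGraph U V)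
    (M : Finset (U × V)) (v : V) : ℝ :=
  ∑ i : Fin (G.sortedWeights M v).length,
    (((G.sortedWeights M v).length : ℝ) - (i : ℕ)) * (G.sortedWeights M v).get i

/-- The cost of `M`: the total completion time over all machines. -/
noncomputable def WeightedGraph.cost [Fintype V] [DecidableEq V] (G : WeightedGraph U V)
    (M : Finset (U × V)) : ℝ :=
  ∑ v : V, G.machineCost M v

/-- A semi-matching of minimum cost. -/
def WeightedGraph.IsOptimal [Fintype V] [DecidableEq V] (G : WeightedGraph U V)
    (M : Finset (U × V)) : Prop :=
  G.IsSemiMatching M ∧ ∀ M' : Finset (U × V), G.IsSemiMatching M' → G.cost M ≤ G.cost M'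

/-! ## The machine model

A random access machine programmed by structured programs.  There are word variables and real
variables, and word arrays and real arrays, each indexed by words; a program is a finite object,
so it mentions finitely many variables and arrays.  Words are natural numbers and the results of
word operations are reduced modulo `W`.  Real cells hold exact real numbers, which a program can
only add, subtract, multiply by a word, and compare.  Every operation and every memory access
costs one step. -/

/-- The memory of the machine. -/
structure State where
  word : ℕ → ℕ
  real : ℕ → ℝ
  wordArr : ℕ → ℕ → ℕ
  realArr : ℕ → ℕ → ℝ

/-- Overwrite the word variable `x`. -/
def State.setWord (s : State) (x v : ℕ) : State :=
  { s with word := Function.update s.word x v }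

/-- Overwrite the real variable `x`. -/
def State.setReal (s : State) (x : ℕ) (v : ℝ) : State :=
  { s with real := Function.update s.real x v }

/-- Overwrite cell `i` of the word array `a`. -/
def State.storeWord (s : State) (a i v : ℕ) : State :=
  { s with wordArr := Function.update s.wordArr a (Function.update (s.wordArr a) i v) }

/-- Overwrite cell `i` of the real array `a`. -/
def State.storeReal (s : State) (a i : ℕ) (v : ℝ) : State :=
  { s with realArr := Function.update s.realArr a (Function.update (s.realArr a) i v) }

/-- Word-valued expressions; `get a i` reads cell `i` of the word array number `a`. -/
inductive WExp where
  | const (c : ℕ)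
  | var (x : ℕ)
  | get (a : ℕ) (i : WExp)
  | add (e f : WExp)
  | sub (e f : WExp)
  | mul (e f : WExp)
  | div (e f : WExp)

/-- The value of a word expression, for words modulo `W`.  Subtraction is truncated at `0`,
division is rounded down. -/
def WExp.eval (W : ℕ) (s : State) : WExp → ℕ
  | const c => c % W
  | var x => s.word x
  | get a i => s.wordArr a (i.eval W s)
  | add e f => (e.eval W s + f.eval W s) % W
  | sub e f => e.eval W s - f.eval W s
  | mul e f => (e.eval W s * f.eval W s) % W
  | div e f => e.eval W s / f.eval W s

/-- The number of steps needed to evaluate a word expression. -/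
def WExp.size : WExp → ℕ
  | const _ => 1
  | var _ => 1
  | get _ i => i.size + 1
  | add e f => e.size + f.size + 1
  | sub e f => e.size + f.size + 1
  | mul e f => e.size + f.size + 1
  | div e f => e.size + f.size + 1

/-- Real-valued expressions; `get a i` reads cell `i` of the real array number `a`, and
`scale e r` is the product of a word and a real number. -/
inductive RExp where
  | zero
  | var (x : ℕ)
  | get (a : ℕ) (i : WExp)
  | add (r q : RExp)
  | sub (r q : RExp)
  | scale (e : WExp) (r : RExp)

/-- The value of a real expression. -/
noncomputable def RExp.eval (W : ℕ) (s : State) : RExp → ℝ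
  | zero => 0
  | var x => s.real x
  | get a i => s.realArr a (i.eval W s)
  | add r q => r.eval W s + q.eval W s
  | sub r q => r.eval W s - q.eval W s
  | scale e r => (e.eval W s : ℝ) * r.eval W s

/-- The number of steps needed to evaluate a real expression. -/
def RExp.size : RExp → ℕ
  | zero => 1
  | var _ => 1
  | get _ i => i.size + 1
  | add r q => r.size + q.size + 1
  | sub r q => r.size + q.size + 1
  | scale e r => e.size + r.size + 1

/-- Tests: comparisons of words, comparisons of reals, and their Boolean combinations. -/
inductive BExp where
  | wordLE (e f : WExp)
  | wordEq (e f : WExp)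
  | realLE (r q : RExp)
  | not (b : BExp)
  | and (b c : BExp)
  | or (b c : BExp)

/-- The truth value of a test. -/
def BExp.eval (W : ℕ) (s : State) : BExp → Prop
  | wordLE e f => e.eval W s ≤ f.eval W s
  | wordEq e f => e.eval W s = f.eval W s
  | realLE r q => r.eval W s ≤ q.eval W s
  | not b => ¬ b.eval W s
  | and b c => b.eval W s ∧ c.eval W s
  | or b c => b.eval W s ∨ c.eval W s

/-- The number of steps needed to evaluate a test. -/
def BExp.size : BExp → ℕ
  | wordLE e f => e.size + f.size + 1
  | wordEq e f => e.size + f.size + 1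
  | realLE r q => r.size + q.size + 1
  | not b => b.size + 1
  | and b c => b.size + c.size + 1
  | or b c => b.size + c.size + 1

/-- Programs. -/
inductive Program where
  | skip
  | setWord (x : ℕ) (e : WExp)
  | setReal (x : ℕ) (r : RExp)
  | storeWord (a : ℕ) (i e : WExp)
  | storeReal (a : ℕ) (i : WExp) (r : RExp)
  | seq (P Q : Program)
  | ite (b : BExp) (P Q : Program)
  | while (b : BExp) (P : Program)

/-- `Run W P s t s'`: with words modulo `W`, the program `P` started in the memory `s` halts after
exactly `t` steps in the memory `s'`. -/
inductive Run (W : ℕ) : Program → State → ℕ → State → Prop where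
  | skip (s : State) : Run W .skip s 1 s
  | setWord (x : ℕ) (e : WExp) (s : State) :
      Run W (.setWord x e) s (e.size + 1)
        (s.setWord x (e.eval W s))
  | setReal (x : ℕ) (r : RExp) (s : State) :
      Run W (.setReal x r) s (r.size + 1)
        (s.setReal x (r.eval W s))
  | storeWord (a : ℕ) (i e : WExp) (s : State) :
      Run W (.storeWord a i e) s (i.size + e.size + 1)
        (s.storeWord a (i.eval W s) (e.eval W s))
  | storeReal (a : ℕ) (i : WExp) (r : RExp) (s : State) :
      Run W (.storeReal a i r) s (i.size + r.size + 1)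
        (s.storeReal a (i.eval W s) (r.eval W s))
  | seq {P Q : Program} {s s₁ s₂ : State} {t₁ t₂ : ℕ} :
      Run W P s t₁ s₁ → Run W Q s₁ t₂ s₂ → Run W (.seq P Q) s (t₁ + t₂) s₂
  | iteTrue {b : BExp} {P Q : Program} {s s' : State} {t : ℕ} :
      b.eval W s → Run W P s t s' → Run W (.ite b P Q) s (b.size + 1 + t) s'
  | iteFalse {b : BExp} {P Q : Program} {s s' : State} {t : ℕ} :
      ¬ b.eval W s → Run W Q s t s' → Run W (.ite b P Q) s (b.size + 1 + t) s'
  | whileTrue {b : BExp} {P : Program} {s s₁ s₂ : State} {t₁ t₂ : ℕ} :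
      b.eval W s → Run W P s t₁ s₁ → Run W (.while b P) s₁ t₂ s₂ →
        Run W (.while b P) s (b.size + 1 + t₁ + t₂) s₂
  | whileFalse {b : BExp} {P : Program} {s : State} :
      ¬ b.eval W s → Run W (.while b P) s (b.size + 1) s

/-! ## Input and output -/

/-- The memory that holds the instance `G`, whose edges are listed (in any order) by `l`.
Word variables `0`, `1`, `2` hold the numbers of jobs, machines and edges; cell `i` of the word
arrays `0` and `1` and of the real array `0` holds the job, the machine and the weight of the
`i`-th edge.  All other cells are `0`. -/
def inputState {p q : ℕ} (G : WeightedGraph (Fin p) (Fin q)) (l : List (Fin p × Fin q)) :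
    State where
  word x := if x = 0 then p else if x = 1 then q else if x = 2 then l.length else 0
  real _ := 0
  wordArr a i :=
    if h : i < l.length then
      if a = 0 then ((l.get ⟨i, h⟩).1 : ℕ) else if a = 1 then ((l.get ⟨i, h⟩).2 : ℕ) else 0
    else 0
  realArr a i := if h : i < l.length then if a = 0 then G.weight (l.get ⟨i, h⟩) else 0 else 0

/-- The set of edges written in the word array `2`: its cell `u` holds the machine of job `u`. -/
def outputEdges (p q : ℕ) (s : State) : Finset (Fin p × Fin q) :=
  Finset.univ.filter fun e => s.wordArr 2 (e.1 : ℕ) = (e.2 : ℕ)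

/-- The final memory `s` answers the instance `G`: if `G` has a semi-matching then word variable
`0` is `1` and the output is an optimal semi-matching; otherwise word variable `0` is `0`. -/
def Solves {p q : ℕ} (G : WeightedGraph (Fin p) (Fin q)) (s : State) : Prop :=
  ((∃ M, G.IsSemiMatching M) → s.word 0 = 1 ∧ G.IsOptimal (outputEdges p q s)) ∧
    ((¬ ∃ M, G.IsSemiMatching M) → s.word 0 = 0)

end SemiMatching

/-!
The problem is a minimum cost flow problem with convex costs. If `n(t)` edges of a set `S` at a
machine have a weight greater than `t`, then the cost of `S` at the machine is the integral of
`n(t) (n(t) + 1) / 2` over `t ≥ 0`. Hence, for each machine, link its edges by decreasing weight to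
a chain that ends in a common sink of weight `0`, and let every assigned job send one unit of flow
from its edge along the chain to the sink. An arc from edge `i` to its successor that carries `f`
units costs `(w i - w (nx i)) * f (f + 1) / 2`, and the total cost of the flow is the cost of the
semi-matching (`InputNet.machineCost_eq`, together with the summation by parts in
`Net.Feasible.loadCost_le`). The network has only one node and one chain arc per edge of the graph,
although there may be far more pairs of a job and a position on a machine.

The jobs are inserted one after the other, each by an augmentation along a shortest path. The
residual network (`Net.Arc`) has three kinds of arcs into a node `z`: from its predecessor on the
chain (one more unit), from its successor (take one unit back), and from the edge to which the job
of `z` is assigned at present (switch to `z`). So the distances of all `m` nodes to the sink can be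
computed by Dijkstra's algorithm with potentials, run backwards from the sink, with `m` extractions
and at most `3 m` relaxations. With a tournament tree as priority queue (`TreeOn`) this takes
`O(m log m)` steps. The correctness of this search is the invariant `Net.Search`; the distances
found are the next potential. The new job takes its edge `e` of least distance, and a unit is sent
from `e` to the sink along the tree of shortest paths. It uses only tight arcs, and each of
them once since the finishing times decrease along the path, so the new potential remains feasible
(`Net.Augment`, with convexity of the costs entering through `Net.Augment.push_forward` and
`Net.Augment.push_backward`). As the sink can be reached from every node, a semi-matching exists if
and only if every job has an edge. A feasible potential certifies optimality at the end
(`InputNet.isOptimal`).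

Sorting the chains by insertion takes `O(p)` steps for each edge, since a machine has at most one
edge for each job. All in all there are `O(p m log m)` steps, and `m ≤ p q ≤ n ^ 2`.

Programs are verified by a Hoare logic with time bounds (`Ends`) over a memory whose cells have
names (`Mem`). Straight-line code is executed symbolically (`Program.exec`); for loops there is the
rule `Ends.while`. Words stay below a constant multiple of `n + m`, so no word operation overflows
modulo `W`; this is where the bounds on `W` in the lemmas are used. The numerical constants in
the time bounds are not optimized.
-/

namespace SemiMatching

open Function (update)

/-! ### Execution of loop-free programs -/

open Classical in
/-- The effect of a program without loops; loops are skipped. -/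
noncomputable def Program.exec (W : ℕ) : Program → State → State
  | .skip, s => s
  | .setWord x e, s => s.setWord x (e.eval W s)
  | .setReal x r, s => s.setReal x (r.eval W s)
  | .storeWord a i e, s => s.storeWord a (i.eval W s) (e.eval W s)
  | .storeReal a i r, s => s.storeReal a (i.eval W s) (r.eval W s)
  | .seq P Q, s => Q.exec W (P.exec W s)
  | .ite b P Q, s => if b.eval W s then P.exec W s else Q.exec W s
  | .while _ _, s => s

theorem Program.exec_ite_pos {W : ℕ} {b : BExp} {P Q : Program} {s : State} (h : b.eval W s) :
    (Program.ite b P Q).exec W s = P.exec W s := if_pos h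

theorem Program.exec_ite_neg {W : ℕ} {b : BExp} {P Q : Program} {s : State} (h : ¬ b.eval W s) :
    (Program.ite b P Q).exec W s = Q.exec W s := if_neg h

/-- The program contains no loop. -/
def Program.LoopFree : Program → Prop
  | .seq P Q => P.LoopFree ∧ Q.LoopFree
  | .ite _ P Q => P.LoopFree ∧ Q.LoopFree
  | .while _ _ => False
  | _ => True

/-- An upper bound for the number of steps of a program without loops. -/
def Program.steps : Program → ℕ
  | .skip => 1
  | .setWord _ e => e.size + 1
  | .setReal _ r => r.size + 1
  | .storeWord _ i e => i.size + e.size + 1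
  | .storeReal _ i r => i.size + r.size + 1
  | .seq P Q => P.steps + Q.steps
  | .ite b P Q => b.size + 1 + (P.steps + Q.steps)
  | .while _ _ => 0

theorem Program.LoopFree.run {W : ℕ} {P : Program} (hP : P.LoopFree) (s : State) :
    ∃ t ≤ P.steps, Run W P s t (P.exec W s) := by
  induction P generalizing s with
  | skip => exact ⟨_, le_rfl, .skip s⟩
  | setWord x e => exact ⟨_, le_rfl, .setWord x e s⟩
  | setReal x r => exact ⟨_, le_rfl, .setReal x r s⟩
  | storeWord a i e => exact ⟨_, le_rfl, .storeWord a i e s⟩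
  | storeReal a i r => exact ⟨_, le_rfl, .storeReal a i r s⟩
  | seq P Q ihP ihQ =>
    obtain ⟨t₁, h₁, r₁⟩ := ihP hP.1 s
    obtain ⟨t₂, h₂, r₂⟩ := ihQ hP.2 (P.exec W s)
    exact ⟨_, Nat.add_le_add h₁ h₂, .seq r₁ r₂⟩
  | ite b P Q ihP ihQ =>
    by_cases hb : b.eval W s
    · obtain ⟨t, h, r⟩ := ihP hP.1 s
      refine ⟨b.size + 1 + t, ?_, ?_⟩
      · simp only [Program.steps]; omega
      · rw [Program.exec, if_pos hb]; exact .iteTrue hb r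
    · obtain ⟨t, h, r⟩ := ihQ hP.2 s
      refine ⟨b.size + 1 + t, ?_, ?_⟩
      · simp only [Program.steps]; omega
      · rw [Program.exec, if_neg hb]; exact .iteFalse hb r
  | _ => exact hP.elim

/-! ### The memory layout -/

/-- The part of the memory that the algorithm uses, with named cells.
`p`, `q`, `m` are the numbers of jobs, machines and edges; edges have the numbers `0, …, m - 1`,
the sink of the network is node `m`, and `m + 1 + v` is the head of the list of machine `v`.
`nx` and `pv` link the edges of a machine in the order of decreasing weights, `f` is the flow on
the arc from an edge to the next one, `asg` the edge of an assigned job. `st` is the status of a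
node in the search (`0` unreached, `1` queued, `2` finished), `kd` and `tgt` describe the first arc
of the path found from a node to the sink, `tree` is the tournament tree of the queue, `y` the old
and `Y` the new potential. -/
structure Mem where
  (p q m i x u ok z t e k : ℕ)
  (job mach out nx pv f asg st kd tgt tree : ℕ → ℕ)
  r : ℝ
  (w y Y : ℕ → ℝ)

/-- The machine state described by `μ`; the cells not named there are zero. -/
def Mem.toState (μ : Mem) : State where
  word
    | 0 => μ.p | 1 => μ.q | 2 => μ.m | 3 => μ.i | 4 => μ.x | 5 => μ.u | 6 => μ.ok
    | 7 => μ.z | 8 => μ.t | 9 => μ.e | 10 => μ.k | _ => 0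
  real
    | 0 => μ.r | _ => 0
  wordArr
    | 0 => μ.job | 1 => μ.mach | 2 => μ.out | 3 => μ.nx | 4 => μ.pv | 5 => μ.f
    | 6 => μ.asg | 7 => μ.st | 8 => μ.kd | 9 => μ.tgt | 10 => μ.tree | _ => 0
  realArr
    | 0 => μ.w | 1 => μ.y | 2 => μ.Y | _ => 0

section Layout

variable (μ : Mem)

@[simp] theorem Mem.word_p : μ.toState.word 0 = μ.p := rfl
@[simp] theorem Mem.word_q : μ.toState.word 1 = μ.q := rfl
@[simp] theorem Mem.word_m : μ.toState.word 2 = μ.m := rfl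
@[simp] theorem Mem.word_i : μ.toState.word 3 = μ.i := rfl
@[simp] theorem Mem.word_x : μ.toState.word 4 = μ.x := rfl
@[simp] theorem Mem.word_u : μ.toState.word 5 = μ.u := rfl
@[simp] theorem Mem.word_ok : μ.toState.word 6 = μ.ok := rfl
@[simp] theorem Mem.word_z : μ.toState.word 7 = μ.z := rfl
@[simp] theorem Mem.word_t : μ.toState.word 8 = μ.t := rfl
@[simp] theorem Mem.word_e : μ.toState.word 9 = μ.e := rfl
@[simp] theorem Mem.word_k : μ.toState.word 10 = μ.k := rfl
@[simp] theorem Mem.real_r : μ.toState.real 0 = μ.r := rfl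
@[simp] theorem Mem.arr_job : μ.toState.wordArr 0 = μ.job := rfl
@[simp] theorem Mem.arr_mach : μ.toState.wordArr 1 = μ.mach := rfl
@[simp] theorem Mem.arr_out : μ.toState.wordArr 2 = μ.out := rfl
@[simp] theorem Mem.arr_nx : μ.toState.wordArr 3 = μ.nx := rfl
@[simp] theorem Mem.arr_pv : μ.toState.wordArr 4 = μ.pv := rfl
@[simp] theorem Mem.arr_f : μ.toState.wordArr 5 = μ.f := rfl
@[simp] theorem Mem.arr_asg : μ.toState.wordArr 6 = μ.asg := rfl
@[simp] theorem Mem.arr_st : μ.toState.wordArr 7 = μ.st := rfl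
@[simp] theorem Mem.arr_kd : μ.toState.wordArr 8 = μ.kd := rfl
@[simp] theorem Mem.arr_tgt : μ.toState.wordArr 9 = μ.tgt := rfl
@[simp] theorem Mem.arr_tree : μ.toState.wordArr 10 = μ.tree := rfl
@[simp] theorem Mem.arr_w : μ.toState.realArr 0 = μ.w := rfl
@[simp] theorem Mem.arr_y : μ.toState.realArr 1 = μ.y := rfl
@[simp] theorem Mem.arr_Y : μ.toState.realArr 2 = μ.Y := rfl

variable (v i : ℕ) (r : ℝ)

@[simp] theorem Mem.set_p : μ.toState.setWord 0 v = Mem.toState { μ with p := v } := by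
  simp only [State.setWord, Mem.toState, State.mk.injEq, and_true]
  funext n; rcases n with _|_|_|_|_|_|_|_|_|_|_|n <;> rfl
@[simp] theorem Mem.set_i : μ.toState.setWord 3 v = Mem.toState { μ with i := v } := by
  simp only [State.setWord, Mem.toState, State.mk.injEq, and_true]
  funext n; rcases n with _|_|_|_|_|_|_|_|_|_|_|n <;> rfl
@[simp] theorem Mem.set_x : μ.toState.setWord 4 v = Mem.toState { μ with x := v } := by
  simp only [State.setWord, Mem.toState, State.mk.injEq, and_true]
  funext n; rcases n with _|_|_|_|_|_|_|_|_|_|_|n <;> rfl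
@[simp] theorem Mem.set_u : μ.toState.setWord 5 v = Mem.toState { μ with u := v } := by
  simp only [State.setWord, Mem.toState, State.mk.injEq, and_true]
  funext n; rcases n with _|_|_|_|_|_|_|_|_|_|_|n <;> rfl
@[simp] theorem Mem.set_ok : μ.toState.setWord 6 v = Mem.toState { μ with ok := v } := by
  simp only [State.setWord, Mem.toState, State.mk.injEq, and_true]
  funext n; rcases n with _|_|_|_|_|_|_|_|_|_|_|n <;> rfl
@[simp] theorem Mem.set_z : μ.toState.setWord 7 v = Mem.toState { μ with z := v } := by
  simp only [State.setWord, Mem.toState, State.mk.injEq, and_true]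
  funext n; rcases n with _|_|_|_|_|_|_|_|_|_|_|n <;> rfl
@[simp] theorem Mem.set_t : μ.toState.setWord 8 v = Mem.toState { μ with t := v } := by
  simp only [State.setWord, Mem.toState, State.mk.injEq, and_true]
  funext n; rcases n with _|_|_|_|_|_|_|_|_|_|_|n <;> rfl
@[simp] theorem Mem.set_e : μ.toState.setWord 9 v = Mem.toState { μ with e := v } := by
  simp only [State.setWord, Mem.toState, State.mk.injEq, and_true]
  funext n; rcases n with _|_|_|_|_|_|_|_|_|_|_|n <;> rfl
@[simp] theorem Mem.set_k : μ.toState.setWord 10 v = Mem.toState { μ with k := v } := by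
  simp only [State.setWord, Mem.toState, State.mk.injEq, and_true]
  funext n; rcases n with _|_|_|_|_|_|_|_|_|_|_|n <;> rfl
@[simp] theorem Mem.set_r : μ.toState.setReal 0 r = Mem.toState { μ with r := r } := by
  simp only [State.setReal, Mem.toState, State.mk.injEq, and_true, true_and]
  funext n; rcases n with _|n <;> rfl

@[simp] theorem Mem.store_out :
    μ.toState.storeWord 2 i v = Mem.toState { μ with out := update μ.out i v } := by
  simp only [State.storeWord, Mem.toState, State.mk.injEq, and_true, true_and]
  funext n; rcases n with _|_|_|_|_|_|_|_|_|_|_|n <;> rfl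
@[simp] theorem Mem.store_nx :
    μ.toState.storeWord 3 i v = Mem.toState { μ with nx := update μ.nx i v } := by
  simp only [State.storeWord, Mem.toState, State.mk.injEq, and_true, true_and]
  funext n; rcases n with _|_|_|_|_|_|_|_|_|_|_|n <;> rfl
@[simp] theorem Mem.store_pv :
    μ.toState.storeWord 4 i v = Mem.toState { μ with pv := update μ.pv i v } := by
  simp only [State.storeWord, Mem.toState, State.mk.injEq, and_true, true_and]
  funext n; rcases n with _|_|_|_|_|_|_|_|_|_|_|n <;> rfl
@[simp] theorem Mem.store_f :
    μ.toState.storeWord 5 i v = Mem.toState { μ with f := update μ.f i v } := by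
  simp only [State.storeWord, Mem.toState, State.mk.injEq, and_true, true_and]
  funext n; rcases n with _|_|_|_|_|_|_|_|_|_|_|n <;> rfl
@[simp] theorem Mem.store_asg :
    μ.toState.storeWord 6 i v = Mem.toState { μ with asg := update μ.asg i v } := by
  simp only [State.storeWord, Mem.toState, State.mk.injEq, and_true, true_and]
  funext n; rcases n with _|_|_|_|_|_|_|_|_|_|_|n <;> rfl
@[simp] theorem Mem.store_st :
    μ.toState.storeWord 7 i v = Mem.toState { μ with st := update μ.st i v } := by
  simp only [State.storeWord, Mem.toState, State.mk.injEq, and_true, true_and]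
  funext n; rcases n with _|_|_|_|_|_|_|_|_|_|_|n <;> rfl
@[simp] theorem Mem.store_kd :
    μ.toState.storeWord 8 i v = Mem.toState { μ with kd := update μ.kd i v } := by
  simp only [State.storeWord, Mem.toState, State.mk.injEq, and_true, true_and]
  funext n; rcases n with _|_|_|_|_|_|_|_|_|_|_|n <;> rfl
@[simp] theorem Mem.store_tgt :
    μ.toState.storeWord 9 i v = Mem.toState { μ with tgt := update μ.tgt i v } := by
  simp only [State.storeWord, Mem.toState, State.mk.injEq, and_true, true_and]
  funext n; rcases n with _|_|_|_|_|_|_|_|_|_|_|n <;> rfl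
@[simp] theorem Mem.store_tree :
    μ.toState.storeWord 10 i v = Mem.toState { μ with tree := update μ.tree i v } := by
  simp only [State.storeWord, Mem.toState, State.mk.injEq, and_true, true_and]
  funext n; rcases n with _|_|_|_|_|_|_|_|_|_|_|n <;> rfl
@[simp] theorem Mem.store_y :
    μ.toState.storeReal 1 i r = Mem.toState { μ with y := update μ.y i r } := by
  simp only [State.storeReal, Mem.toState, State.mk.injEq, true_and]
  funext n; rcases n with _|_|_|n <;> rfl
@[simp] theorem Mem.store_Y :
    μ.toState.storeReal 2 i r = Mem.toState { μ with Y := update μ.Y i r } := by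
  simp only [State.storeReal, Mem.toState, State.mk.injEq, true_and]
  funext n; rcases n with _|_|_|n <;> rfl

end Layout

/-! ### Total correctness with a time bound -/

/-- Started in `μ`, the program halts after at most `T` steps in a memory that satisfies `Q`. -/
def Ends (W : ℕ) (P : Program) (μ : Mem) (T : ℕ) (Q : Mem → Prop) : Prop :=
  ∃ (t : ℕ) (μ' : Mem), Run W P μ.toState t μ'.toState ∧ t ≤ T ∧ Q μ'

section Rules

variable {W : ℕ} {P P' : Program} {μ μ' : Mem} {T T₁ T₂ : ℕ} {Q R : Mem → Prop} {b : BExp}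

theorem Ends.mono (h : Ends W P μ T₁ R) (hT : T₁ ≤ T) (hQ : ∀ μ', R μ' → Q μ') :
    Ends W P μ T Q := by
  obtain ⟨t, μ', r, ht, hR⟩ := h
  exact ⟨t, μ', r, ht.trans hT, hQ _ hR⟩

theorem Ends.of_exec (hP : P.LoopFree) (h : P.exec W μ.toState = μ'.toState) (hT : P.steps ≤ T)
    (hQ : Q μ') : Ends W P μ T Q := by
  obtain ⟨t, ht, r⟩ := hP.run (W := W) μ.toState
  rw [h] at r
  exact ⟨t, μ', r, ht.trans hT, hQ⟩

theorem Ends.seq (h₁ : Ends W P μ T₁ R) (h₂ : ∀ μ', R μ' → Ends W P' μ' T₂ Q)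
    (hT : T₁ + T₂ ≤ T) : Ends W (.seq P P') μ T Q := by
  obtain ⟨t₁, μ₁, r₁, ht₁, hR⟩ := h₁
  obtain ⟨t₂, μ₂, r₂, ht₂, hQ⟩ := h₂ μ₁ hR
  exact ⟨_, μ₂, .seq r₁ r₂, by omega, hQ⟩

theorem Ends.ite (h₁ : b.eval W μ.toState → Ends W P μ T₁ Q)
    (h₂ : ¬ b.eval W μ.toState → Ends W P' μ T₁ Q) (hT : b.size + 1 + T₁ ≤ T) :
    Ends W (.ite b P P') μ T Q := by
  by_cases hb : b.eval W μ.toState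
  · obtain ⟨t, μ', r, ht, hQ⟩ := h₁ hb
    exact ⟨_, μ', .iteTrue hb r, by omega, hQ⟩
  · obtain ⟨t, μ', r, ht, hQ⟩ := h₂ hb
    exact ⟨_, μ', .iteFalse hb r, by omega, hQ⟩

/-- The rule for loops: `I n μ` says that the invariant holds in `μ` and that at most `n` further
iterations are needed. -/
theorem Ends.while (I : ℕ → Mem → Prop)
    (h : ∀ n μ, I n μ → b.eval W μ.toState → Ends W P μ T₁ fun μ' => ∃ n' < n, I n' μ')
    {n : ℕ} (hI : I n μ) (hT : (n + 1) * (T₁ + b.size + 1) ≤ T)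
    (hQ : ∀ n μ', I n μ' → ¬ b.eval W μ'.toState → Q μ') :
    Ends W (.while b P) μ T Q := by
  refine Ends.mono (R := Q) (T₁ := (n + 1) * (T₁ + b.size + 1)) ?_ hT fun _ h => h
  clear hT
  induction n using Nat.strong_induction_on generalizing μ with
  | _ n ih =>
    by_cases hb : b.eval W μ.toState
    · obtain ⟨t₁, μ₁, r₁, ht₁, n', hn', hI'⟩ := h n μ hI hb
      obtain ⟨t₂, μ₂, r₂, ht₂, hQ₂⟩ := ih n' hn' hI'
      refine ⟨_, μ₂, .whileTrue hb r₁ r₂, ?_, hQ₂⟩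
      have h3 : (n' + 1) * (T₁ + b.size + 1) ≤ n * (T₁ + b.size + 1) :=
        Nat.mul_le_mul_right _ hn'
      have h4 : (n + 1) * (T₁ + b.size + 1) = n * (T₁ + b.size + 1) + (T₁ + b.size + 1) := by
        ring
      omega
    · refine ⟨_, μ, .whileFalse hb, ?_, hQ n μ hI hb⟩
      have h4 : (n + 1) * (T₁ + b.size + 1) = n * (T₁ + b.size + 1) + (T₁ + b.size + 1) := by
        ring
      omega

end Rules

/-! ### The algorithm -/

/-- Sequential composition. -/
infixr:30 " ;; " => Program.seq

/-- Strict comparison of words. -/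
abbrev BExp.lt (e f : WExp) : BExp := .not (.wordLE f e)

namespace Code

/-! ### Names for the cells of the memory -/

abbrev vP : WExp := .var 0
abbrev vQ : WExp := .var 1
abbrev vM : WExp := .var 2
abbrev vI : WExp := .var 3
abbrev vX : WExp := .var 4
abbrev vU : WExp := .var 5
abbrev vOk : WExp := .var 6
abbrev vZ : WExp := .var 7
abbrev vT : WExp := .var 8
abbrev vE : WExp := .var 9
abbrev vK : WExp := .var 10
abbrev jobOf (e : WExp) : WExp := .get 0 e
abbrev machOf (e : WExp) : WExp := .get 1 e
abbrev nxOf (e : WExp) : WExp := .get 3 e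
abbrev pvOf (e : WExp) : WExp := .get 4 e
abbrev fOf (e : WExp) : WExp := .get 5 e
abbrev asgOf (e : WExp) : WExp := .get 6 e
abbrev stOf (e : WExp) : WExp := .get 7 e
abbrev kdOf (e : WExp) : WExp := .get 8 e
abbrev tgtOf (e : WExp) : WExp := .get 9 e
abbrev treeOf (e : WExp) : WExp := .get 10 e
abbrev vR : RExp := .var 0
abbrev wOf (e : WExp) : RExp := .get 0 e
abbrev yOf (e : WExp) : RExp := .get 1 e
abbrev YOf (e : WExp) : RExp := .get 2 e
abbrev inc (e : WExp) : WExp := .add e (.const 1)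

/-- Empty lists for all machines. -/
def initHeads : Program :=
  .setWord 3 (.const 0) ;;
  .while (.lt vI vQ) (.storeWord 3 (.add (inc vM) vI) vM ;; .setWord 3 (inc vI))

/-- Find the place of edge `i` in the list of its machine. -/
def walk : Program :=
  .while (.not (.realLE (wOf (nxOf vX)) (wOf vI))) (.setWord 4 (nxOf vX))

/-- Put edge `i` behind node `x`. -/
def link : Program :=
  .storeWord 4 (nxOf vX) vI ;; .storeWord 3 vI (nxOf vX) ;;
  .storeWord 4 vI vX ;; .storeWord 3 vX vI ;; .setWord 3 (inc vI)

/-- Sort the edges of every machine by decreasing weight (insertion into linked lists). -/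
def insertAll : Program :=
  .setWord 3 (.const 0) ;;
  .while (.lt vI vM) (.setWord 4 (.add (inc vM) (machOf vI)) ;; walk ;; link)

/-- Node `d` is queued, and if node `c` is queued too, the key of `d` is not greater. -/
def better (d c : WExp) : BExp :=
  .and (.wordEq (stOf d) (.const 1))
    (.or (.not (.wordEq (stOf c) (.const 1)))
      (.realLE (.sub (YOf d) (yOf d)) (.sub (YOf c) (yOf c))))

/-- Recompute the winner at the inner node `t` of the tournament tree. -/
def pull : Program :=
  .ite (better (treeOf (.mul (.const 2) vT)) (treeOf (inc (.mul (.const 2) vT))))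
    (.storeWord 10 vT (treeOf (.mul (.const 2) vT)))
    (.storeWord 10 vT (treeOf (inc (.mul (.const 2) vT))))

/-- Recompute the winners above the leaf of `x`. -/
def sift : Program :=
  .setWord 8 (.div (.add vM vX) (.const 2)) ;;
  .while (.wordLE (.const 1) vT) (pull ;; .setWord 8 (.div vT (.const 2)))

/-- Offer node `x` a path of cost `r` whose first arc has kind `k` and leads to `z`. -/
def relax : Program :=
  .ite (.or (.wordEq (stOf vX) (.const 0))
      (.and (.wordEq (stOf vX) (.const 1)) (.not (.realLE (YOf vX) vR))))
    ((.storeReal 2 vX vR ;; .storeWord 7 vX (.const 1) ;;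
      .storeWord 8 vX vK ;; .storeWord 9 vX vZ) ;; sift)
    .skip

/-- Start of the search: save the potentials and queue the nodes with an arc to the sink. -/
def initSearch : Program :=
  .setWord 3 (.const 0) ;;
  .while (.lt vI vM)
    (.storeReal 1 vI (YOf vI) ;; .storeWord 10 (.add vM vI) vI ;;
    .ite (.wordEq (nxOf vI) vM)
      (.storeWord 7 vI (.const 1) ;; .storeWord 8 vI (.const 0) ;; .storeWord 9 vI vM ;;
        .storeReal 2 vI (.scale (inc (fOf vI)) (wOf vI)))
      (.storeWord 7 vI (.const 0)) ;;
    .setWord 3 (inc vI))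

/-- Build the tournament tree. -/
def build : Program :=
  .setWord 8 vM ;;
  .while (.lt (.const 1) vT) (.setWord 8 (.sub vT (.const 1)) ;; pull)

/-- Finish the queued node with the least key. -/
def pop : Program :=
  (.setWord 7 (treeOf (.const 1)) ;; .setWord 4 vZ ;; .storeWord 7 vX (.const 2)) ;; sift

/-- Relax the arc into `z` from its predecessor on the chain. -/
def relaxForward : Program :=
  .setWord 4 (pvOf vZ) ;;
  .ite (.lt vX vM)
    ((.setReal 0 (.add (YOf vZ) (.scale (inc (fOf vX)) (.sub (wOf vX) (wOf vZ)))) ;;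
      .setWord 10 (.const 0)) ;; relax)
    .skip

/-- Relax the residual arc into `z` from its successor on the chain. -/
def relaxBackward : Program :=
  .setWord 4 (nxOf vZ) ;;
  .ite (.and (.lt vX vM) (.lt (.const 0) (fOf vZ)))
    ((.setReal 0 (.sub (YOf vZ) (.scale (fOf vZ) (.sub (wOf vZ) (wOf vX)))) ;;
      .setWord 10 (.const 1)) ;; relax)
    .skip

/-- Relax the arc into `z` from the edge to which the job of `z` is assigned. -/
def relaxSwitch : Program :=
  .ite (.lt (jobOf vZ) vU)
    ((.setWord 4 (asgOf (jobOf vZ)) ;; .setReal 0 (YOf vZ) ;; .setWord 10 (.const 2)) ;; relax)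
    .skip

/-- Shortest paths from all nodes to the sink. -/
def search : Program :=
  initSearch ;; build ;;
  .while (.wordEq (stOf (treeOf (.const 1))) (.const 1))
    (pop ;; relaxForward ;; relaxBackward ;; relaxSwitch)

/-- Among the edges of job `u`, find one with least potential. -/
def findEdge : Program :=
  (.setWord 9 vM ;; .setWord 3 (.const 0)) ;;
  .while (.lt vI vM)
    (.ite (.and (.wordEq (jobOf vI) vU)
        (.or (.wordEq vE vM) (.not (.realLE (YOf vE) (YOf vI)))))
      (.setWord 9 vI) .skip ;;
    .setWord 3 (inc vI))

/-- Send one unit along the first arc of the path from `x`. -/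
def push : Program :=
  .ite (.wordEq (kdOf vX) (.const 0)) (.storeWord 5 vX (inc (fOf vX)))
    (.ite (.wordEq (kdOf vX) (.const 1))
      (.storeWord 5 (tgtOf vX) (.sub (fOf (tgtOf vX)) (.const 1)))
      (.storeWord 6 (jobOf vX) (tgtOf vX))) ;;
  .setWord 4 (tgtOf vX)

/-- Assign job `u` to the edge `e` found and send one unit from there to the sink; without such an
edge, record that there is no semi-matching. -/
def augment : Program :=
  .ite (.lt vE vM)
    ((.storeWord 6 vU vE ;; .setWord 4 vE) ;; .while (.lt vX vM) push)
    (.setWord 6 (.const 0))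

/-- Assign all jobs, one after the other. -/
def assignAll : Program :=
  (.setWord 6 (.const 1) ;; .setWord 5 (.const 0)) ;;
  .while (.lt vU vP) (search ;; findEdge ;; augment ;; .setWord 5 (inc vU))

/-- Write the result. -/
def output : Program :=
  .setWord 5 (.const 0) ;;
  .while (.lt vU vP) (.storeWord 2 vU (machOf (asgOf vU)) ;; .setWord 5 (inc vU)) ;;
  .setWord 0 vOk

/-- The whole algorithm. -/
def main : Program :=
  initHeads ;; insertAll ;; assignAll ;; output

end Code

/-! ### The tournament tree -/

/-- If node `c` is queued, then so is `d`, with a key `Y d - y d` that is not greater. -/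
def Beats (st : ℕ → ℕ) (Y y : ℕ → ℝ) (d c : ℕ) : Prop :=
  st c = 1 → st d = 1 ∧ Y d - y d ≤ Y c - y c

theorem Beats.refl {st : ℕ → ℕ} {Y y : ℕ → ℝ} (d : ℕ) : Beats st Y y d d := fun h => ⟨h, le_rfl⟩

theorem Beats.trans {st : ℕ → ℕ} {Y y : ℕ → ℝ} {d c b : ℕ} (h₁ : Beats st Y y d c)
    (h₂ : Beats st Y y c b) : Beats st Y y d b := fun h =>
  ⟨(h₁ (h₂ h).1).1, (h₁ (h₂ h).1).2.trans (h₂ h).2⟩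

/-- A tournament tree over `0, …, m - 1`: the children of node `j` are `2 j` and `2 j + 1`, the
leaves are `m, …, 2 m - 1`, and `tree j` is the winner among the leaves below `j`. The entries at
the nodes in `bad` may be out of date. -/
structure TreeOn (m : ℕ) (tree st : ℕ → ℕ) (Y y : ℕ → ℝ) (bad : ℕ → Prop) : Prop where
  leaf : ∀ i < m, tree (m + i) = i
  desc : ∀ j, 1 ≤ j → j < 2 * m → ¬ bad j → tree j < m ∧ ∃ r, (m + tree j) / 2 ^ r = j
  beats : ∀ j, 2 ≤ j → j < 2 * m → ¬ bad (j / 2) → Beats st Y y (tree (j / 2)) (tree j)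

namespace TreeOn

variable {m : ℕ} {tree st st' : ℕ → ℕ} {Y Y' y : ℕ → ℝ} {bad bad' : ℕ → Prop}

theorem mono (h : TreeOn m tree st Y y bad) (hb : ∀ j, 1 ≤ j → bad j → bad' j) :
    TreeOn m tree st Y y bad' where
  leaf := h.leaf
  desc j h1 h2 h3 := h.desc j h1 h2 fun h4 => h3 (hb j h1 h4)
  beats j h1 h2 h3 := h.beats j h1 h2 fun h4 => h3 (hb _ (by omega) h4)

/-- Recomputing the winner at `t` brings `t` up to date; its parent has to be recomputed later. -/
theorem pull (h : TreeOn m tree st Y y bad) {t a : ℕ} (ht : 1 ≤ t) (htm : t < m)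
    (h1 : ¬ bad (2 * t)) (h2 : ¬ bad (2 * t + 1)) (h3 : 2 ≤ t → bad (t / 2))
    (ha : a = tree (2 * t) ∨ a = tree (2 * t + 1))
    (hb1 : Beats st Y y a (tree (2 * t))) (hb2 : Beats st Y y a (tree (2 * t + 1))) :
    TreeOn m (update tree t a) st Y y fun j => bad j ∧ j ≠ t where
  leaf i hi := by
    rw [Function.update_of_ne (by omega)]; exact h.leaf i hi
  desc j hj hj2 hbad := by
    by_cases hjt : j = t
    · subst hjt
      rw [Function.update_self]
      rcases ha with rfl | rfl
      · obtain ⟨e1, r, e2⟩ := h.desc (2 * j) (by omega) (by omega) h1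
        refine ⟨e1, r + 1, ?_⟩
        rw [pow_succ, ← Nat.div_div_eq_div_mul, e2]; omega
      · obtain ⟨e1, r, e2⟩ := h.desc (2 * j + 1) (by omega) (by omega) h2
        refine ⟨e1, r + 1, ?_⟩
        rw [pow_succ, ← Nat.div_div_eq_div_mul, e2]; omega
    · rw [Function.update_of_ne hjt]
      exact h.desc j hj hj2 fun hc => hbad ⟨hc, hjt⟩
  beats j hj hj2 hbad := by
    by_cases hjt : j / 2 = t
    · rw [hjt, Function.update_self, Function.update_of_ne (by omega)]
      obtain rfl | rfl : j = 2 * t ∨ j = 2 * t + 1 := by omega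
      · exact hb1
      · exact hb2
    · have hb : ¬ bad (j / 2) := fun hc => hbad ⟨hc, hjt⟩
      have : j ≠ t := by
        rintro rfl
        exact hb (h3 hj)
      rw [Function.update_of_ne hjt, Function.update_of_ne this]
      exact h.beats j hj hj2 hb

/-- Changing the status and the key of `x` invalidates only the ancestors of the leaf of `x`. -/
theorem touch (h : TreeOn m tree st Y y fun _ => False) {x : ℕ}
    (hst : ∀ i, i ≠ x → st' i = st i) (hY : ∀ i, i ≠ x → Y' i = Y i) :
    TreeOn m tree st' Y' y fun j => ∃ r, j = (m + x) / 2 / 2 ^ r where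
  leaf := h.leaf
  desc j hj hj2 _ := h.desc j hj hj2 not_false
  beats j hj hj2 hbad := by
    have key : ∀ {k}, 1 ≤ k → k < 2 * m → tree k = x → ∃ r, k / 2 = (m + x) / 2 / 2 ^ r := by
      intro k hk hk2 hkx
      obtain ⟨-, r, hr⟩ := h.desc k hk hk2 not_false
      rw [hkx] at hr
      exact ⟨r, by rw [← hr, Nat.div_div_eq_div_mul, Nat.div_div_eq_div_mul, mul_comm]⟩
    have h1 : tree j ≠ x := fun hc => hbad (key (by omega) hj2 hc)
    have h2 : tree (j / 2) ≠ x := by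
      intro hc
      obtain ⟨-, r, hr⟩ := h.desc (j / 2) (by omega) (by omega) not_false
      rw [hc] at hr
      rcases r with _ | r
      · -- an inner node is not a leaf
        simp at hr; omega
      · exact hbad ⟨r, by rw [← hr, pow_succ', Nat.div_div_eq_div_mul]⟩
    have := h.beats j hj hj2 not_false
    unfold Beats at this ⊢
    rwa [hst _ h1, hst _ h2, hY _ h1, hY _ h2]

theorem root_lt (h : TreeOn m tree st Y y fun _ => False) (hm : 1 ≤ m) : tree 1 < m :=
  (h.desc 1 le_rfl (by omega) not_false).1

/-- The winner at the root is a queued node of least key, if any node is queued. -/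
theorem root_beats (h : TreeOn m tree st Y y fun _ => False) {i : ℕ} (hi : i < m) :
    Beats st Y y (tree 1) i := by
  have key : ∀ j, 1 ≤ j → j < 2 * m → Beats st Y y (tree 1) (tree j) := by
    intro j
    induction j using Nat.strong_induction_on with
    | _ j ih =>
      intro hj hj2
      by_cases h1 : j = 1
      · subst h1; exact .refl _
      · exact (ih (j / 2) (by omega) (by omega) (by omega)).trans
          (h.beats j (by omega) hj2 not_false)
  have := key (m + i) (by omega) (by omega)
  rwa [h.leaf i hi] at this

end TreeOn

/-! ### The network -/

/-- The chains of edges: `nx` and `pv` link the edges of one machine, node `m` is the sink. -/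
structure Net where
  m : ℕ
  (job nx pv : ℕ → ℕ)
  w : ℕ → ℝ

/-- The links are consistent, weights decrease along chains, and all chains end in the sink
(the last field is induction along a chain, starting from the sink). -/
structure Net.Good (N : Net) : Prop where
  nx_le : ∀ i < N.m, N.nx i ≤ N.m
  pv_nx : ∀ i < N.m, N.nx i < N.m → N.pv (N.nx i) = i
  nx_pv : ∀ i < N.m, N.pv i < N.m → N.nx (N.pv i) = i
  w_sink : N.w N.m = 0
  w_nx : ∀ i < N.m, N.w (N.nx i) ≤ N.w i
  ind : ∀ P : ℕ → Prop, P N.m → (∀ i < N.m, P (N.nx i) → P i) → ∀ i < N.m, P i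

/-- `N.Arc u f asg k x z c`: the residual network of the flow `f`, in which the jobs less than `u`
are assigned to the edges `asg`, has an arc of kind `k` and cost `c` from `x` to `z`. It sends one
more unit along the chain (kind `0`), takes one unit back (kind `1`), or moves a job to another
edge (kind `2`). -/
inductive Net.Arc (N : Net) (u : ℕ) (f asg : ℕ → ℕ) : ℕ → ℕ → ℕ → ℝ → Prop
  | forward (x : ℕ) (hx : x < N.m) :
      N.Arc u f asg 0 x (N.nx x) ((N.w x - N.w (N.nx x)) * (f x + 1))
  | backward (z : ℕ) (hz : z < N.m) (hf : 0 < f z) :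
      N.Arc u f asg 1 (N.nx z) z (-((N.w z - N.w (N.nx z)) * f z))
  | switch (z : ℕ) (hz : z < N.m) (hj : N.job z < u) :
      N.Arc u f asg 2 (asg (N.job z)) z 0

theorem Net.Arc.kind_lt {N : Net} {u : ℕ} {f asg : ℕ → ℕ} {k x z : ℕ} {c : ℝ}
    (h : N.Arc u f asg k x z c) : k < 3 := by
  cases h <;> omega

/-- The assignment `asg` of the jobs less than `u` carries the flow `f`, and the potential `y`
shows that there is no negative cycle in the residual network. -/
structure Net.Feasible (N : Net) (u : ℕ) (f asg : ℕ → ℕ) (y : ℕ → ℝ) : Prop where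
  asg_lt : ∀ i < N.m, N.job i < u → asg (N.job i) < N.m
  job_asg : ∀ i < N.m, N.job i < u → N.job (asg (N.job i)) = N.job i
  sink : y N.m = 0
  arc : ∀ {k x z c}, N.Arc u f asg k x z c → y x ≤ c + y z
  flow : ∀ i < N.m, f i = (if N.pv i < N.m then f (N.pv i) else 0) +
    if N.job i < u ∧ asg (N.job i) = i then 1 else 0
  f_le : ∀ i < N.m, f i ≤ u

/-! ### The search for shortest paths -/

/-- The set of finished nodes. -/
def finished (m : ℕ) (st : ℕ → ℕ) : Finset ℕ := (Finset.range m).filter fun x => st x = 2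

/-- The invariant of the search. `Y` is the tentative distance of the reached nodes, whose paths
start with an arc of kind `kd` to the finished node (or sink) `tgt`. The node finished last is `z`,
and its incoming arcs of kinds less than `κ` are relaxed already. `τ` is the time when a node was
finished. -/
structure Net.Search (N : Net) (u : ℕ) (f asg : ℕ → ℕ) (y : ℕ → ℝ) (st kd tgt : ℕ → ℕ)
    (Y : ℕ → ℝ) (τ : ℕ → ℕ) (z κ : ℕ) : Prop where
  sink : Y N.m = 0
  sink_time : τ N.m = 0
  le : ∀ x < N.m, st x ≠ 0 → y x ≤ Y x
  st_le : ∀ x < N.m, st x ≤ 2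
  path : ∀ x < N.m, st x ≠ 0 → ∃ c, N.Arc u f asg (kd x) x (tgt x) c ∧ Y x = c + Y (tgt x)
  tgt_done : ∀ x < N.m, st x ≠ 0 → tgt x = N.m ∨ tgt x < N.m ∧ st (tgt x) = 2
  order : ∀ s x, s < N.m → x < N.m → st s = 2 → st x = 1 → Y s - y s ≤ Y x - y x
  last : ∀ s < N.m, st s = 2 → Y s - y s ≤ Y z - y z
  relaxed : ∀ {k x s c}, N.Arc u f asg k x s c → x < N.m → (s = N.m ∨ s < N.m ∧ st s = 2) →
    (s = z → k < κ) → st x ≠ 0 ∧ Y x ≤ c + Y s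
  time : ∀ x < N.m, st x = 2 → τ (tgt x) < τ x
  time_le : ∀ x < N.m, st x = 2 → τ x ≤ (finished N.m st).card

/-- The result of the search: distances `Y` to the sink, and the first arcs `kd`, `tgt` of shortest
paths; along these paths `τ` decreases. -/
structure Net.Shortest (N : Net) (u : ℕ) (f asg : ℕ → ℕ) (kd tgt : ℕ → ℕ) (Y : ℕ → ℝ)
    (τ : ℕ → ℕ) : Prop where
  sink : Y N.m = 0
  arc : ∀ {k x z c}, N.Arc u f asg k x z c → Y x ≤ c + Y z
  path : ∀ x < N.m, ∃ c, N.Arc u f asg (kd x) x (tgt x) c ∧ Y x = c + Y (tgt x)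
  tgt_le : ∀ x < N.m, tgt x ≤ N.m
  time : ∀ x < N.m, τ (tgt x) < τ x
  time_le : ∀ x < N.m, τ x ≤ N.m

namespace Net

variable {N : Net} {u : ℕ} {f asg : ℕ → ℕ} {y : ℕ → ℝ} {st kd tgt : ℕ → ℕ} {Y : ℕ → ℝ}
  {τ : ℕ → ℕ} {z κ : ℕ}

/-- The end points of an arc are nodes of the network. -/
theorem Feasible.arc_le (hy : N.Feasible u f asg y) (hN : N.Good) {k x s : ℕ} {c : ℝ}
    (ha : N.Arc u f asg k x s c) : x ≤ N.m ∧ s ≤ N.m := by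
  cases ha with
  | forward x hx => exact ⟨hx.le, hN.nx_le _ hx⟩
  | backward x hx => exact ⟨hN.nx_le _ hx, hx.le⟩
  | switch x hx hj => exact ⟨(hy.asg_lt _ hx hj).le, hx.le⟩

theorem Feasible.congr (hy : N.Feasible u f asg y) (hN : N.Good) {y' : ℕ → ℝ}
    (h : ∀ i ≤ N.m, y' i = y i) : N.Feasible u f asg y' :=
  { hy with
    sink := (h _ le_rfl).trans hy.sink
    arc := fun {k x z c} ha => by
      rw [h _ (hy.arc_le hN ha).1, h _ (hy.arc_le hN ha).2]
      exact hy.arc ha }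

/-- Before the first extraction, only the nodes with a chain arc to the sink are reached. No node has
been finished yet, so the sink takes the place of the node finished last. -/
theorem Search.start (hN : N.Good) (hy : N.Feasible u f asg y) (hsink : Y N.m = 0)
    (h1 : ∀ x < N.m, N.nx x = N.m → st x = 1 ∧ kd x = 0 ∧ tgt x = N.m ∧ Y x = (f x + 1) * N.w x)
    (h0 : ∀ x < N.m, N.nx x ≠ N.m → st x = 0) :
    N.Search u f asg y st kd tgt Y (fun _ => 0) N.m 3 := by
  have hr : ∀ x < N.m, st x ≠ 0 → N.nx x = N.m := fun x hx h => by
    by_contra hc; exact h (h0 x hx hc)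
  have h2 : ∀ x < N.m, st x ≠ 2 := fun x hx h => by
    have := h1 x hx (hr x hx (by omega))
    omega
  have hp : ∀ x < N.m, st x ≠ 0 →
      ∃ c, N.Arc u f asg (kd x) x (tgt x) c ∧ Y x = c + Y (tgt x) := fun x hx h => by
    obtain ⟨-, e2, e3, e4⟩ := h1 x hx (hr x hx h)
    refine ⟨(N.w x - N.w (N.nx x)) * (f x + 1), ?_, ?_⟩
    · rw [e2, e3, ← hr x hx h]; exact .forward x hx
    · rw [e3, hsink, e4, hr x hx h, hN.w_sink]; ring
  refine ⟨hsink, rfl, ?_, ?_, hp, ?_, ?_, ?_, ?_, ?_, ?_⟩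
  · intro x hx h
    obtain ⟨c, e1, e2⟩ := hp x hx h
    have := hy.arc e1
    rw [(h1 x hx (hr x hx h)).2.2.1] at this e2
    rw [e2, hsink]; rwa [hy.sink] at this
  · intro x hx
    by_cases hc : N.nx x = N.m
    · rw [(h1 x hx hc).1]; omega
    · rw [h0 x hx hc]; omega
  · exact fun x hx h => .inl (h1 x hx (hr x hx h)).2.2.1
  · exact fun s x hs _ h => absurd h (h2 s hs)
  · exact fun s hs h => absurd h (h2 s hs)
  · intro k x s c ha hx hs _
    obtain rfl : s = N.m := hs.resolve_right fun h => h2 s h.1 h.2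
    have key : k = 0 ∧ N.nx x = N.m ∧ c = (N.w x - N.w (N.nx x)) * (f x + 1) := by
      generalize hs : N.m = s at *
      cases ha with
      | forward => exact ⟨rfl, rfl, rfl⟩
      | backward z hz => omega
      | switch z hz => omega
    obtain ⟨e1, -, -, e4⟩ := h1 x hx key.2.1
    refine ⟨by omega, ?_⟩
    rw [hsink, e4, key.2.2, key.2.1, hN.w_sink]
    exact le_of_eq (by ring)
  · exact fun s hs h => absurd h (h2 s hs)
  · exact fun s hs h => absurd h (h2 s hs)

/-- Finishing a queued node of least key. -/
theorem Search.pop {z₀ : ℕ} (h : N.Search u f asg y st kd tgt Y τ z₀ 3) (hz : z < N.m)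
    (h1 : st z = 1) (hmin : ∀ x < N.m, st x = 1 → Y z - y z ≤ Y x - y x) :
    (finished N.m (update st z 2)).card = (finished N.m st).card + 1 ∧
    N.Search u f asg y (update st z 2) kd tgt Y
      (update τ z ((finished N.m st).card + 1)) z 0 := by
  have hcard : (finished N.m (update st z 2)).card = (finished N.m st).card + 1 := by
    have : finished N.m (update st z 2) = insert z (finished N.m st) := by
      ext i
      simp only [finished, Finset.mem_filter, Finset.mem_range, Finset.mem_insert,
        Function.update_apply]
      by_cases hi : i = z
      · subst hi; simp [hz]
      · simp [hi]
    rw [this, Finset.card_insert_of_notMem]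
    simp [finished, h1]
  have h0 : ∀ x, update st z 2 x ≠ 0 → st x ≠ 0 := by
    intro x hx
    by_cases hi : x = z
    · subst hi; omega
    · rwa [Function.update_of_ne hi] at hx
  have h1' : ∀ x, update st z 2 x = 1 → st x = 1 := by
    intro x hx
    by_cases hi : x = z
    · subst hi; simp at hx
    · rwa [Function.update_of_ne hi] at hx
  have hup : ∀ x, st x = 2 → update st z 2 x = 2 := by
    intro x hx
    by_cases hi : x = z
    · subst hi; simp
    · rwa [Function.update_of_ne hi]
  have h2 : ∀ x, update st z 2 x = 2 → x = z ∨ x ≠ z ∧ st x = 2 := by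
    intro x hx
    by_cases hi : x = z
    · exact .inl hi
    · rw [Function.update_of_ne hi] at hx; exact .inr ⟨hi, hx⟩
  have htz : ∀ x < N.m, st x ≠ 0 → tgt x ≠ z := by
    intro x hx hs hc
    rcases h.tgt_done x hx hs with h3 | h3
    · omega
    · rw [hc] at h3; omega
  refine ⟨hcard, h.sink, ?_, fun x hx hs => h.le x hx (h0 x hs), ?_,
    fun x hx hs => h.path x hx (h0 x hs), ?_, ?_, ?_, ?_, ?_, ?_⟩
  · rw [Function.update_of_ne (by omega)]; exact h.sink_time
  · intro x hx
    by_cases hi : x = z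
    · subst hi; simp
    · rw [Function.update_of_ne hi]; exact h.st_le x hx
  · intro x hx hs
    exact (h.tgt_done x hx (h0 x hs)).imp_right fun h3 => ⟨h3.1, hup _ h3.2⟩
  · intro s x hs hx e1 e2
    rcases h2 s e1 with rfl | ⟨-, e⟩
    · exact hmin x hx (h1' x e2)
    · exact h.order s x hs hx e (h1' x e2)
  · intro s hs e1
    rcases h2 s e1 with rfl | ⟨-, e⟩
    · exact le_rfl
    · exact h.order s z hs hz e h1
  · intro k x s c ha hx hs hk
    have hsz : s ≠ z := fun hc => absurd (hk hc) (by omega)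
    obtain ⟨e1, e2⟩ := h.relaxed ha hx (hs.imp_right fun h3 =>
      ⟨h3.1, by simpa [Function.update_of_ne hsz] using h3.2⟩) fun _ => ha.kind_lt
    refine ⟨?_, e2⟩
    by_cases hi : x = z
    · subst hi; simp
    · rwa [Function.update_of_ne hi]
  · intro x hx e1
    rcases h2 x e1 with rfl | ⟨hne, e⟩
    · rw [Function.update_self, Function.update_of_ne (htz x hx (by omega))]
      rcases h.tgt_done x hx (by omega) with h3 | h3
      · rw [h3, h.sink_time]; omega
      · have := h.time_le _ h3.1 h3.2; omega
    · rw [Function.update_of_ne hne, Function.update_of_ne (htz x hx (by omega))]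
      exact h.time x hx e
  · intro x hx e1
    rw [hcard]
    rcases h2 x e1 with rfl | ⟨hne, e⟩
    · rw [Function.update_self]
    · rw [Function.update_of_ne hne]
      exact (h.time_le x hx e).trans (Nat.le_succ _)

theorem Search.advance (h : N.Search u f asg y st kd tgt Y τ z κ)
    (hx : ∀ x c, N.Arc u f asg κ x z c → x < N.m → st x ≠ 0 ∧ Y x ≤ c + Y z) :
    N.Search u f asg y st kd tgt Y τ z (κ + 1) :=
  { h with
    relaxed := by
      intro k x s c ha hxm hs hk
      by_cases hc : s = z → k < κ
      · exact h.relaxed ha hxm hs hc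
      · push Not at hc
        obtain ⟨rfl, hc⟩ := hc
        obtain rfl : k = κ := by have := hk rfl; omega
        exact hx x c ha hxm }

/-- An offer that does not improve the tentative distance of `x`: a finished node cannot be
improved, because the reduced cost of the arc is nonnegative and `z` was finished last. -/
theorem Search.relax_skip (h : N.Search u f asg y st kd tgt Y τ z κ) (hy : N.Feasible u f asg y)
    {k x : ℕ} {c : ℝ} (ha : N.Arc u f asg k x z c) (hx : x < N.m)
    (hs : ¬ (st x = 0 ∨ st x = 1 ∧ ¬ Y x ≤ c + Y z)) : st x ≠ 0 ∧ Y x ≤ c + Y z := by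
  push Not at hs
  refine ⟨hs.1, ?_⟩
  by_cases h1 : st x = 1
  · exact hs.2 h1
  · have h2 : st x = 2 := by have := h.st_le x hx; omega
    have := h.last x hx h2
    have := hy.arc ha
    linarith

/-- An offer that improves the tentative distance of `x`. -/
theorem Search.relax_take (h : N.Search u f asg y st kd tgt Y τ z κ) (hy : N.Feasible u f asg y)
    {k x : ℕ} {c : ℝ} (ha : N.Arc u f asg k x z c) (hx : x < N.m) (hz : z < N.m) (hz2 : st z = 2)
    (hs : st x = 0 ∨ st x = 1 ∧ ¬ Y x ≤ c + Y z) :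
    finished N.m (update st x 1) = finished N.m st ∧
    N.Search u f asg y (update st x 1) (update kd x k) (update tgt x z) (update Y x (c + Y z))
      τ z κ := by
  have hx2 : st x ≠ 2 := by omega
  have hxz : x ≠ z := by rintro rfl; exact hx2 hz2
  have hfin : finished N.m (update st x 1) = finished N.m st := by
    ext i
    simp only [finished, Finset.mem_filter, Finset.mem_range, Function.update_apply]
    by_cases hi : i = x
    · subst hi; simp [hx2]
    · simp [hi]
  have h2 : ∀ s, update st x 1 s = 2 → s ≠ x ∧ st s = 2 := by
    intro s e
    by_cases hi : s = x
    · subst hi; simp at e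
    · rw [Function.update_of_ne hi] at e; exact ⟨hi, e⟩
  have hkey : Y z - y z ≤ c + Y z - y x := by have := hy.arc ha; linarith
  have htx : ∀ i < N.m, st i ≠ 0 → tgt i ≠ x := by
    intro i hi e hc
    rcases h.tgt_done i hi e with h3 | h3
    · omega
    · rw [hc] at h3; exact hx2 h3.2
  refine ⟨hfin, ?_, h.sink_time, ?_, ?_, ?_, ?_, ?_, ?_, ?_, ?_, ?_⟩
  · rw [Function.update_of_ne (by omega)]; exact h.sink
  · intro i hi e
    by_cases hix : i = x
    · subst hix
      have := h.le z hz (by omega)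
      rw [Function.update_self]; linarith
    · rw [Function.update_of_ne hix] at e ⊢; exact h.le i hi e
  · intro i hi
    by_cases hix : i = x
    · subst hix; simp
    · rw [Function.update_of_ne hix]; exact h.st_le i hi
  · intro i hi e
    by_cases hix : i = x
    · subst hix
      exact ⟨c, by simpa using ha, by simp [Function.update_of_ne hxz.symm]⟩
    · rw [Function.update_of_ne hix] at e
      rw [Function.update_of_ne hix, Function.update_of_ne hix, Function.update_of_ne hix,
        Function.update_of_ne (htx i hi e)]
      exact h.path i hi e
  · intro i hi e
    by_cases hix : i = x
    · subst hix
      rw [Function.update_self, Function.update_of_ne hxz.symm]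
      exact .inr ⟨hz, hz2⟩
    · rw [Function.update_of_ne hix] at e
      rw [Function.update_of_ne hix, Function.update_of_ne (htx i hi e)]
      exact h.tgt_done i hi e
  · intro s i hs' hi e1 e2
    obtain ⟨hsx, e3⟩ := h2 s e1
    rw [Function.update_of_ne hsx]
    by_cases hix : i = x
    · subst hix
      rw [Function.update_self]
      exact (h.last s hs' e3).trans hkey
    · rw [Function.update_of_ne hix] at e2 ⊢
      exact h.order s i hs' hi e3 e2
  · intro s hs' e1
    obtain ⟨hsx, e1⟩ := h2 s e1
    rw [Function.update_of_ne hsx, Function.update_of_ne hxz.symm]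
    exact h.last s hs' e1
  · intro k' i s c' ha' hi hs' hk
    have hs'' : s = N.m ∨ s < N.m ∧ st s = 2 := hs'.imp_right fun e => ⟨e.1, (h2 s e.2).2⟩
    have hsx : s ≠ x := by
      rcases hs'' with e | e
      · omega
      · rintro rfl; exact hx2 e.2
    obtain ⟨e1, e2⟩ := h.relaxed ha' hi hs'' hk
    rw [Function.update_of_ne hsx]
    by_cases hix : i = x
    · subst hix
      rw [Function.update_self, Function.update_self]
      refine ⟨one_ne_zero, ?_⟩
      have := hs.resolve_left e1
      push Not at this
      exact this.2.le.trans e2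
    · rw [Function.update_of_ne hix, Function.update_of_ne hix]
      exact ⟨e1, e2⟩
  · intro i hi e
    obtain ⟨hix, e⟩ := h2 i e
    rw [Function.update_of_ne hix]
    exact h.time i hi e
  · intro i hi e
    rw [hfin]
    exact h.time_le i hi (h2 i e).2

/-- When the queue is empty, all nodes are finished, since the sink can be reached along the
chains. -/
theorem Search.finish (hN : N.Good) (hy : N.Feasible u f asg y)
    (h : N.Search u f asg y st kd tgt Y τ z 3) (hq : ∀ x < N.m, st x ≠ 1) :
    N.Shortest u f asg kd tgt Y τ := by
  have h2 : ∀ x < N.m, st x = 2 := by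
    intro x hx
    refine (hN.ind (fun x => x = N.m ∨ x < N.m ∧ st x = 2) (.inl rfl) ?_ x hx).elim
      (fun e => absurd e (by omega)) (·.2)
    intro i hi e
    obtain ⟨e1, -⟩ := h.relaxed (.forward i hi) hi e fun _ => by omega
    have := hq i hi
    have := h.st_le i hi
    exact .inr ⟨hi, by omega⟩
  have h0 : ∀ x < N.m, st x ≠ 0 := fun x hx => by rw [h2 x hx]; omega
  have htgt : ∀ x < N.m, tgt x ≤ N.m := fun x hx => by
    rcases h.tgt_done x hx (h0 x hx) with e | e <;> omega
  refine ⟨h.sink, ?_, fun x hx => h.path x hx (h0 x hx), htgt, fun x hx => h.time x hx (h2 x hx), ?_⟩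
  · intro k x s c ha
    have hs := (hy.arc_le hN ha).2
    rcases (hy.arc_le hN ha).1.lt_or_eq with hx | rfl
    · exact (h.relaxed ha hx (by
        rcases hs.lt_or_eq with e | e
        · exact .inr ⟨e, h2 s e⟩
        · exact .inl e) fun _ => ha.kind_lt).2
    · have h1 := hy.arc ha
      rw [h.sink]
      rw [hy.sink] at h1
      rcases hs.lt_or_eq with e | rfl
      · have := h.le s e (h0 s e); linarith
      · rw [h.sink]; rwa [hy.sink] at h1
  · intro x hx
    refine (h.time_le x hx (h2 x hx)).trans ?_
    exact (Finset.card_filter_le _ _).trans (by simp)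

end Net

/-! ### Augmentation along a shortest path -/

namespace Net

variable {N : Net} {u : ℕ} {f asg : ℕ → ℕ} {y : ℕ → ℝ} {kd tgt : ℕ → ℕ} {Y : ℕ → ℝ}
  {τ : ℕ → ℕ} {x z k : ℕ} {c : ℝ}

theorem arc_zero : N.Arc u f asg 0 x z c ↔
    x < N.m ∧ z = N.nx x ∧ c = (N.w x - N.w z) * (f x + 1) := by
  constructor
  · intro h; cases h with | forward _ hx => exact ⟨hx, rfl, rfl⟩
  · rintro ⟨hx, rfl, rfl⟩; exact .forward x hx

theorem arc_one : N.Arc u f asg 1 x z c ↔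
    z < N.m ∧ x = N.nx z ∧ 0 < f z ∧ c = -((N.w z - N.w x) * f z) := by
  constructor
  · intro h; cases h with | backward _ hz hf => exact ⟨hz, rfl, hf, rfl⟩
  · rintro ⟨hz, rfl, hf, rfl⟩; exact .backward z hz hf

theorem arc_two : N.Arc u f asg 2 x z c ↔
    z < N.m ∧ N.job z < u ∧ x = asg (N.job z) ∧ c = 0 := by
  constructor
  · intro h; cases h with | switch _ hz hj => exact ⟨hz, hj, rfl, rfl⟩
  · rintro ⟨hz, hj, rfl, rfl⟩; exact .switch z hz hj

/-- The state while the unit of the new job `u` is on its way to the sink and has reached node `x`.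
The arcs that start in nodes finished no later than `x` have not been used yet, so they are still
arcs of the residual network. -/
structure Augment (N : Net) (u : ℕ) (f asg : ℕ → ℕ) (kd tgt : ℕ → ℕ) (Y : ℕ → ℝ)
    (τ : ℕ → ℕ) (x : ℕ) : Prop where
  asg_lt : ∀ i < N.m, N.job i < u + 1 → asg (N.job i) < N.m
  job_asg : ∀ i < N.m, N.job i < u + 1 → N.job (asg (N.job i)) = N.job i
  arc : ∀ {k x z c}, N.Arc (u + 1) f asg k x z c → Y x ≤ c + Y z
  flow : ∀ i < N.m, f i + (if i = x then 1 else 0) = (if N.pv i < N.m then f (N.pv i) else 0) +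
    if N.job i < u + 1 ∧ asg (N.job i) = i then 1 else 0
  f_le : ∀ i < N.m, f i ≤ u + 1
  path : ∀ i < N.m, τ i ≤ τ x →
    ∃ c, N.Arc (u + 1) f asg (kd i) i (tgt i) c ∧ Y i = c + Y (tgt i)
  room : ∀ i < N.m, τ i ≤ τ x → kd i = 0 → f i ≤ u
  sink : Y N.m = 0
  tgt_le : ∀ i < N.m, tgt i ≤ N.m
  time : ∀ i < N.m, τ (tgt i) < τ i

/-- The unit starts at an edge `e` of the new job with the least distance to the sink. -/
theorem Augment.start (hy : N.Feasible u f asg y) (h : N.Shortest u f asg kd tgt Y τ) {e : ℕ}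
    (he : e < N.m) (hj : N.job e = u) (hmin : ∀ i < N.m, N.job i = u → Y e ≤ Y i) :
    N.Augment u f (update asg u e) kd tgt Y τ e := by
  have hold : ∀ {j}, j < u → update asg u e j = asg j := fun hj =>
    Function.update_of_ne hj.ne _ _
  have hnew : ∀ {j}, j < u + 1 → ¬ j < u → j = u := by omega
  refine ⟨?_, ?_, ?_, ?_, fun i hi => (hy.f_le i hi).trans (Nat.le_succ u), ?_,
    fun i hi _ _ => hy.f_le i hi, h.sink, h.tgt_le, h.time⟩
  · intro i hi hji
    by_cases hc : N.job i < u
    · rw [hold hc]; exact hy.asg_lt i hi hc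
    · rw [hnew hji hc, Function.update_self]; exact he
  · intro i hi hji
    by_cases hc : N.job i < u
    · rw [hold hc]; exact hy.job_asg i hi hc
    · rw [hnew hji hc, Function.update_self]; exact hj
  · intro k x z c ha
    induction ha with
    | forward x hx => exact h.arc (.forward x hx)
    | backward z hz hf => exact h.arc (.backward z hz hf)
    | switch z hz hjz =>
      by_cases hc : N.job z < u
      · rw [hold hc]; exact h.arc (.switch z hz hc)
      · rw [hnew hjz hc, Function.update_self, zero_add]; exact hmin z hz (hnew hjz hc)
  · intro i hi
    rw [hy.flow i hi]
    by_cases hc : N.job i < u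
    · have : i ≠ e := by rintro rfl; omega
      simp only [hold hc, hc, this, if_false, true_and, Nat.lt_succ_of_lt hc, add_zero]
    · by_cases hc2 : N.job i = u
      · simp [hc2, eq_comm]
      · have h1 : i ≠ e := by rintro rfl; omega
        have h2 : ¬ N.job i < u + 1 := by omega
        simp [hc, h1, h2]
  · intro i hi _
    obtain ⟨c, ha, hc⟩ := h.path i hi
    refine ⟨c, ?_, hc⟩
    generalize kd i = k, tgt i = z at ha
    induction ha with
    | forward x hx => exact .forward x hx
    | backward z hz hf => exact .backward z hz hf
    | switch z hz hjz =>
      have := Arc.switch (N := N) (u := u + 1) (f := f) (asg := update asg u e) z hz (by omega)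
      rwa [hold hjz] at this

/-- One more unit on the arc that leaves `x`: this arc is tight, so the potential difference along it,
the marginal cost of the new unit before, becomes the gain of taking a unit back. -/
theorem Augment.push_forward (hN : N.Good) (h : N.Augment u f asg kd tgt Y τ x) (hx : x < N.m)
    (hk : kd x = 0) : N.Augment u (update f x (f x + 1)) asg kd tgt Y τ (tgt x) := by
  obtain ⟨c, ha, hc⟩ := h.path x hx le_rfl
  rw [hk, arc_zero] at ha
  obtain ⟨-, hz, rfl⟩ := ha
  have hlt := h.time x hx
  have hδ : 0 ≤ N.w x - N.w (N.nx x) := sub_nonneg.2 (hN.w_nx x hx)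
  rw [hz] at hlt hc ⊢
  refine ⟨h.asg_lt, h.job_asg, ?_, ?_, ?_, ?_, ?_, h.sink, h.tgt_le, h.time⟩
  · intro k i z c ha
    induction ha with
    | forward i hi =>
      have := h.arc (.forward i hi)
      by_cases hix : i = x
      · subst hix
        rw [Function.update_self]; push_cast; nlinarith
      · rwa [Function.update_of_ne hix]
    | backward i hi hf =>
      by_cases hix : i = x
      · subst hix
        rw [Function.update_self]; push_cast; nlinarith
      · rw [Function.update_of_ne hix] at hf ⊢
        exact h.arc (.backward i hi hf)
    | switch i hi hj => exact h.arc (.switch i hi hj)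
  · intro i hi
    have h1 := h.flow i hi
    by_cases hix : i = x
    · subst hix
      have h2 : i ≠ N.nx i := by intro hc; rw [← hc] at hlt; omega
      have h3 : N.pv i < N.m → N.pv i ≠ i := fun h4 h5 => h2 (by
        have := hN.nx_pv i hi h4; rw [h5] at this; exact this.symm)
      rw [Function.update_self, if_neg h2, add_zero]
      rw [if_pos rfl] at h1
      refine h1.trans ?_
      congr 1
      split_ifs with h4
      · rw [Function.update_of_ne (h3 h4)]
      · rfl
    · rw [Function.update_of_ne hix]
      rw [if_neg hix] at h1
      by_cases hiz : i = N.nx x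
      · subst hiz
        have h4 := hN.pv_nx x hx hi
        rw [h4, if_pos hx, add_zero] at h1
        rw [h4, if_pos hx, if_pos rfl, Function.update_self, h1]; omega
      · rw [if_neg hiz, h1]
        congr 1
        split_ifs with h4
        · rw [Function.update_of_ne]
          intro h5
          have := hN.nx_pv i hi h4
          rw [h5] at this; exact hiz this.symm
        · rfl
  · intro i hi
    by_cases hix : i = x
    · subst hix
      have := h.room i hi le_rfl hk
      rw [Function.update_self]; omega
    · rw [Function.update_of_ne hix]; exact h.f_le i hi
  · intro i hi hτ
    obtain ⟨c, ha, hc⟩ := h.path i hi (by omega)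
    refine ⟨c, ?_, hc⟩
    have hτ' := h.time i hi
    have hix : i ≠ x := by rintro rfl; omega
    have htx : tgt i ≠ x := by intro h1; rw [h1] at hτ'; omega
    generalize kd i = k at ha ⊢
    generalize tgt i = z at ha htx ⊢
    induction ha with
    | forward j hj =>
      have := Arc.forward (N := N) (u := u + 1) (f := update f x (f x + 1)) (asg := asg) j hj
      rwa [Function.update_of_ne hix] at this
    | backward j hj hf =>
      have := Arc.backward (N := N) (u := u + 1) (f := update f x (f x + 1)) (asg := asg) j hj
        (by rwa [Function.update_of_ne htx])
      rwa [Function.update_of_ne htx] at this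
    | switch j hj hjj => exact .switch j hj hjj
  · intro i hi hτ hki
    have hix : i ≠ x := by rintro rfl; omega
    rw [Function.update_of_ne hix]
    exact h.room i hi (by omega) hki

/-- One unit less on the arc that enters `x`: the potential difference along this arc, the gain of
taking a unit back before, becomes the marginal cost of the next unit. -/
theorem Augment.push_backward (hN : N.Good) (h : N.Augment u f asg kd tgt Y τ x) (hx : x < N.m)
    (hk : kd x = 1) :
    N.Augment u (update f (tgt x) (f (tgt x) - 1)) asg kd tgt Y τ (tgt x) := by
  obtain ⟨c, ha, hc⟩ := h.path x hx le_rfl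
  rw [hk, arc_one] at ha
  have hlt := h.time x hx
  obtain ⟨hz, hxz, hf, rfl⟩ := ha
  have htt := h.time _ hz
  have hkz : kd (tgt x) = 0 → tgt (tgt x) = x := by
    intro hk0
    obtain ⟨c, ha, -⟩ := h.path _ hz hlt.le
    rw [hk0, arc_zero] at ha
    rw [ha.2.1, ← hxz]
  generalize tgt x = z at *
  have hδ : 0 ≤ N.w z - N.w x := by rw [hxz]; exact sub_nonneg.2 (hN.w_nx z hz)
  have hpv : N.pv x = z := by rw [hxz]; exact hN.pv_nx z hz (hxz ▸ hx)
  have hne : x ≠ z := by rintro rfl; omega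
  have hcast : ((f z - 1 : ℕ) : ℝ) = f z - 1 := by rw [Nat.cast_sub hf]; simp
  refine ⟨h.asg_lt, h.job_asg, ?_, ?_, ?_, ?_, ?_, h.sink, h.tgt_le, h.time⟩
  · intro k i s c ha
    induction ha with
    | forward i hi =>
      by_cases hix : i = z
      · subst hix
        rw [Function.update_self, hcast, ← hxz]; linarith
      · have := h.arc (.forward i hi)
        rwa [Function.update_of_ne hix]
    | backward i hi hf =>
      by_cases hix : i = z
      · subst hix
        rw [Function.update_self, hcast, ← hxz]; nlinarith
      · rw [Function.update_of_ne hix] at hf ⊢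
        exact h.arc (.backward i hi hf)
    | switch i hi hj => exact h.arc (.switch i hi hj)
  · intro i hi
    have h1 := h.flow i hi
    by_cases hix : i = x
    · subst hix
      rw [if_pos rfl, hpv, if_pos hz] at h1
      rw [Function.update_of_ne hne, hpv, if_pos hz, Function.update_self, if_neg hne]
      omega
    · rw [if_neg hix] at h1
      have h3 : N.pv i < N.m → N.pv i ≠ z := fun h4 h5 => hix (by
        have := hN.nx_pv i hi h4; rw [h5, ← hxz] at this; exact this.symm)
      have h4 : (if N.pv i < N.m then update f z (f z - 1) (N.pv i) else 0) =
          if N.pv i < N.m then f (N.pv i) else 0 := by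
        split_ifs with h4
        · rw [Function.update_of_ne (h3 h4)]
        · rfl
      rw [h4, ← h1]
      by_cases hiz : i = z
      · subst hiz
        rw [Function.update_self, if_pos rfl]; omega
      · rw [Function.update_of_ne hiz, if_neg hiz]
  · intro i hi
    by_cases hix : i = z
    · subst hix
      have := h.f_le i hi
      rw [Function.update_self]; omega
    · rw [Function.update_of_ne hix]; exact h.f_le i hi
  · intro i hi hτ
    obtain ⟨c, ha, hc⟩ := h.path i hi (by omega)
    refine ⟨c, ?_, hc⟩
    have hix : i ≠ x := by rintro rfl; omega
    by_cases hk0 : kd i = 0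
    · have hiz : i ≠ z := by
        rintro rfl
        rw [hkz hk0] at htt; omega
      rw [hk0, arc_zero] at ha ⊢
      rwa [Function.update_of_ne hiz]
    · by_cases hk1 : kd i = 1
      · have htz : tgt i ≠ z := by
          intro h1
          rw [hk1, arc_one, h1, ← hxz] at ha
          exact hix ha.2.1
        rw [hk1, arc_one] at ha ⊢
        rwa [Function.update_of_ne htz]
      · have hk2 : kd i = 2 := by have := ha.kind_lt; omega
        rw [hk2, arc_two] at ha ⊢
        exact ha
  · intro i hi hτ hki
    have hiz : i ≠ z := by
      rintro rfl
      rw [hkz hki] at htt; omega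
    rw [Function.update_of_ne hiz]
    exact h.room i hi (by omega) hki

/-- The job of `x` switches to `tgt x`, which has the same potential. -/
theorem Augment.push_switch (h : N.Augment u f asg kd tgt Y τ x) (hx : x < N.m)
    (hk0 : kd x ≠ 0) (hk1 : kd x ≠ 1) :
    N.Augment u f (update asg (N.job x) (tgt x)) kd tgt Y τ (tgt x) := by
  obtain ⟨c, ha, hc⟩ := h.path x hx le_rfl
  have hk2 : kd x = 2 := by have := ha.kind_lt; omega
  rw [hk2, arc_two] at ha
  have hlt := h.time x hx
  obtain ⟨hz, hj, hxz, rfl⟩ := ha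
  generalize tgt x = z at *
  have hjx : N.job x = N.job z := by rw [hxz]; exact h.job_asg z hz hj
  have hne : x ≠ z := by rintro rfl; omega
  rw [hjx]
  have hY : Y z = Y x := by rw [hc, zero_add]
  have key : ∀ i, N.job i < u + 1 → N.job i ≠ N.job z →
      update asg (N.job z) z (N.job i) = asg (N.job i) := fun i _ h2 => Function.update_of_ne h2 _ _
  refine ⟨?_, ?_, ?_, ?_, h.f_le, ?_, ?_, h.sink, h.tgt_le, h.time⟩
  · intro i hi hji
    by_cases hc : N.job i = N.job z
    · rw [hc, Function.update_self]; exact hz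
    · rw [key i hji hc]; exact h.asg_lt i hi hji
  · intro i hi hji
    by_cases hc : N.job i = N.job z
    · rw [hc, Function.update_self]
    · rw [key i hji hc]; exact h.job_asg i hi hji
  · intro k i s c ha
    induction ha with
    | forward i hi => exact h.arc (.forward i hi)
    | backward i hi hf => exact h.arc (.backward i hi hf)
    | switch i hi hji =>
      have := h.arc (.switch i hi hji)
      by_cases hc : N.job i = N.job z
      · rw [hc, ← hxz] at this
        rw [hc, Function.update_self, hY]; exact this
      · rwa [key i hji hc]
  · intro i hi
    have h1 := h.flow i hi
    by_cases hc : N.job i = N.job z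
    · rw [hc, ← hxz] at h1
      rw [hc, Function.update_self]
      simp only [hj, true_and, eq_comm (a := x), eq_comm (a := z)] at h1 ⊢
      omega
    · have hix : i ≠ x := by intro h1; exact hc (h1 ▸ hjx)
      have hiz : i ≠ z := by intro h1; exact hc (h1 ▸ rfl)
      rw [if_neg hix] at h1
      rw [if_neg hiz, h1, Function.update_of_ne hc]
  · intro i hi hτ
    obtain ⟨c, ha, hc⟩ := h.path i hi (by omega)
    refine ⟨c, ?_, hc⟩
    have hix : i ≠ x := by rintro rfl; omega
    by_cases hk0 : kd i = 0
    · rw [hk0, arc_zero] at ha ⊢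
      exact ha
    · by_cases hk1 : kd i = 1
      · rw [hk1, arc_one] at ha ⊢
        exact ha
      · have hk2 : kd i = 2 := by have := ha.kind_lt; omega
        rw [hk2, arc_two] at ha ⊢
        have hne' : N.job (tgt i) ≠ N.job z := by
          intro hcc
          rw [hcc, ← hxz] at ha
          exact hix ha.2.2.1
        rwa [Function.update_of_ne hne']
  · exact fun i hi hτ => h.room i hi (by omega)

theorem Augment.finish (h : N.Augment u f asg kd tgt Y τ N.m) :
    N.Feasible (u + 1) f asg Y :=
  ⟨h.asg_lt, h.job_asg, h.sink, h.arc, fun i hi => by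
    have := h.flow i hi
    rwa [if_neg hi.ne, add_zero] at this, h.f_le⟩

/-- A job without edges changes nothing. -/
theorem Feasible.skip (h : N.Feasible u f asg y) (hu : ∀ i < N.m, N.job i ≠ u) :
    N.Feasible (u + 1) f asg y := by
  have hlt : ∀ i < N.m, (N.job i < u + 1 ↔ N.job i < u) := fun i hi => by
    have := hu i hi; omega
  refine ⟨fun i hi h1 => h.asg_lt i hi ((hlt i hi).1 h1),
    fun i hi h1 => h.job_asg i hi ((hlt i hi).1 h1), h.sink, ?_, ?_,
    fun i hi => (h.f_le i hi).trans (Nat.le_succ u)⟩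
  · intro k x z c ha
    induction ha with
    | forward x hx => exact h.arc (.forward x hx)
    | backward x hx hf => exact h.arc (.backward x hx hf)
    | switch x hx hj => exact h.arc (.switch x hx ((hlt x hx).1 hj))
  · intro i hi
    simp only [hlt i hi]
    exact h.flow i hi

/-- With zero flow, the zero potential is feasible since weights decrease along the chains. -/
theorem Feasible.zero (hN : N.Good) (asg : ℕ → ℕ) :
    N.Feasible 0 (fun _ => 0) asg fun _ => 0 := by
  refine ⟨by simp, by simp, rfl, ?_, by simp, by simp⟩
  intro k x z c ha
  induction ha with
  | forward x hx => have := hN.w_nx x hx; simpa using this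
  | backward x hx hf => simp at hf
  | switch x hx hj => simp at hj

/-- After the search, its result is a potential for the same flow. -/
theorem Shortest.feasible (h : N.Shortest u f asg kd tgt Y τ) (hy : N.Feasible u f asg y) :
    N.Feasible u f asg Y :=
  { hy with sink := h.sink, arc := h.arc }

end Net

/-! ### Insertion into the chains -/

/-- The list `L` is what one finds when following the links `nx` from node `h` until `m`; the links
`pv` point back. -/
def IsChain (m : ℕ) (nx pv : ℕ → ℕ) : ℕ → List ℕ → Prop
  | h, [] => nx h = m
  | h, a :: L => nx h = a ∧ pv a = h ∧ IsChain m nx pv a L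

namespace IsChain

variable {m : ℕ} {nx pv nx' pv' : ℕ → ℕ}

theorem congr {h : ℕ} {L : List ℕ} (hc : IsChain m nx pv h L) (h0 : nx' h = nx h)
    (h1 : ∀ a ∈ L, nx' a = nx a) (h2 : ∀ a ∈ L, pv' a = pv a) : IsChain m nx' pv' h L := by
  induction L generalizing h with
  | nil => exact h0.trans hc
  | cons a L ih =>
    refine ⟨h0.trans hc.1, (h2 a (by simp)).trans hc.2.1, ?_⟩
    exact ih hc.2.2 (h1 a (by simp)) (fun b hb => h1 b (by simp [hb])) fun b hb => h2 b (by simp [hb])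

theorem drop {h : ℕ} {A B : List ℕ} (hc : IsChain m nx pv h (A ++ B)) :
    IsChain m nx pv (A.getLastD h) B := by
  induction A generalizing h with
  | nil => exact hc
  | cons a A ih => rw [List.getLastD_cons]; exact ih hc.2.2

theorem nx_eq {h : ℕ} {L : List ℕ} (hc : IsChain m nx pv h L) : nx h = L.headD m := by
  cases L with
  | nil => exact hc
  | cons a L => exact hc.1

/-- Linking `n` between `x`, the last node of `A`, and `s`, the first node of `B` (or `m`). -/
theorem insert {h n x s : ℕ} {A B : List ℕ} (hc : IsChain m nx pv h (A ++ B))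
    (hx : x = A.getLastD h) (hs : s = B.headD m) (hnd : (h :: (A ++ B)).Nodup)
    (hn : n ∉ h :: (A ++ B)) (hm : ∀ a ∈ A ++ B, a ≠ m) :
    IsChain m (update (update nx n s) x n) (update (update pv s n) n x) h (A ++ n :: B) := by
  induction A generalizing h with
  | nil =>
    simp only [List.nil_append, List.getLastD_nil] at *
    subst hx
    have hnx : n ≠ x := by rintro rfl; simp at hn
    refine ⟨by simp, by simp, ?_⟩
    cases B with
    | nil => simpa [IsChain, Function.update_of_ne hnx] using hs
    | cons b B =>
      simp only [List.headD_cons] at hs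
      subst hs
      have hbn : s ≠ n := by rintro rfl; simp at hn
      have hbx : s ≠ x := by rintro rfl; simp at hnd
      refine ⟨by simp [Function.update_of_ne hnx], by simp [Function.update_of_ne hbn], ?_⟩
      refine hc.2.2.congr (by simp [Function.update_of_ne hbn, Function.update_of_ne hbx]) ?_ ?_
      · intro a ha
        have h1 : a ≠ x := by rintro rfl; simp [ha] at hnd
        have h2 : a ≠ n := by rintro rfl; simp [ha] at hn
        rw [Function.update_of_ne h1, Function.update_of_ne h2]
      · intro a ha
        have h1 : a ≠ s := by rintro rfl; simp [ha] at hnd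
        have h2 : a ≠ n := by rintro rfl; simp [ha] at hn
        rw [Function.update_of_ne h2, Function.update_of_ne h1]
  | cons a A ih =>
    rw [List.getLastD_cons] at hx
    have hxm : x ∈ a :: A := by
      rw [hx]
      rcases List.eq_nil_or_concat A with rfl | ⟨A', b, rfl⟩
      · simp
      · simp
    have h1 : h ≠ x := by
      rintro rfl
      rw [List.nodup_cons] at hnd
      exact hnd.1 (List.mem_append_left _ hxm)
    have h2 : h ≠ n := by rintro rfl; simp at hn
    have h3 : a ≠ n := by rintro rfl; simp at hn
    have h4 : a ≠ s := by
      rintro rfl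
      cases B with
      | nil => exact hm a (by simp) hs
      | cons b B =>
        simp only [List.headD_cons] at hs
        subst hs
        simp at hnd
    refine ⟨?_, ?_, ih hc.2.2 hx ?_ ?_ ?_⟩
    · rw [Function.update_of_ne h1, Function.update_of_ne h2]; exact hc.1
    · rw [Function.update_of_ne h3, Function.update_of_ne h4]; exact hc.2.1
    · exact (List.nodup_cons.1 hnd).2
    · exact fun h => hn (List.mem_cons_of_mem _ h)
    · exact fun b hb => hm b (List.mem_cons_of_mem _ hb)

end IsChain

/-- The edges `0, …, n - 1` are linked: the chain of machine `v < q` starts at node `m + 1 + v` and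
lists the edges of that machine by decreasing weight. -/
structure Chains (m q n : ℕ) (mach nx pv : ℕ → ℕ) (w : ℕ → ℝ) (L : ℕ → List ℕ) : Prop where
  chain : ∀ v < q, IsChain m nx pv (m + 1 + v) (L v)
  mem : ∀ v < q, ∀ i, i ∈ L v ↔ i < n ∧ mach i = v
  nodup : ∀ v < q, (L v).Nodup
  sorted : ∀ v < q, (L v).Pairwise fun a b => w b ≤ w a

namespace Chains

variable {m q n : ℕ} {mach nx pv : ℕ → ℕ} {w : ℕ → ℝ} {L : ℕ → List ℕ}

theorem empty (h : ∀ v < q, nx (m + 1 + v) = m) : Chains m q 0 mach nx pv w fun _ => [] :=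
  ⟨h, by simp, by simp, by simp⟩

/-- Linking edge `n` at a place that keeps the chain of its machine sorted. -/
theorem insert (h : Chains m q n mach nx pv w L) (hn : n < m) {x : ℕ} (hv : mach n < q)
    {A B : List ℕ} (hL : L (mach n) = A ++ B) (hx : x = A.getLastD (m + 1 + mach n))
    (hA : ∀ a ∈ A, w n ≤ w a) (hB : ∀ b ∈ B, w b ≤ w n) :
    Chains m q (n + 1) mach (update (update nx n (nx x)) x n)
      (update (update pv (nx x) n) n x) w (update L (mach n) (A ++ n :: B)) := by
  have hlt : ∀ v < q, ∀ i ∈ L v, i < n := fun v hv i hi => ((h.mem v hv i).1 hi).1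
  have hc := h.chain _ hv
  rw [hL] at hc
  have hs : nx x = B.headD m := by rw [hx]; exact hc.drop.nx_eq
  have hxm : x = m + 1 + mach n ∨ x ∈ A := by
    rw [hx]
    rcases List.eq_nil_or_concat A with rfl | ⟨A', b, rfl⟩
    · simp
    · simp
  have hAB : ∀ i ∈ A ++ B, i < n := by rw [← hL]; exact hlt _ hv
  refine ⟨?_, ?_, ?_, ?_⟩
  · intro v hv'
    by_cases hvn : v = mach n
    · subst hvn
      rw [Function.update_self]
      refine hc.insert hx hs ?_ ?_ ?_
      · rw [List.nodup_cons]
        exact ⟨fun h1 => by have := hAB _ h1; omega, hL ▸ h.nodup _ hv⟩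
      · intro h1
        rcases List.mem_cons.1 h1 with h1 | h1
        · omega
        · exact absurd (hAB _ h1) (by omega)
      · intro a ha; have := hAB a ha; omega
    · rw [Function.update_of_ne hvn]
      have hne : ∀ i ∈ L v, i ∉ A ++ B := by
        intro i hi h1
        rw [← hL] at h1
        exact hvn (((h.mem v hv' i).1 hi).2.symm.trans ((h.mem _ hv i).1 h1).2)
      refine (h.chain v hv').congr ?_ ?_ ?_
      · have h1 : m + 1 + v ≠ x := by
          rcases hxm with h1 | h1
          · omega
          · have := hAB x (by simp [h1]); omega
        rw [Function.update_of_ne h1, Function.update_of_ne (by omega)]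
      · intro a ha
        have h0 := hlt v hv' a ha
        have h1 : a ≠ x := by
          rintro rfl
          rcases hxm with h1 | h1
          · omega
          · exact hne _ ha (by simp [h1])
        rw [Function.update_of_ne h1, Function.update_of_ne (by omega)]
      · intro a ha
        have h0 := hlt v hv' a ha
        have h1 : a ≠ nx x := by
          rw [hs]
          cases B with
          | nil => simp only [List.headD_nil]; omega
          | cons b B => rintro rfl; exact hne _ ha (by simp)
        rw [Function.update_of_ne (by omega), Function.update_of_ne h1]
  · intro v hv' i
    by_cases hvn : v = mach n
    · subst hvn
      have := h.mem _ hv i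
      rw [hL, List.mem_append] at this
      rw [Function.update_self, List.mem_append, List.mem_cons]
      by_cases hi : i = n
      · simp [hi]
      · have e : i < n + 1 ↔ i < n := by omega
        rw [e, ← this]; tauto
    · rw [Function.update_of_ne hvn, h.mem v hv' i]
      constructor
      · rintro ⟨h1, h2⟩; exact ⟨by omega, h2⟩
      · rintro ⟨h1, h2⟩
        refine ⟨?_, h2⟩
        have : i ≠ n := by rintro rfl; exact hvn h2.symm
        omega
  · intro v hv'
    by_cases hvn : v = mach n
    · subst hvn
      rw [Function.update_self, List.nodup_middle, List.nodup_cons, ← hL]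
      exact ⟨fun h1 => absurd (hlt _ hv _ h1) (lt_irrefl _), h.nodup _ hv⟩
    · rw [Function.update_of_ne hvn]; exact h.nodup v hv'
  · intro v hv'
    by_cases hvn : v = mach n
    · subst hvn
      have := h.sorted _ hv
      rw [hL, List.pairwise_append] at this
      rw [Function.update_self, List.pairwise_append, List.pairwise_cons]
      refine ⟨this.1, ⟨hB, this.2.1⟩, ?_⟩
      intro a ha b hb
      rcases List.mem_cons.1 hb with rfl | hb
      · exact hA a ha
      · exact this.2.2 a ha b hb
    · rw [Function.update_of_ne hvn]; exact h.sorted v hv'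

theorem good (h : Chains m q m mach nx pv w L) (hq : ∀ i < m, mach i < q)
    (hw : ∀ i < m, 0 ≤ w i) (hwm : w m = 0) (job : ℕ → ℕ) :
    Net.Good { m := m, job := job, nx := nx, pv := pv, w := w } := by
  have key : ∀ i < m, ∃ A B, L (mach i) = A ++ i :: B ∧
      nx (A.getLastD (m + 1 + mach i)) = i ∧ pv i = A.getLastD (m + 1 + mach i) ∧
      IsChain m nx pv i B ∧ (∀ b ∈ B, b < m) ∧ ∀ b ∈ B, w b ≤ w i := by
    intro i hi
    obtain ⟨A, B, hAB⟩ := List.append_of_mem ((h.mem _ (hq i hi) i).2 ⟨hi, rfl⟩)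
    have hc := h.chain _ (hq i hi)
    have hs := h.sorted _ (hq i hi)
    rw [hAB] at hc hs
    have hc' := hc.drop
    refine ⟨A, B, hAB, hc'.1, hc'.2.1, hc'.2.2, ?_, ?_⟩
    · intro b hb
      exact ((h.mem _ (hq i hi) b).1 (by rw [hAB]; simp [hb])).1
    · exact (List.pairwise_cons.1 (List.pairwise_append.1 hs).2.1).1
  refine ⟨?_, ?_, ?_, hwm, ?_, ?_⟩
  · intro i hi
    obtain ⟨A, B, -, -, -, h3, h4, -⟩ := key i hi
    change nx i ≤ m
    rw [h3.nx_eq]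
    cases B with
    | nil => simp
    | cons b B => exact (h4 b (by simp)).le
  · intro i hi hlt
    obtain ⟨A, B, -, -, -, h3, h4, -⟩ := key i hi
    change nx i < m at hlt
    change pv (nx i) = i
    cases B with
    | nil => exact absurd h3 hlt.ne
    | cons b B => rw [h3.1]; exact h3.2.1
  · intro i hi _
    obtain ⟨A, B, -, h1, h2, -⟩ := key i hi
    change nx (pv i) = i
    rw [h2, h1]
  · intro i hi
    obtain ⟨A, B, -, -, -, h3, h4, h5⟩ := key i hi
    change w (nx i) ≤ w i
    rw [h3.nx_eq]
    cases B with
    | nil => simpa [hwm] using hw i hi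
    | cons b B => exact h5 b (by simp)
  · intro P h0 hstep i hi
    obtain ⟨A, B, -, -, -, h3, h4, -⟩ := key i hi
    clear key
    induction B generalizing i with
    | nil => exact hstep i hi (by change P (nx i); rw [h3.nx_eq]; exact h0)
    | cons b B ih =>
      refine hstep i hi ?_
      change P (nx i)
      rw [h3.1]
      exact ih b (h4 b (by simp)) h3.2.2 fun c hc => h4 c (by simp [hc])

end Chains

/-! ### The cost of a machine -/

/-- `∑ i, (k + 1 + i) * l[i]`. -/
def posCost : List ℝ → ℕ → ℝ
  | [], _ => 0
  | a :: l, k => a * (k + 1) + posCost l (k + 1)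

theorem posCost_append_singleton (l : List ℝ) (a : ℝ) (k : ℕ) :
    posCost (l ++ [a]) k = posCost l k + a * (k + l.length + 1) := by
  induction l generalizing k with
  | nil => simp [posCost]
  | cons b l ih => simp only [List.cons_append, posCost, ih, List.length_cons]; push_cast; ring

theorem sum_eq_posCost_reverse (l : List ℝ) :
    ∑ i : Fin l.length, ((l.length : ℝ) - (i : ℕ)) * l.get i = posCost l.reverse 0 := by
  induction l with
  | nil => simp [posCost]
  | cons a l ih =>
    rw [List.reverse_cons, posCost_append_singleton, ← ih]
    simp only [List.length_cons]
    rw [Fin.sum_univ_succ]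
    simp only [List.get_cons_zero, Fin.val_zero, Fin.val_succ,
      List.length_reverse]
    push_cast
    rw [add_comm]
    congr 1
    · refine Finset.sum_congr rfl fun i _ => ?_
      have : (a :: l).get i.succ = l.get i := rfl
      rw [this]; ring
    · ring

/-- The cost of the edges of a chain that are selected by `a`, if `k` edges have been selected
before: the `j`-th selected edge counts with factor `k + j`. -/
def loadCost (w : ℕ → ℝ) (a : ℕ → ℕ) : List ℕ → ℕ → ℝ
  | [], _ => 0
  | i :: L, k => a i * (w i * (k + 1)) + loadCost w a L (k + a i)

theorem loadCost_eq_posCost (w : ℕ → ℝ) (a : ℕ → ℕ) (P : ℕ → Prop) [DecidablePred P]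
    (L : List ℕ) (ha : ∀ i ∈ L, a i = if P i then 1 else 0) (k : ℕ) :
    loadCost w a L k = posCost ((L.filter P).map w) k := by
  induction L generalizing k with
  | nil => rfl
  | cons i L ih =>
    rw [loadCost, ih (fun j hj => ha j (by simp [hj])), ha i (by simp)]
    by_cases hP : P i <;> simp [hP, posCost]

/-- A function with slopes between `δ k` and `δ (k + 1)` at `k` supports the convex function
`δ * k (k + 1) / 2`. -/
theorem convex_gap {δ D : ℝ} (hδ : 0 ≤ δ) {k k' : ℕ} (h1 : D ≤ δ * (k + 1))
    (h2 : 0 < k → δ * k ≤ D) :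
    D * ((k' : ℝ) - k) ≤ δ * (k' * (k' + 1) / 2) - δ * (k * (k + 1) / 2) := by
  rcases lt_trichotomy k k' with h | rfl | h
  · have h3 : (k : ℝ) + 1 ≤ k' := by exact_mod_cast h
    nlinarith [mul_nonneg hδ (mul_nonneg (sub_nonneg.2 h3) (show (0 : ℝ) ≤ k' - k by linarith))]
  · simp
  · have h3 : (k' : ℝ) + 1 ≤ k := by exact_mod_cast h
    have := h2 (by omega)
    nlinarith [mul_nonneg hδ (mul_nonneg (sub_nonneg.2 h3) (show (0 : ℝ) ≤ k - k' by linarith))]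

/-- The selection `a` with flow `f` and feasible potential `y` against any selection `a'`, on a
chain: the cost of `a'` exceeds the cost of `a` at least by the difference of the potentials. The
terms with the number of edges selected so far are those of a summation by parts. -/
theorem Net.Feasible.loadCost_le {N : Net} {u : ℕ} {f asg : ℕ → ℕ} {y : ℕ → ℝ}
    (h : N.Feasible u f asg y) (hN : N.Good) {a a' : ℕ → ℕ}
    (ha : ∀ i < N.m, a i = if N.job i < u ∧ asg (N.job i) = i then 1 else 0)
    (ha' : ∀ i < N.m, a' i = 0 ∨ a' i = 1) (L : List ℕ) (hL : ∀ i ∈ L, i < N.m) (b k k' : ℕ)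
    (hc : IsChain N.m N.nx N.pv b L) (hk : k = if b < N.m then f b else 0) :
    (L.map fun i => y i * ((a' i : ℝ) - a i)).sum +
      (N.w (L.headD N.m) * (k * (k + 1) / 2) - y (L.headD N.m) * k) -
      (N.w (L.headD N.m) * (k' * (k' + 1) / 2) - y (L.headD N.m) * k') ≤
    loadCost N.w a' L k' - loadCost N.w a L k := by
  induction L generalizing b k k' with
  | nil => simp [loadCost, hN.w_sink, h.sink]
  | cons i L ih =>
    have hi : i < N.m := hL i (by simp)
    have hfi : f i = k + a i := by rw [h.flow i hi, hc.2.1, hk, ha i hi]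
    have h1 := ih (fun j hj => hL j (by simp [hj])) i (k + a i) (k' + a' i) hc.2.2
      (by rw [if_pos hi, hfi])
    have hnx := hc.2.2.nx_eq
    have hup := h.arc (.forward i hi)
    have hlow : 0 < f i → (N.w i - N.w (N.nx i)) * f i ≤ y i - y (N.nx i) := fun hf => by
      have := h.arc (.backward i hi hf); linarith
    have hδ := sub_nonneg.2 (hN.w_nx i hi)
    rw [hnx, hfi] at hlow hup
    rw [hnx] at hδ
    have h2 := convex_gap (k := k + a i) (k' := k' + a' i) hδ
      (D := y i - y (L.headD N.m)) (by linarith) hlow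
    simp only [List.map_cons, List.sum_cons, List.headD_cons, loadCost]
    have e1 : ∀ (c : ℕ) (k : ℕ), c = 0 ∨ c = 1 → ((c : ℕ) : ℝ) * (N.w i * (k + 1)) =
        N.w i * (((k + c : ℕ) : ℝ) * (((k + c : ℕ) : ℝ) + 1) / 2) - N.w i * (k * (k + 1) / 2) := by
      rintro c k (rfl | rfl)
      · simp
      · push_cast; ring
    rw [e1 _ k (by rw [ha i hi]; split_ifs <;> simp), e1 _ k' (ha' i hi)]
    push_cast at h1 h2 ⊢
    linarith

/-! ### Optimality -/

section Optimal

variable {p q : ℕ} {G : WeightedGraph (Fin p) (Fin q)} {l : List (Fin p × Fin q)}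

/-- `InputNet G l job mach w`: the arrays `job`, `mach`, `w` list the edges of `G` in the order of
`l`, and `w` is `0` behind the end. -/
structure InputNet (G : WeightedGraph (Fin p) (Fin q)) (l : List (Fin p × Fin q))
    (job mach : ℕ → ℕ) (w : ℕ → ℝ) : Prop where
  nodup : l.Nodup
  edges : l.toFinset = G.edges
  job_eq : ∀ i (h : i < l.length), job i = (l[i].1 : ℕ)
  mach_eq : ∀ i (h : i < l.length), mach i = (l[i].2 : ℕ)
  w_eq : ∀ i (h : i < l.length), w i = G.weight l[i]
  w_end : w l.length = 0

namespace InputNet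

variable {job mach : ℕ → ℕ} {w : ℕ → ℝ}

theorem job_lt (h : InputNet G l job mach w) {i : ℕ} (hi : i < l.length) : job i < p := by
  rw [h.job_eq i hi]; exact Fin.isLt _

theorem mach_lt (h : InputNet G l job mach w) {i : ℕ} (hi : i < l.length) : mach i < q := by
  rw [h.mach_eq i hi]; exact Fin.isLt _

theorem w_nonneg (h : InputNet G l job mach w) {i : ℕ} (hi : i < l.length) : 0 ≤ w i := by
  rw [h.w_eq i hi]
  exact G.weight_nonneg _ (h.edges ▸ List.mem_toFinset.2 (List.getElem_mem hi))

theorem inj (h : InputNet G l job mach w) {i j : ℕ} (hi : i < l.length) (hj : j < l.length)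
    (h1 : job i = job j) (h2 : mach i = mach j) : i = j := by
  rw [h.job_eq i hi, h.job_eq j hj] at h1
  rw [h.mach_eq i hi, h.mach_eq j hj] at h2
  exact (h.nodup.getElem_inj_iff).1 (Prod.ext (Fin.ext h1) (Fin.ext h2))

/-- Every edge has a number. -/
theorem exists_index (h : InputNet G l job mach w) {e : Fin p × Fin q} (he : e ∈ G.edges) :
    ∃ i, ∃ hi : i < l.length, l[i] = e := by
  rw [← h.edges, List.mem_toFinset] at he
  exact List.getElem_of_mem he

open Classical in
/-- The cost of a machine, computed along its chain. -/
theorem machineCost_eq (h : InputNet G l job mach w) {M : Finset (Fin p × Fin q)}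
    (hM : M ⊆ G.edges) {nx pv : ℕ → ℕ} {L : ℕ → List ℕ}
    (hL : Chains l.length q l.length mach nx pv w L) (v : Fin q) {a : ℕ → ℕ}
    (ha : ∀ i (hi : i < l.length), a i = if l[i] ∈ M then 1 else 0) :
    G.machineCost M v = loadCost w a (L v) 0 := by
  set P : ℕ → Prop := fun i => ∃ hi : i < l.length, l[i] ∈ M with hP
  have hmem := hL.mem v v.isLt
  have hlt : ∀ i ∈ L v, i < l.length := fun i hi => ((hmem i).1 hi).1
  rw [loadCost_eq_posCost w a P (L v) fun i hi => by
    rw [ha i (hlt i hi)]; simp [hP, hlt i hi]]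
  unfold WeightedGraph.machineCost
  rw [sum_eq_posCost_reverse]
  congr 1
  rw [List.reverse_eq_iff]
  have hperm : ((M.filter fun e => e.2 = v).val.map G.weight) =
      (((L v).filter P).map w : List ℝ) := by
    have hinj : Set.InjOn (fun i => l[i]?) {i | i < l.length} := by
      intro i hi j hj hij
      simp only [Set.mem_ofPred_eq] at hi hj
      simp only [List.getElem?_eq_getElem hi, List.getElem?_eq_getElem hj, Option.some_inj] at hij
      exact (h.nodup.getElem_inj_iff).1 hij
    have h1 : (M.filter fun e => e.2 = v).val.map some =
        (((L v).filter P : List ℕ) : Multiset ℕ).map fun i => l[i]? := by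
      refine Multiset.Nodup.ext ?_ ?_ |>.2 ?_
      · exact (Finset.nodup _).map (Option.some_injective _)
      · refine Multiset.Nodup.map_on ?_ ?_
        · intro i hi j hj hij
          simp only [Multiset.mem_coe, List.mem_filter] at hi hj
          exact hinj (hlt i hi.1) (hlt j hj.1) hij
        · exact (hL.nodup v v.isLt).filter _
      · intro o
        simp only [Multiset.mem_map, Finset.mem_val, Finset.mem_filter, Multiset.mem_coe,
          List.mem_filter, decide_eq_true_eq]
        constructor
        · rintro ⟨e, ⟨he, hev⟩, rfl⟩
          obtain ⟨i, hi, rfl⟩ := h.exists_index (hM he)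
          exact ⟨i, ⟨(hmem i).2 ⟨hi, by rw [h.mach_eq i hi, hev]⟩, hi, he⟩,
            List.getElem?_eq_getElem hi⟩
        · rintro ⟨i, ⟨h2, hi, he⟩, rfl⟩
          refine ⟨l[i], ⟨he, ?_⟩, (List.getElem?_eq_getElem hi).symm⟩
          exact Fin.ext (by rw [← h.mach_eq i hi, ((hmem i).1 h2).2])
    have h2 := congrArg (Multiset.map fun o : Option (Fin p × Fin q) => o.elim 0 G.weight) h1
    rw [Multiset.map_map, Multiset.map_map] at h2
    rw [← Multiset.map_coe]
    refine Eq.trans ?_ (h2.trans ?_)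
    · rfl
    · refine Multiset.map_congr rfl fun i hi => ?_
      simp only [Multiset.mem_coe, List.mem_filter] at hi
      have := hlt i hi.1
      simp [List.getElem?_eq_getElem this, h.w_eq i this]
  have hsort : (G.sortedWeights M v).Pairwise (· ≤ ·) := Multiset.pairwise_sort _ _
  refine List.Perm.eq_of_pairwise' (r := (· ≤ ·)) hsort ?_ ?_
  · rw [List.pairwise_reverse, List.pairwise_map]
    exact (hL.sorted v v.isLt).filter _
  · refine List.Perm.trans ?_ (List.reverse_perm _).symm
    rw [← Multiset.coe_eq_coe, ← hperm, WeightedGraph.sortedWeights]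
    convert Multiset.sort_eq _ _

/-- A semi-matching contains exactly one of the numbered edges of job `u`. -/
theorem exists_unique_index (h : InputNet G l job mach w) {M : Finset (Fin p × Fin q)}
    (hM : G.IsSemiMatching M) {u : ℕ} (hu : u < p) :
    ∃ i < l.length, job i = u ∧ ∃ hi : i < l.length, l[i] ∈ M ∧
      ∀ j, ∀ hj : j < l.length, job j = u → l[j] ∈ M → j = i := by
  obtain ⟨e, ⟨he, heu⟩, huniq⟩ := hM.2 ⟨u, hu⟩
  obtain ⟨i, hi, rfl⟩ := h.exists_index (hM.1 he)
  refine ⟨i, hi, by rw [h.job_eq i hi, heu], hi, he, fun j hj hju hjM => ?_⟩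
  refine (h.nodup.getElem_inj_iff (hi := hj) (hj := hi)).1 (huniq _ ⟨hjM, Fin.ext ?_⟩)
  rw [← h.job_eq j hj, hju]

variable {s : State} {asg f nx pv : ℕ → ℕ} {y : ℕ → ℝ} {L : ℕ → List ℕ}

/-- An assignment of all jobs to their edges is a semi-matching. -/
theorem isSemiMatching (h : InputNet G l job mach w)
    (hasg : ∀ u < p, asg u < l.length ∧ job (asg u) = u)
    (hs : ∀ u < p, s.wordArr 2 u = mach (asg u)) :
    G.IsSemiMatching (outputEdges p q s) ∧
      ∀ i (hi : i < l.length), l[i] ∈ outputEdges p q s ↔ asg (job i) = i := by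
  have h2 : ∀ i (hi : i < l.length), l[i] ∈ outputEdges p q s ↔ asg (job i) = i := by
    intro i hi
    have hj := h.job_lt hi
    simp only [outputEdges, Finset.mem_filter, Finset.mem_univ, true_and]
    rw [← h.job_eq i hi, ← h.mach_eq i hi, hs _ hj]
    exact ⟨fun e => h.inj (hasg _ hj).1 hi (hasg _ hj).2 e, fun e => by rw [e]⟩
  have h3 : ∀ e, e ∈ outputEdges p q s → ∃ hi : asg e.1 < l.length, l[asg e.1] = e := by
    intro e he
    simp only [outputEdges, Finset.mem_filter, Finset.mem_univ, true_and] at he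
    have ha := hasg e.1 e.1.isLt
    refine ⟨ha.1, Prod.ext (Fin.ext ?_) (Fin.ext ?_)⟩
    · rw [← h.job_eq _ ha.1, ha.2]
    · rw [← h.mach_eq _ ha.1, ← hs _ e.1.isLt, he]
  refine ⟨⟨?_, ?_⟩, h2⟩
  · intro e he
    obtain ⟨hi, h4⟩ := h3 e he
    rw [← h4, ← h.edges, List.mem_toFinset]
    exact List.getElem_mem hi
  · intro u
    have ha := hasg u u.isLt
    refine ⟨l[asg u]'ha.1, ⟨(h2 _ ha.1).2 (by rw [ha.2]), Fin.ext ?_⟩, ?_⟩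
    · rw [← h.job_eq _ ha.1, ha.2]
    · rintro e ⟨he, rfl⟩
      obtain ⟨hi, h4⟩ := h3 e he
      exact h4.symm

open Classical in
/-- A feasible potential is a certificate of optimality. -/
theorem isOptimal (h : InputNet G l job mach w)
    (hL : Chains l.length q l.length mach nx pv w L)
    (hy : Net.Feasible ⟨l.length, job, nx, pv, w⟩ p f asg y)
    (hall : ∀ u < p, ∃ i < l.length, job i = u)
    (hs : ∀ u < p, s.wordArr 2 u = mach (asg u)) :
    G.IsOptimal (outputEdges p q s) := by
  have hN := hL.good (fun i hi => h.mach_lt hi) (fun i hi => h.w_nonneg hi) h.w_end job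
  have hasg : ∀ u < p, asg u < l.length ∧ job (asg u) = u := by
    intro u hu
    obtain ⟨i, hi, rfl⟩ := hall u hu
    exact ⟨hy.asg_lt i hi hu, hy.job_asg i hi hu⟩
  obtain ⟨hsemi, hmem⟩ := h.isSemiMatching hasg hs
  refine ⟨hsemi, fun M' hM' => ?_⟩
  set M := outputEdges p q s
  set a : ℕ → ℕ := fun i => if asg (job i) = i then 1 else 0 with ha
  set a' : ℕ → ℕ := fun i => if ∃ hi : i < l.length, l[i] ∈ M' then 1 else 0 with ha'
  have h1 : ∀ v : Fin q, ((L v).map fun i => y i * ((a' i : ℝ) - a i)).sum ≤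
      G.machineCost M' v - G.machineCost M v := by
    intro v
    rw [h.machineCost_eq hsemi.1 hL v (a := a) fun i hi => by simp [ha, hmem i hi],
      h.machineCost_eq hM'.1 hL v (a := a') fun i hi => by simp [ha', hi]]
    have := hy.loadCost_le hN (a := a) (a' := a')
      (fun i hi => by
        have : job i < p := h.job_lt hi
        simp [ha, this])
      (fun i hi => by simp only [ha']; split_ifs <;> simp) (L v)
      (fun i hi => ((hL.mem v v.isLt i).1 hi).1) _ 0 0 (hL.chain v v.isLt)
      (by rw [if_neg]; simp only; omega)
    simpa using this
  have h2 : ∀ v : Fin q, ((L v).map fun i => y i * ((a' i : ℝ) - a i)).sum =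
      ∑ i ∈ (Finset.range l.length).filter (fun i => mach i = v), y i * ((a' i : ℝ) - a i) := by
    intro v
    rw [← List.sum_toFinset _ (hL.nodup v v.isLt)]
    refine Finset.sum_congr ?_ fun _ _ => rfl
    ext i
    simp [hL.mem v v.isLt i]
  have h3 : ∑ v : Fin q, ((L v).map fun i => y i * ((a' i : ℝ) - a i)).sum =
      ∑ i ∈ Finset.range l.length, y i * ((a' i : ℝ) - a i) := by
    simp only [h2]
    rw [Fin.sum_univ_eq_sum_range (fun v => ∑ i ∈ (Finset.range l.length).filter
      (fun i => mach i = v), y i * ((a' i : ℝ) - a i)) q]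
    exact Finset.sum_fiberwise_of_maps_to
      (fun i hi => Finset.mem_range.2 (h.mach_lt (Finset.mem_range.1 hi))) _
  have h4 : 0 ≤ ∑ i ∈ Finset.range l.length, y i * ((a' i : ℝ) - a i) := by
    rw [← Finset.sum_fiberwise_of_maps_to (t := Finset.range p) (g := job)
      (fun i hi => Finset.mem_range.2 (h.job_lt (Finset.mem_range.1 hi)))]
    refine Finset.sum_nonneg fun u hu => ?_
    rw [Finset.mem_range] at hu
    obtain ⟨j, hj, hju, hj', hjM, hjuniq⟩ := h.exists_unique_index hM' hu
    obtain ⟨hi, hiu⟩ := hasg u hu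
    simp only [mul_sub, Finset.sum_sub_distrib]
    rw [Finset.sum_eq_single j, Finset.sum_eq_single (asg u)]
    · have e1 : a' j = 1 := by simp [ha', hj, hjM]
      have e2 : a (asg u) = 1 := by simp [ha, hiu]
      have := hy.arc (.switch j hj (by rw [← hju] at hu; exact hu))
      simp only [hju, zero_add] at this
      rw [e1, e2]; simpa using this
    · intro i hi' hne
      rw [Finset.mem_filter] at hi'
      have : a i = 0 := by
        simp only [ha, hi'.2]
        rw [if_neg hne.symm]
      simp [this]
    · intro hc
      exact absurd (Finset.mem_filter.2 ⟨Finset.mem_range.2 hi, hiu⟩) hc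
    · intro i hi' hne
      rw [Finset.mem_filter, Finset.mem_range] at hi'
      have : a' i = 0 := by
        simp only [ha']
        rw [if_neg]
        rintro ⟨h5, h6⟩
        exact hne (hjuniq i h5 hi'.2 h6)
      simp [this]
    · intro hc
      exact absurd (Finset.mem_filter.2 ⟨Finset.mem_range.2 hj, hju⟩) hc
  have h5 := Finset.sum_le_sum fun v (_ : v ∈ Finset.univ) => h1 v
  rw [h3, Finset.sum_sub_distrib] at h5
  unfold WeightedGraph.cost
  linarith

end InputNet

end Optimal

namespace Code

/-! ### The queue -/

section Queue

variable {W : ℕ}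

theorem pull_exec {μ : Mem} (hW : 4 * μ.m + 9 ≤ W) (ht : μ.t < μ.m) :
    ∃ a, (a = μ.tree (2 * μ.t) ∨ a = μ.tree (2 * μ.t + 1)) ∧
      Beats μ.st μ.Y μ.y a (μ.tree (2 * μ.t)) ∧ Beats μ.st μ.Y μ.y a (μ.tree (2 * μ.t + 1)) ∧
      pull.exec W μ.toState = Mem.toState { μ with tree := update μ.tree μ.t a } := by
  have e1 : 1 % W = 1 := Nat.mod_eq_of_lt (by omega)
  have e2 : 2 % W = 2 := Nat.mod_eq_of_lt (by omega)
  have e3 : (2 * μ.t) % W = 2 * μ.t := Nat.mod_eq_of_lt (by omega)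
  have e4 : (2 * μ.t + 1) % W = 2 * μ.t + 1 := Nat.mod_eq_of_lt (by omega)
  simp only [pull, better, Program.exec, BExp.eval, WExp.eval, RExp.eval, Mem.word_t, Mem.arr_tree,
    Mem.arr_st, Mem.arr_Y, Mem.arr_y, Mem.store_tree, e1, e2, e3, e4]
  generalize μ.tree (2 * μ.t) = d
  generalize μ.tree (2 * μ.t + 1) = c
  split_ifs with h
  · exact ⟨d, .inl rfl, .refl d, fun hc => ⟨h.1, h.2.resolve_left fun h2 => h2 hc⟩, rfl⟩
  · refine ⟨c, .inr rfl, fun hd => ?_, .refl c, rfl⟩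
    push Not at h
    exact ⟨(h hd).1, (h hd).2.le⟩

/-- The loop climbs from the parent of the leaf `m + x` to the root, in at most `L` rounds. -/
theorem sift_ends {L : ℕ} {μ : Mem} (hW : 4 * μ.m + 9 ≤ W) (hx : μ.x < μ.m) (hL : μ.m ≤ 2 ^ L)
    (h : TreeOn μ.m μ.tree μ.st μ.Y μ.y fun j => ∃ r, j = (μ.m + μ.x) / 2 / 2 ^ r) :
    Ends W sift μ (100 * (L + 1) + 10) fun μ' => ∃ T t, μ' = { μ with tree := T, t := t } ∧
      TreeOn μ.m T μ.st μ.Y μ.y fun _ => False := by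
  have e1 : 1 % W = 1 := Nat.mod_eq_of_lt (by omega)
  have e2 : 2 % W = 2 := Nat.mod_eq_of_lt (by omega)
  refine Ends.seq (T₁ := 6) (T₂ := 100 * (L + 1))
    (R := fun ν => ν = { μ with t := (μ.m + μ.x) / 2 }) ?_ ?_ (by omega)
  · refine Ends.of_exec (μ' := { μ with t := (μ.m + μ.x) / 2 }) trivial ?_ (by decide) rfl
    have e3 : (μ.m + μ.x) % W = μ.m + μ.x := Nat.mod_eq_of_lt (by omega)
    simp [Program.exec, WExp.eval, e2, e3]
  rintro _ rfl
  refine Ends.while (T₁ := 90) (n := L) (fun n ν => ∃ T t, ν = { μ with tree := T, t := t } ∧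
    t < 2 ^ n ∧ t < μ.m ∧ TreeOn μ.m T μ.st μ.Y μ.y fun j => ∃ r, j = t / 2 ^ r) ?_ ?_ ?_ ?_
  · rintro n _ ⟨T, t, rfl, htn, htm, hT⟩ hb
    replace hb : 1 ≤ t := by simpa [BExp.eval, WExp.eval, e1] using hb
    obtain ⟨a, h1, h2, h3, h4⟩ := pull_exec (W := W) (μ := { μ with tree := T, t := t }) hW htm
    refine Ends.of_exec (μ' := { μ with tree := update T t a, t := t / 2 }) ?_ ?_ ?_ ?_
    · exact ⟨⟨trivial, trivial⟩, trivial⟩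
    · rw [Program.exec, h4]
      simp [Program.exec, WExp.eval, e2]
    · decide
    · have hn : n ≠ 0 := by rintro rfl; simp at htn; omega
      refine ⟨n - 1, by omega, _, _, rfl, ?_, by omega, ?_⟩
      · obtain ⟨k, rfl⟩ := Nat.exists_eq_succ_of_ne_zero hn
        rw [Nat.succ_sub_one]
        rw [pow_succ] at htn
        omega
      · have hle : ∀ r, t / 2 ^ r ≤ t := fun r => Nat.div_le_self _ _
        refine (hT.pull hb htm ?_ ?_ ?_ h1 h2 h3).mono ?_
        · rintro ⟨r, hr⟩; have := hle r; omega
        · rintro ⟨r, hr⟩; have := hle r; omega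
        · exact fun _ => ⟨1, by simp⟩
        · rintro j hj ⟨⟨r, rfl⟩, hne⟩
          rcases r with _ | r
          · simp at hne
          · exact ⟨r, by rw [pow_succ', Nat.div_div_eq_div_mul]⟩
  · exact ⟨_, _, rfl, by omega, by omega, h⟩
  · rw [mul_comm]
    exact Nat.mul_le_mul_right _ (by decide)
  · rintro n _ ⟨T, t, rfl, -, -, hT⟩ hb
    replace hb : t = 0 := by simpa [BExp.eval, WExp.eval, e1] using hb
    subst hb
    refine ⟨T, 0, rfl, hT.mono ?_⟩
    rintro j hj ⟨r, hr⟩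
    simp at hr; omega

theorem build_ends {μ : Mem} (hW : 4 * μ.m + 9 ≤ W) (h : ∀ i < μ.m, μ.tree (μ.m + i) = i) :
    Ends W build μ (110 * (μ.m + 1)) fun μ' => ∃ T t, μ' = { μ with tree := T, t := t } ∧
      TreeOn μ.m T μ.st μ.Y μ.y fun _ => False := by
  have e1 : 1 % W = 1 := Nat.mod_eq_of_lt (by omega)
  refine Ends.seq (T₁ := 2) (T₂ := 100 * (μ.m + 1)) (R := fun ν => ν = { μ with t := μ.m })
    ?_ ?_ (by omega)
  · refine Ends.of_exec (μ' := { μ with t := μ.m }) trivial ?_ (by decide) rfl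
    simp [Program.exec, WExp.eval]
  rintro _ rfl
  refine Ends.while (T₁ := 90) (n := μ.m) (fun n ν => ∃ T, ν = { μ with tree := T, t := n } ∧
    n ≤ μ.m ∧ TreeOn μ.m T μ.st μ.Y μ.y fun j => j < n) ?_ ?_ ?_ ?_
  · rintro n _ ⟨T, rfl, hn, hT⟩ hb
    replace hb : 1 < n := by simpa [BExp.eval, WExp.eval, e1] using hb
    obtain ⟨a, h1, h2, h3, h4⟩ := pull_exec (W := W) (μ := { μ with tree := T, t := n - 1 }) hW
      (by simp only; omega)
    simp only at h1 h2 h3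
    refine Ends.of_exec (μ' := { μ with tree := update T (n - 1) a, t := n - 1 }) ?_ ?_ ?_ ?_
    · exact ⟨trivial, ⟨trivial, trivial⟩⟩
    · rw [Program.exec]
      simp only [Program.exec, WExp.eval, e1, Mem.word_t, Mem.set_t]
      exact h4
    · decide
    · refine ⟨n - 1, by omega, _, rfl, by omega, ?_⟩
      refine (hT.pull (t := n - 1) (by omega) (by omega) (by omega) (by omega)
        (fun _ => by omega) h1 h2 h3).mono ?_
      rintro j hj ⟨h5, h6⟩; omega
  · refine ⟨μ.tree, rfl, le_rfl, h, ?_, ?_⟩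
    · intro j hj hj2 hb
      have := h (j - μ.m) (by omega)
      rw [Nat.add_sub_cancel' (by omega)] at this
      rw [this]
      exact ⟨by omega, 0, by simp; omega⟩
    · intro j hj hj2 hb; omega
  · rw [mul_comm]
    exact Nat.mul_le_mul_right _ (by decide)
  · rintro n _ ⟨T, rfl, -, hT⟩ hb
    replace hb : n ≤ 1 := by simpa [BExp.eval, WExp.eval, e1] using hb
    refine ⟨T, n, rfl, hT.mono fun j hj hlt => ?_⟩
    omega

end Queue

end Code

/-- The network stored in the memory. -/
def Mem.net (μ : Mem) : Net := ⟨μ.m, μ.job, μ.nx, μ.pv, μ.w⟩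

namespace Code

/-! ### Verification of the search -/

/-- The memories differ at most in the cells that the search writes. -/
def Keep (μ ν : Mem) : Prop :=
  ∃ x z t k r st kd tgt tree Y, ν = { μ with
    x := x, z := z, t := t, k := k, r := r, st := st, kd := kd, tgt := tgt, tree := tree, Y := Y }

theorem Keep.refl (μ : Mem) : Keep μ μ := ⟨_, _, _, _, _, _, _, _, _, _, rfl⟩

theorem Keep.trans {μ ν ρ : Mem} (h₁ : Keep μ ν) (h₂ : Keep ν ρ) : Keep μ ρ := by
  obtain ⟨_, _, _, _, _, _, _, _, _, _, rfl⟩ := h₁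
  obtain ⟨_, _, _, _, _, _, _, _, _, _, rfl⟩ := h₂
  exact ⟨_, _, _, _, _, _, _, _, _, _, rfl⟩

/-- The invariant of the search and of its queue, for the contents of the memory `ν`. -/
structure Searching (ν : Mem) (τ : ℕ → ℕ) (z κ : ℕ) : Prop where
  feas : ν.net.Feasible ν.u ν.f ν.asg ν.y
  search : ν.net.Search ν.u ν.f ν.asg ν.y ν.st ν.kd ν.tgt ν.Y τ z κ
  tree : TreeOn ν.m ν.tree ν.st ν.Y ν.y fun _ => False

/-- The situation while the arcs into the finished node `z` are relaxed. -/
structure Relaxing (μ ν : Mem) (τ : ℕ → ℕ) (κ : ℕ) : Prop extends Searching ν τ ν.z κ where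
  keep : Keep μ ν
  z_lt : ν.z < ν.m
  done : ν.st ν.z = 2

variable {W L : ℕ} {τ : ℕ → ℕ} {κ : ℕ}

theorem Relaxing.advance {μ ν : Mem} (h : Relaxing μ ν τ κ)
    (hx : ∀ x c, ν.net.Arc ν.u ν.f ν.asg κ x ν.z c → x < ν.m → ν.st x ≠ 0 ∧ ν.Y x ≤ c + ν.Y ν.z) :
    Relaxing μ ν τ (κ + 1) :=
  { h with search := h.search.advance hx }

theorem relax_ends {μ ν : Mem} {c : ℝ} (hW : 4 * ν.m + 9 ≤ W) (hL : ν.m ≤ 2 ^ L)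
    (h : Relaxing μ ν τ κ) (hx : ν.x < ν.m)
    (ha : ν.net.Arc ν.u ν.f ν.asg ν.k ν.x ν.z c) (hr : ν.r = c + ν.Y ν.z) :
    Ends W relax ν (100 * (L + 1) + 60) fun ν' => Relaxing μ ν' τ κ ∧ Keep ν ν' ∧ ν'.z = ν.z ∧
      finished ν'.m ν'.st = finished ν.m ν.st ∧ ν'.st ν.x ≠ 0 ∧ ν'.Y ν.x ≤ c + ν'.Y ν.z := by
  have e1 : 1 % W = 1 := Nat.mod_eq_of_lt (by omega)
  have hcond : (BExp.or (.wordEq (stOf vX) (.const 0))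
      (.and (.wordEq (stOf vX) (.const 1)) (.not (.realLE (YOf vX) vR)))).eval W ν.toState ↔
      ν.st ν.x = 0 ∨ ν.st ν.x = 1 ∧ ¬ ν.Y ν.x ≤ c + ν.Y ν.z := by
    simp [BExp.eval, WExp.eval, RExp.eval, e1, hr]
  refine Ends.ite (T₁ := 100 * (L + 1) + 30) ?_ ?_ ?_
  · intro hb
    rw [hcond] at hb
    obtain ⟨hfin, hs⟩ := h.search.relax_take h.feas ha hx h.z_lt h.done hb
    have hxz : ν.x ≠ ν.z := by
      intro hc
      have := h.done
      rw [← hc] at this; omega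
    refine Ends.seq (T₁ := 12) (T₂ := 100 * (L + 1) + 10)
      (R := fun ρ => ρ = { ν with
        Y := update ν.Y ν.x (c + ν.Y ν.z), st := update ν.st ν.x 1,
        kd := update ν.kd ν.x ν.k, tgt := update ν.tgt ν.x ν.z }) ?_ ?_ (by omega)
    · refine Ends.of_exec (μ' := { ν with
        Y := update ν.Y ν.x (c + ν.Y ν.z), st := update ν.st ν.x 1,
        kd := update ν.kd ν.x ν.k, tgt := update ν.tgt ν.x ν.z }) ?_ ?_ (by decide) rfl
      · exact ⟨trivial, trivial, trivial, trivial⟩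
      · simp [Program.exec, WExp.eval, RExp.eval, e1, hr]
    rintro _ rfl
    refine (sift_ends (μ := { ν with
        Y := update ν.Y ν.x (c + ν.Y ν.z), st := update ν.st ν.x 1,
        kd := update ν.kd ν.x ν.k, tgt := update ν.tgt ν.x ν.z }) hW hx hL ?_).mono le_rfl ?_
    · exact h.tree.touch (x := ν.x) (fun i hi => Function.update_of_ne hi _ _)
        fun i hi => Function.update_of_ne hi _ _
    · rintro _ ⟨T, t, rfl, hT⟩
      refine ⟨⟨⟨h.feas, hs, hT⟩, ?_, h.z_lt, ?_⟩, ?_, rfl, hfin, ?_, ?_⟩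
      · exact h.keep.trans ⟨_, _, _, _, _, _, _, _, _, _, rfl⟩
      · simpa [Function.update_of_ne hxz.symm] using h.done
      · exact ⟨_, _, _, _, _, _, _, _, _, _, rfl⟩
      · simp
      · simp [Function.update_of_ne hxz.symm]
  · intro hb
    rw [hcond] at hb
    obtain ⟨h1, h2⟩ := h.search.relax_skip h.feas ha hx hb
    exact Ends.of_exec (μ' := ν) trivial rfl (by simp [Program.steps])
      ⟨h, .refl ν, rfl, rfl, h1, h2⟩
  · have : (BExp.or (.wordEq (stOf vX) (.const 0))
      (.and (.wordEq (stOf vX) (.const 1)) (.not (.realLE (YOf vX) vR)))).size + 1 ≤ 30 := by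
      decide
    omega

theorem relaxForward_ends {μ ν : Mem} (hW : 4 * (ν.p + ν.m) + 9 ≤ W) (hL : ν.m ≤ 2 ^ L)
    (hN : ν.net.Good) (hu : ν.u ≤ ν.p) (h : Relaxing μ ν τ 0) :
    Ends W relaxForward ν (100 * (L + 1) + 120) fun ν' => Relaxing μ ν' τ 1 ∧ Keep ν ν' ∧
      finished ν'.m ν'.st = finished ν.m ν.st := by
  have e1 : 1 % W = 1 := Nat.mod_eq_of_lt (by omega)
  refine Ends.seq (T₁ := 3) (T₂ := 100 * (L + 1) + 110)
    (R := fun ρ => ρ = { ν with x := ν.pv ν.z }) ?_ ?_ (by omega)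
  · exact Ends.of_exec (μ' := { ν with x := ν.pv ν.z }) trivial
      (by simp [Program.exec, WExp.eval]) (by decide) rfl
  rintro _ rfl
  have huniq : ∀ x c, ν.net.Arc ν.u ν.f ν.asg 0 x ν.z c → x < ν.m →
      x = ν.pv ν.z ∧ c = (ν.w x - ν.w ν.z) * (ν.f x + 1) := by
    intro x c ha hx
    obtain ⟨-, hz, hc⟩ := Net.arc_zero.1 ha
    have := hN.pv_nx x hx (hz ▸ h.z_lt)
    rw [← hz] at this
    exact ⟨this.symm, hc⟩
  refine Ends.ite (T₁ := 100 * (L + 1) + 100) ?_ ?_ ?_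
  · intro hb
    replace hb : ν.pv ν.z < ν.m := by simpa [BExp.eval, WExp.eval] using hb
    set x := ν.pv ν.z with hx
    have hf : ν.f x ≤ ν.u := h.feas.f_le x hb
    have e2 : (ν.f x + 1) % W = ν.f x + 1 := Nat.mod_eq_of_lt (by omega)
    refine Ends.seq (T₁ := 30) (T₂ := 100 * (L + 1) + 60)
      (R := fun ρ => ρ = { ν with
        x := x, r := ν.Y ν.z + (ν.f x + 1) * (ν.w x - ν.w ν.z), k := 0 }) ?_ ?_ (by omega)
    · refine Ends.of_exec (μ' := { ν with
        x := x, r := ν.Y ν.z + (ν.f x + 1) * (ν.w x - ν.w ν.z), k := 0 }) ⟨trivial, trivial⟩ ?_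
        (by decide) rfl
      simp [Program.exec, WExp.eval, RExp.eval, e1, e2]
    rintro _ rfl
    refine (relax_ends (μ := μ) (ν := { ν with
      x := x, r := ν.Y ν.z + (ν.f x + 1) * (ν.w x - ν.w ν.z), k := 0 }) (c := (ν.w x - ν.w ν.z) * (ν.f x + 1)) (by simp only; omega) hL
      ⟨⟨h.feas, h.search, h.tree⟩, ?_, h.z_lt, h.done⟩ hb ?_ (by simp only; ring)).mono le_rfl ?_
    · exact h.keep.trans ⟨_, _, _, _, _, _, _, _, _, _, rfl⟩
    · exact Net.arc_zero.2 ⟨hb, (hN.nx_pv ν.z h.z_lt hb).symm, rfl⟩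
    · rintro ν' ⟨h1, h2, h3, h4, h5, h6⟩
      refine ⟨h1.advance ?_, ⟨_, _, _, _, _, _, _, _, _, _, rfl⟩ |> fun h0 => Keep.trans h0 h2, h4⟩
      obtain ⟨_, _, _, _, _, _, _, _, _, _, rfl⟩ := h2
      intro x' c ha hx'
      simp only at h3
      subst h3
      obtain ⟨rfl, rfl⟩ := huniq x' c ha hx'
      exact ⟨h5, h6⟩
  · intro hb
    replace hb : ¬ ν.pv ν.z < ν.m := by simpa [BExp.eval, WExp.eval] using hb
    refine Ends.of_exec (μ' := { ν with x := ν.pv ν.z }) trivial rfl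
      (by simp [Program.steps]) ⟨Relaxing.advance ⟨⟨h.feas, h.search, h.tree⟩, ?_, h.z_lt,
        h.done⟩ ?_, ?_, rfl⟩
    · exact h.keep.trans ⟨_, _, _, _, _, _, _, _, _, _, rfl⟩
    · intro x' c ha hx'
      obtain ⟨rfl, -⟩ := huniq x' c ha hx'
      exact absurd hx' hb
    · exact ⟨_, _, _, _, _, _, _, _, _, _, rfl⟩
  · have : (BExp.lt vX vM).size + 1 ≤ 10 := by decide
    omega

theorem relaxBackward_ends {μ ν : Mem} (hW : 4 * ν.m + 9 ≤ W) (hL : ν.m ≤ 2 ^ L)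
    (h : Relaxing μ ν τ 1) :
    Ends W relaxBackward ν (100 * (L + 1) + 120) fun ν' => Relaxing μ ν' τ 2 ∧ Keep ν ν' ∧
      finished ν'.m ν'.st = finished ν.m ν.st := by
  have e1 : 1 % W = 1 := Nat.mod_eq_of_lt (by omega)
  refine Ends.seq (T₁ := 3) (T₂ := 100 * (L + 1) + 110)
    (R := fun ρ => ρ = { ν with x := ν.nx ν.z }) ?_ ?_ (by omega)
  · exact Ends.of_exec (μ' := { ν with x := ν.nx ν.z }) trivial
      (by simp [Program.exec, WExp.eval]) (by decide) rfl
  rintro _ rfl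
  refine Ends.ite (T₁ := 100 * (L + 1) + 90) ?_ ?_ ?_
  · intro hb
    replace hb : ν.nx ν.z < ν.m ∧ 0 < ν.f ν.z := by
      simpa [BExp.eval, WExp.eval, Nat.pos_iff_ne_zero] using hb
    set x := ν.nx ν.z with hx
    refine Ends.seq (T₁ := 30) (T₂ := 100 * (L + 1) + 60)
      (R := fun ρ => ρ = { ν with
        x := x, r := ν.Y ν.z - ν.f ν.z * (ν.w ν.z - ν.w x), k := 1 }) ?_ ?_ (by omega)
    · refine Ends.of_exec (μ' := { ν with
        x := x, r := ν.Y ν.z - ν.f ν.z * (ν.w ν.z - ν.w x), k := 1 }) ⟨trivial, trivial⟩ ?_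
        (by decide) rfl
      simp [Program.exec, WExp.eval, RExp.eval, e1]
    rintro _ rfl
    refine (relax_ends (μ := μ) (ν := { ν with
      x := x, r := ν.Y ν.z - ν.f ν.z * (ν.w ν.z - ν.w x), k := 1 }) (c := -((ν.w ν.z - ν.w x) * ν.f ν.z)) (by simp only; omega) hL
      ⟨⟨h.feas, h.search, h.tree⟩, ?_, h.z_lt, h.done⟩ hb.1 ?_ (by simp only; ring)).mono le_rfl ?_
    · exact h.keep.trans ⟨_, _, _, _, _, _, _, _, _, _, rfl⟩
    · exact Net.arc_one.2 ⟨h.z_lt, rfl, hb.2, rfl⟩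
    · rintro ν' ⟨h1, h2, h3, h4, h5, h6⟩
      refine ⟨h1.advance ?_, ⟨_, _, _, _, _, _, _, _, _, _, rfl⟩ |> fun h0 => Keep.trans h0 h2, h4⟩
      obtain ⟨_, _, _, _, _, _, _, _, _, _, rfl⟩ := h2
      intro x' c ha hx'
      simp only at h3
      subst h3
      obtain ⟨-, rfl, -, rfl⟩ := Net.arc_one.1 ha
      exact ⟨h5, h6⟩
  · intro hb
    replace hb : ¬ (ν.nx ν.z < ν.m ∧ 0 < ν.f ν.z) := by
      simpa [BExp.eval, WExp.eval, Nat.pos_iff_ne_zero] using hb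
    refine Ends.of_exec (μ' := { ν with x := ν.nx ν.z }) trivial rfl
      (by simp [Program.steps]) ⟨Relaxing.advance ⟨⟨h.feas, h.search, h.tree⟩, ?_, h.z_lt,
        h.done⟩ ?_, ?_, rfl⟩
    · exact h.keep.trans ⟨_, _, _, _, _, _, _, _, _, _, rfl⟩
    · intro x' c ha hx'
      obtain ⟨-, rfl, hf, -⟩ := Net.arc_one.1 ha
      exact absurd ⟨hx', hf⟩ hb
    · exact ⟨_, _, _, _, _, _, _, _, _, _, rfl⟩
  · have : (BExp.and (.lt vX vM) (.lt (.const 0) (fOf vZ))).size + 1 ≤ 20 := by decide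
    omega

theorem relaxSwitch_ends {μ ν : Mem} (hW : 4 * ν.m + 9 ≤ W) (hL : ν.m ≤ 2 ^ L)
    (h : Relaxing μ ν τ 2) :
    Ends W relaxSwitch ν (100 * (L + 1) + 120) fun ν' => Relaxing μ ν' τ 3 ∧ Keep ν ν' ∧
      finished ν'.m ν'.st = finished ν.m ν.st := by
  have e1 : 2 % W = 2 := Nat.mod_eq_of_lt (by omega)
  refine Ends.ite (T₁ := 100 * (L + 1) + 90) ?_ ?_ ?_
  · intro hb
    replace hb : ν.job ν.z < ν.u := by simpa [BExp.eval, WExp.eval] using hb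
    set x := ν.asg (ν.job ν.z) with hx
    have hxm : x < ν.m := h.feas.asg_lt _ h.z_lt hb
    refine Ends.seq (T₁ := 30) (T₂ := 100 * (L + 1) + 60)
      (R := fun ρ => ρ = { ν with x := x, r := ν.Y ν.z, k := 2 }) ?_ ?_ (by omega)
    · refine Ends.of_exec (μ' := { ν with x := x, r := ν.Y ν.z, k := 2 })
        ⟨trivial, trivial, trivial⟩ ?_ (by decide) rfl
      simp [Program.exec, WExp.eval, RExp.eval, e1, hx]
    rintro _ rfl
    refine (relax_ends (μ := μ) (ν := { ν with
      x := x, r := ν.Y ν.z, k := 2 }) (c := 0) (by simp only; omega) hL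
      ⟨⟨h.feas, h.search, h.tree⟩, ?_, h.z_lt, h.done⟩ hxm ?_ (by simp only; ring)).mono le_rfl ?_
    · exact h.keep.trans ⟨_, _, _, _, _, _, _, _, _, _, rfl⟩
    · exact Net.arc_two.2 ⟨h.z_lt, hb, rfl, rfl⟩
    · rintro ν' ⟨h1, h2, h3, h4, h5, h6⟩
      refine ⟨h1.advance ?_, ⟨_, _, _, _, _, _, _, _, _, _, rfl⟩ |> fun h0 => Keep.trans h0 h2, h4⟩
      obtain ⟨_, _, _, _, _, _, _, _, _, _, rfl⟩ := h2
      intro x' c ha hx'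
      simp only at h3
      subst h3
      obtain ⟨-, -, rfl, rfl⟩ := Net.arc_two.1 ha
      exact ⟨h5, h6⟩
  · intro hb
    replace hb : ¬ ν.job ν.z < ν.u := by simpa [BExp.eval, WExp.eval] using hb
    refine Ends.of_exec (μ' := ν) trivial rfl (by simp [Program.steps])
      ⟨h.advance ?_, .refl ν, rfl⟩
    intro x' c ha hx'
    exact absurd (Net.arc_two.1 ha).2.1 hb
  · have : (BExp.lt (jobOf vZ) vU).size + 1 ≤ 20 := by decide
    omega

theorem pop_ends {μ ν : Mem} {z : ℕ} (hW : 4 * ν.m + 9 ≤ W) (hL : ν.m ≤ 2 ^ L) (hm : 1 ≤ ν.m)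
    (h : Searching ν τ z 3) (hk : Keep μ ν) (h1 : ν.st (ν.tree 1) = 1) :
    Ends W pop ν (100 * (L + 1) + 30) fun ν' => Keep ν ν' ∧
      (finished ν'.m ν'.st).card = (finished ν.m ν.st).card + 1 ∧ ∃ τ', Relaxing μ ν' τ' 0 := by
  have e1 : 1 % W = 1 := Nat.mod_eq_of_lt (by omega)
  have e2 : 2 % W = 2 := Nat.mod_eq_of_lt (by omega)
  have hlt := h.tree.root_lt hm
  obtain ⟨hcard, hs⟩ := h.search.pop hlt h1 fun x hx hx1 => (h.tree.root_beats hx hx1).2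
  refine Ends.seq (T₁ := 12) (T₂ := 100 * (L + 1) + 10)
    (R := fun ρ => ρ = { ν with
      z := ν.tree 1, x := ν.tree 1, st := update ν.st (ν.tree 1) 2 }) ?_ ?_ (by omega)
  · refine Ends.of_exec (μ' := { ν with
      z := ν.tree 1, x := ν.tree 1, st := update ν.st (ν.tree 1) 2 }) ⟨trivial, trivial, trivial⟩ ?_
      (by decide) rfl
    simp [Program.exec, WExp.eval, e1, e2]
  rintro _ rfl
  refine (sift_ends (μ := { ν with
    z := ν.tree 1, x := ν.tree 1, st := update ν.st (ν.tree 1) 2 }) hW hlt hL ?_).mono le_rfl ?_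
  · exact h.tree.touch (fun i hi => Function.update_of_ne hi _ _) fun i hi => rfl
  · rintro _ ⟨T, t, rfl, hT⟩
    refine ⟨⟨_, _, _, _, _, _, _, _, _, _, rfl⟩, hcard, _, ⟨h.feas, hs, hT⟩, ?_, hlt, ?_⟩
    · exact hk.trans ⟨_, _, _, _, _, _, _, _, _, _, rfl⟩
    · simp

/-- The part of the memory that has been prepared when the first `n` nodes are initialized. -/
structure Prepared (μ : Mem) (n : ℕ) (tree st kd tgt : ℕ → ℕ) (y Y : ℕ → ℝ) : Prop where
  leaf : ∀ j < n, tree (μ.m + j) = j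
  old : ∀ j < n, y j = μ.Y j
  old_sink : y μ.m = 0
  rest : ∀ j, n ≤ j → Y j = μ.Y j
  queued : ∀ j < n, μ.nx j = μ.m →
    st j = 1 ∧ kd j = 0 ∧ tgt j = μ.m ∧ Y j = (μ.f j + 1) * μ.w j
  unreached : ∀ j < n, μ.nx j ≠ μ.m → st j = 0

theorem initSearch_ends {μ : Mem} (hW : 4 * (μ.p + μ.m) + 9 ≤ W) (hy : μ.y μ.m = 0)
    (hf : ∀ i < μ.m, μ.f i ≤ μ.p) :
    Ends W initSearch μ (110 * (μ.m + 1)) fun ν => ∃ i tree st kd tgt y Y,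
      ν = { μ with i := i, tree := tree, st := st, kd := kd, tgt := tgt, y := y, Y := Y } ∧
      Prepared μ μ.m tree st kd tgt y Y := by
  have e1 : 1 % W = 1 := Nat.mod_eq_of_lt (by omega)
  refine Ends.seq (T₁ := 2) (T₂ := 100 * (μ.m + 1)) (R := fun ν => ν = { μ with i := 0 })
    ?_ ?_ (by omega)
  · exact Ends.of_exec (μ' := { μ with i := 0 }) trivial (by simp [Program.exec, WExp.eval])
      (by decide) rfl
  rintro _ rfl
  refine Ends.while (T₁ := 90) (n := μ.m) (fun n ν => ∃ i tree st kd tgt y Y,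
      ν = { μ with i := i, tree := tree, st := st, kd := kd, tgt := tgt, y := y, Y := Y } ∧
      n + i = μ.m ∧ Prepared μ i tree st kd tgt y Y) ?_ ?_ ?_ ?_
  · rintro n _ ⟨i, tree, st, kd, tgt, y, Y, rfl, hn, h⟩ hb
    replace hb : i < μ.m := by simpa [BExp.eval, WExp.eval] using hb
    have e2 : (i + 1) % W = i + 1 := Nat.mod_eq_of_lt (by omega)
    have e3 : (μ.m + i) % W = μ.m + i := Nat.mod_eq_of_lt (by omega)
    have e4 : (μ.f i + 1) % W = μ.f i + 1 :=
      Nat.mod_eq_of_lt (by have := hf i hb; omega)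
    have hleaf : ∀ j < i + 1, update tree (μ.m + i) i (μ.m + j) = j := by
      intro j hj
      by_cases hji : j = i
      · subst hji; simp
      · rw [Function.update_of_ne (by omega)]; exact h.leaf j (by omega)
    have hold : ∀ j < i + 1, update y i (Y i) j = μ.Y j := by
      intro j hj
      by_cases hji : j = i
      · subst hji; simp [h.rest]
      · rw [Function.update_of_ne hji]; exact h.old j (by omega)
    have hsink : update y i (Y i) μ.m = 0 := by
      rw [Function.update_of_ne (by omega)]; exact h.old_sink
    by_cases hc : μ.nx i = μ.m
    · refine Ends.of_exec (μ' := { μ with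
        i := i + 1, tree := update tree (μ.m + i) i, st := update st i 1, kd := update kd i 0,
        tgt := update tgt i μ.m, y := update y i (Y i),
        Y := update Y i ((μ.f i + 1) * μ.w i) }) ?_ ?_ (by decide) ?_
      · exact ⟨trivial, trivial, ⟨⟨trivial, trivial, trivial, trivial⟩, trivial⟩, trivial⟩
      · simp [Program.exec, WExp.eval, RExp.eval, BExp.eval, e1, e2, e3, e4, hc]
      · refine ⟨n - 1, by omega, _, _, _, _, _, _, _, rfl, by omega, hleaf, hold, hsink, ?_, ?_, ?_⟩
        · intro j hj
          rw [Function.update_of_ne (by omega)]; exact h.rest j (by omega)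
        · intro j hj hjm
          by_cases hji : j = i
          · subst hji; simp
          · simp only [Function.update_of_ne hji]; exact h.queued j (by omega) hjm
        · intro j hj hjm
          have hji : j ≠ i := by rintro rfl; exact hjm hc
          rw [Function.update_of_ne hji]; exact h.unreached j (by omega) hjm
    · refine Ends.of_exec (μ' := { μ with
        i := i + 1, tree := update tree (μ.m + i) i, st := update st i 0, kd := kd,
        tgt := tgt, y := update y i (Y i), Y := Y }) ?_ ?_ (by decide) ?_
      · exact ⟨trivial, trivial, ⟨⟨trivial, trivial, trivial, trivial⟩, trivial⟩, trivial⟩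
      · simp [Program.exec, WExp.eval, RExp.eval, BExp.eval, e1, e2, e3, hc]
      · refine ⟨n - 1, by omega, _, _, _, _, _, _, _, rfl, by omega, hleaf, hold, hsink, ?_, ?_, ?_⟩
        · intro j hj
          exact h.rest j (by omega)
        · intro j hj hjm
          have hji : j ≠ i := by rintro rfl; exact hc hjm
          simp only [Function.update_of_ne hji]; exact h.queued j (by omega) hjm
        · intro j hj hjm
          by_cases hji : j = i
          · subst hji; simp
          · rw [Function.update_of_ne hji]; exact h.unreached j (by omega) hjm
  · exact ⟨0, _, _, _, _, _, _, rfl, by omega, by simp, by simp, hy, by simp, by simp, by simp⟩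
  · rw [mul_comm]
    exact Nat.mul_le_mul_right _ (by decide)
  · rintro n _ ⟨i, tree, st, kd, tgt, y, Y, rfl, hn, h⟩ hb
    replace hb : μ.m ≤ i := by simpa [BExp.eval, WExp.eval] using hb
    obtain rfl : i = μ.m := by omega
    exact ⟨_, _, _, _, _, _, _, rfl, h⟩

theorem search_ends {μ : Mem} (hW : 4 * (μ.p + μ.m) + 9 ≤ W) (hL : μ.m ≤ 2 ^ L) (hm : 1 ≤ μ.m)
    (hN : μ.net.Good) (hu : μ.u ≤ μ.p) (hy0 : μ.y μ.m = 0)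
    (hy : μ.net.Feasible μ.u μ.f μ.asg μ.Y) :
    Ends W search μ (1200 * (μ.m + 1) * (L + 1)) fun ν => ∃ i x z t k r st kd tgt tree y Y τ,
      ν = { μ with i := i, x := x, z := z, t := t, k := k, r := r, st := st, kd := kd,
                   tgt := tgt, tree := tree, y := y, Y := Y } ∧ y μ.m = 0 ∧
      μ.net.Feasible μ.u μ.f μ.asg Y ∧ μ.net.Shortest μ.u μ.f μ.asg kd tgt Y τ := by
  have e1 : 1 % W = 1 := Nat.mod_eq_of_lt (by omega)
  refine Ends.seq (T₂ := 110 * (μ.m + 1) + (μ.m + 1) * (400 * (L + 1) + 450))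
    (initSearch_ends hW hy0 fun i hi => (hy.f_le i hi).trans hu) ?_ ?_
  swap
  · have h1 : 1 * (μ.m + 1) ≤ (L + 1) * (μ.m + 1) := Nat.mul_le_mul_right _ (by omega)
    have h2 : (μ.m + 1) * (400 * (L + 1) + 450) =
        400 * ((L + 1) * (μ.m + 1)) + 450 * (μ.m + 1) := by ring
    have h3 : 1200 * (μ.m + 1) * (L + 1) = 1200 * ((L + 1) * (μ.m + 1)) := by ring
    rw [h2, h3]
    omega
  rintro _ ⟨i, T, st, kd, tgt, y, Y, rfl, hp⟩
  refine Ends.seq (T₂ := (μ.m + 1) * (400 * (L + 1) + 450))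
    (build_ends (μ := { μ with i := i, tree := T, st := st, kd := kd, tgt := tgt, y := y, Y := Y })
      (by simp only; omega) hp.leaf) ?_ le_rfl
  rintro _ ⟨T', t, rfl, hT⟩
  simp only at hT
  have hyy : μ.net.Feasible μ.u μ.f μ.asg y := by
    refine hy.congr hN fun i hi => ?_
    rcases hi.lt_or_eq with hi | rfl
    · exact hp.old i hi
    · rw [hy.sink]; exact hp.old_sink
  have hs := Net.Search.start (st := st) (kd := kd) (tgt := tgt) (Y := Y) hN hyy
    ((hp.rest _ le_rfl).trans hy.sink) hp.queued hp.unreached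
  set ν₀ : Mem := { μ with
    i := i, tree := T', st := st, kd := kd, tgt := tgt, y := y, Y := Y, t := t } with hν₀
  refine Ends.while (T₁ := 400 * (L + 1) + 440) (n := μ.m - (finished μ.m st).card)
    (fun n ν => Keep ν₀ ν ∧ n + (finished ν.m ν.st).card = ν.m ∧ ∃ τ z, Searching ν τ z 3)
    ?_ ?_ ?_ ?_
  · rintro n ν ⟨hk, hn, τ, z, h⟩ hb
    replace hb : ν.st (ν.tree 1) = 1 := by simpa [BExp.eval, WExp.eval, e1] using hb
    obtain ⟨rp, rq, rm, ru, rnet⟩ : ν.p = μ.p ∧ ν.q = μ.q ∧ ν.m = μ.m ∧ ν.u = μ.u ∧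
        ν.net = μ.net := by
      obtain ⟨_, _, _, _, _, _, _, _, _, _, rfl⟩ := hk
      exact ⟨rfl, rfl, rfl, rfl, rfl⟩
    refine Ends.seq (T₁ := 100 * (L + 1) + 30) (T₂ := 300 * (L + 1) + 410)
      (pop_ends (μ := ν₀) (by omega) (by omega) (by omega) h hk hb) ?_ (by omega)
    rintro ν₁ ⟨k₁, hc₁, τ₁, h₁⟩
    have s₁ : ν₁.p = μ.p ∧ ν₁.m = μ.m ∧ ν₁.u = μ.u ∧ ν₁.net = μ.net := by
      obtain ⟨_, _, _, _, _, _, _, _, _, _, rfl⟩ := k₁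
      exact ⟨rp, rm, ru, rnet⟩
    refine Ends.seq (T₂ := 200 * (L + 1) + 280)
      (relaxForward_ends (L := L) (by omega) (by omega) (s₁.2.2.2 ▸ hN) (by omega) h₁) ?_ (by omega)
    rintro ν₂ ⟨h₂, k₂, hc₂⟩
    have s₂ : ν₂.m = μ.m := by
      obtain ⟨_, _, _, _, _, _, _, _, _, _, rfl⟩ := k₂
      exact s₁.2.1
    refine Ends.seq (T₂ := 100 * (L + 1) + 140)
      (relaxBackward_ends (L := L) (by omega) (by omega) h₂) ?_ (by omega)
    rintro ν₃ ⟨h₃, k₃, hc₃⟩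
    have s₃ : ν₃.m = μ.m := by
      obtain ⟨_, _, _, _, _, _, _, _, _, _, rfl⟩ := k₃
      exact s₂
    refine (relaxSwitch_ends (L := L) (by omega) (by omega) h₃).mono (by omega) ?_
    rintro ν₄ ⟨h₄, k₄, hc₄⟩
    have s₄ : ν₄.m = μ.m := by
      obtain ⟨_, _, _, _, _, _, _, _, _, _, rfl⟩ := k₄
      exact s₃
    have hle : (finished ν₄.m ν₄.st).card ≤ ν₄.m :=
      (Finset.card_filter_le _ _).trans (by simp)
    have hcard : (finished ν₄.m ν₄.st).card = (finished ν.m ν.st).card + 1 := by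
      rw [hc₄, hc₃, hc₂, hc₁]
    exact ⟨n - 1, by omega, h₄.keep, by omega, _, _, h₄.toSearching⟩
  · refine ⟨.refl _, ?_, _, _, hyy, hs, hT⟩
    have hle : (finished μ.m st).card ≤ μ.m := (Finset.card_filter_le _ _).trans (by simp)
    simp only [hν₀]
    omega
  · have hle : μ.m - (finished μ.m st).card + 1 ≤ μ.m + 1 := by omega
    refine Nat.mul_le_mul hle ?_
    have : (BExp.wordEq (stOf (treeOf (.const 1))) (.const 1)).size + 1 ≤ 10 := by decide
    omega
  · rintro n ν ⟨⟨_, _, _, _, _, _, _, _, _, _, rfl⟩, -, τ, z, h⟩ hb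
    simp [BExp.eval, WExp.eval, e1] at hb
    have hfin := h.search.finish hN hyy fun x hx h1 => hb (h.tree.root_beats hx h1).1
    exact ⟨_, _, _, _, _, _, _, _, _, _, _, _, _, rfl, hp.old_sink, hfin.feasible hyy, hfin⟩

/-! ### Verification of the augmentation -/

theorem findEdge_ends {μ : Mem} (hW : 4 * μ.m + 9 ≤ W) :
    Ends W findEdge μ (60 * (μ.m + 1)) fun ν => ∃ i e, ν = { μ with i := i, e := e } ∧
      (e < μ.m ∧ μ.job e = μ.u ∧ (∀ j < μ.m, μ.job j = μ.u → μ.Y e ≤ μ.Y j) ∨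
        e = μ.m ∧ ∀ j < μ.m, μ.job j ≠ μ.u) := by
  have e1 : 1 % W = 1 := Nat.mod_eq_of_lt (by omega)
  refine Ends.seq (T₁ := 4) (T₂ := 50 * (μ.m + 1)) (R := fun ν => ν = { μ with e := μ.m, i := 0 })
    ?_ ?_ (by omega)
  · exact Ends.of_exec (μ' := { μ with e := μ.m, i := 0 }) ⟨trivial, trivial⟩
      (by simp [Program.exec, WExp.eval]) (by decide) rfl
  rintro _ rfl
  refine Ends.while (T₁ := 40) (n := μ.m) (fun n ν => ∃ i e, ν = { μ with i := i, e := e } ∧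
      n + i = μ.m ∧ (e < μ.m ∧ μ.job e = μ.u ∧ (∀ j < i, μ.job j = μ.u → μ.Y e ≤ μ.Y j) ∨
        e = μ.m ∧ ∀ j < i, μ.job j ≠ μ.u)) ?_ ?_ ?_ ?_
  · rintro n _ ⟨i, e, rfl, hn, h⟩ hb
    replace hb : i < μ.m := by simpa [BExp.eval, WExp.eval] using hb
    have e2 : (i + 1) % W = i + 1 := Nat.mod_eq_of_lt (by omega)
    have hcases : ∀ {j}, j < i + 1 → j < i ∨ j = i := by omega
    have hcond : (BExp.and (.wordEq (jobOf vI) vU)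
        (.or (.wordEq vE vM) (.not (.realLE (YOf vE) (YOf vI))))).eval W
          (Mem.toState { μ with i := i, e := e }) ↔
        μ.job i = μ.u ∧ (e = μ.m ∨ ¬ μ.Y e ≤ μ.Y i) := Iff.rfl
    by_cases hc : μ.job i = μ.u ∧ (e = μ.m ∨ ¬ μ.Y e ≤ μ.Y i)
    · refine Ends.of_exec (μ' := { μ with i := i + 1, e := i })
        ⟨⟨trivial, trivial⟩, trivial⟩ ?_ (by decide) ?_
      · rw [Program.exec, Program.exec_ite_pos (hcond.2 hc)]
        simp [Program.exec, WExp.eval, e1, e2]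
      · refine ⟨n - 1, by omega, _, _, rfl, by omega, .inl ⟨hb, hc.1, fun j hj hju => ?_⟩⟩
        rcases hcases hj with hj | rfl
        · rcases h with h | h
          · exact (not_le.1 (hc.2.resolve_left h.1.ne)).le.trans (h.2.2 j hj hju)
          · exact absurd hju (h.2 j hj)
        · exact le_rfl
    · refine Ends.of_exec (μ' := { μ with i := i + 1, e := e })
        ⟨⟨trivial, trivial⟩, trivial⟩ ?_ (by decide) ?_
      · rw [Program.exec, Program.exec_ite_neg (mt hcond.1 hc)]
        simp [Program.exec, WExp.eval, e1, e2]
      · push Not at hc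
        refine ⟨n - 1, by omega, _, _, rfl, by omega, h.imp ?_ ?_⟩
        · rintro ⟨h1, h2, h3⟩
          refine ⟨h1, h2, fun j hj hju => ?_⟩
          rcases hcases hj with hj | rfl
          · exact h3 j hj hju
          · exact (hc hju).2
        · rintro ⟨h1, h2⟩
          refine ⟨h1, fun j hj hju => ?_⟩
          rcases hcases hj with hj | rfl
          · exact h2 j hj hju
          · exact (hc hju).1 h1
  · exact ⟨0, _, rfl, by omega, .inr ⟨rfl, by simp⟩⟩
  · rw [mul_comm]
    exact Nat.mul_le_mul_right _ (by decide)
  · rintro n _ ⟨i, e, rfl, hn, h⟩ hb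
    replace hb : μ.m ≤ i := by simpa [BExp.eval, WExp.eval] using hb
    obtain rfl : i = μ.m := by omega
    exact ⟨_, _, rfl, h⟩

theorem push_ends {μ : Mem} (hW : 4 * (μ.p + μ.m) + 9 ≤ W) (hN : μ.net.Good) (hu : μ.u ≤ μ.p)
    (hx : μ.x < μ.m) (h : μ.net.Augment μ.u μ.f μ.asg μ.kd μ.tgt μ.Y τ μ.x) :
    Ends W push μ 40 fun ν => ∃ f asg, ν = { μ with x := μ.tgt μ.x, f := f, asg := asg } ∧
      μ.net.Augment μ.u f asg μ.kd μ.tgt μ.Y τ (μ.tgt μ.x) := by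
  have e1 : 1 % W = 1 := Nat.mod_eq_of_lt (by omega)
  have hfree : push.LoopFree := ⟨⟨trivial, trivial, trivial⟩, trivial⟩
  by_cases h0 : μ.kd μ.x = 0
  · have hf : μ.f μ.x ≤ μ.u := h.room _ hx le_rfl h0
    have e2 : (μ.f μ.x + 1) % W = μ.f μ.x + 1 := Nat.mod_eq_of_lt (by omega)
    refine Ends.of_exec (μ' := { μ with
      x := μ.tgt μ.x, f := update μ.f μ.x (μ.f μ.x + 1) }) hfree ?_ (by decide)
      ⟨_, _, rfl, h.push_forward hN hx h0⟩
    simp [push, Program.exec, WExp.eval, BExp.eval, e1, e2, h0]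
  · by_cases h1 : μ.kd μ.x = 1
    · refine Ends.of_exec (μ' := { μ with
        x := μ.tgt μ.x, f := update μ.f (μ.tgt μ.x) (μ.f (μ.tgt μ.x) - 1) }) hfree ?_ (by decide)
        ⟨_, _, rfl, h.push_backward hN hx h1⟩
      simp [push, Program.exec, WExp.eval, BExp.eval, e1, h1]
    · refine Ends.of_exec (μ' := { μ with
        x := μ.tgt μ.x, asg := update μ.asg (μ.job μ.x) (μ.tgt μ.x) }) hfree ?_ (by decide)
        ⟨_, _, rfl, h.push_switch hx h0 h1⟩
      simp [push, Program.exec, WExp.eval, BExp.eval, e1, h0, h1]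

theorem augment_ends {μ : Mem} (hW : 4 * (μ.p + μ.m) + 9 ≤ W) (hN : μ.net.Good) (hu : μ.u ≤ μ.p)
    (hy : μ.net.Feasible μ.u μ.f μ.asg μ.Y)
    (hs : μ.net.Shortest μ.u μ.f μ.asg μ.kd μ.tgt μ.Y τ)
    (he : μ.e < μ.m ∧ μ.job μ.e = μ.u ∧ (∀ j < μ.m, μ.job j = μ.u → μ.Y μ.e ≤ μ.Y j) ∨
        μ.e = μ.m ∧ ∀ j < μ.m, μ.job j ≠ μ.u) :
    Ends W augment μ (60 * (μ.m + 1)) fun ν => ∃ x f asg ok,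
      ν = { μ with x := x, f := f, asg := asg, ok := ok } ∧
      μ.net.Feasible (μ.u + 1) f asg μ.Y ∧
      ((∃ j < μ.m, μ.job j = μ.u) → ok = μ.ok) ∧ ((¬ ∃ j < μ.m, μ.job j = μ.u) → ok = 0) := by
  refine Ends.ite (T₁ := 50 * (μ.m + 1)) ?_ ?_ ?_
  · intro hb
    replace hb : μ.e < μ.m := by simpa [BExp.eval, WExp.eval] using hb
    obtain ⟨-, hje, hmin⟩ := he.resolve_right fun h => hb.ne h.1
    refine Ends.seq (T₁ := 5) (T₂ := 45 * (μ.m + 1))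
      (R := fun ν => ν = { μ with asg := update μ.asg μ.u μ.e, x := μ.e }) ?_ ?_ (by omega)
    · exact Ends.of_exec (μ' := { μ with asg := update μ.asg μ.u μ.e, x := μ.e }) ⟨trivial, trivial⟩
        (by simp [Program.exec, WExp.eval]) (by decide) rfl
    rintro _ rfl
    -- the finishing time of the current node decreases with every step
    refine Ends.while (T₁ := 40) (n := τ μ.e) (fun n ν => ∃ x f asg,
        ν = { μ with x := x, f := f, asg := asg } ∧ n = τ x ∧ x ≤ μ.m ∧
        μ.net.Augment μ.u f asg μ.kd μ.tgt μ.Y τ x) ?_ ?_ ?_ ?_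
    · rintro n _ ⟨x, f, asg, rfl, rfl, hx, h⟩ hb
      replace hb : x < μ.m := by simpa [BExp.eval, WExp.eval] using hb
      refine (push_ends (μ := { μ with x := x, f := f, asg := asg }) hW hN hu hb h).mono le_rfl ?_
      rintro _ ⟨f', asg', rfl, h'⟩
      exact ⟨_, hs.time x hb, _, _, _, rfl, rfl, hs.tgt_le x hb, h'⟩
    · exact ⟨_, _, _, rfl, rfl, hb.le, .start hy hs hb hje hmin⟩
    · have h1 : τ μ.e + 1 ≤ μ.m + 1 := by have := hs.time_le _ hb; simp only [Mem.net] at this; omega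
      rw [mul_comm 45]
      exact Nat.mul_le_mul h1 (by decide)
    · rintro n _ ⟨x, f, asg, rfl, -, hx, h⟩ hc
      replace hc : μ.m ≤ x := by simpa [BExp.eval, WExp.eval] using hc
      obtain rfl : x = μ.m := by omega
      exact ⟨_, _, _, _, rfl, h.finish, fun _ => rfl, fun h => absurd ⟨_, hb, hje⟩ h⟩
  · intro hb
    replace hb : ¬ μ.e < μ.m := by simpa [BExp.eval, WExp.eval] using hb
    have h := (he.resolve_left fun h => hb h.1).2
    refine Ends.of_exec (μ' := { μ with ok := 0 }) trivial (by simp [Program.exec, WExp.eval])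
      (by simp [Program.steps, WExp.size]; omega) ⟨_, _, _, _, rfl, hy.skip h, ?_, fun _ => rfl⟩
    rintro ⟨j, hj, hju⟩
    exact absurd hju (h j hj)
  · have : (BExp.lt vE vM).size + 1 ≤ 10 := by decide
    omega

theorem assignAll_ends {μ : Mem} (hW : 4 * (μ.p + μ.m) + 9 ≤ W) (hL : μ.m ≤ 2 ^ L)
    (hm : 1 ≤ μ.m) (hN : μ.net.Good) (hf : μ.f = fun _ => 0) (hY : μ.Y = fun _ => 0)
    (hy : μ.y = fun _ => 0) :
    Ends W assignAll μ (2000 * (μ.p + 1) * (μ.m + 1) * (L + 1)) fun ν =>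
      ∃ i x u ok z t e k f asg st kd tgt tree r y Y,
        ν = { μ with i := i, x := x, u := u, ok := ok, z := z, t := t, e := e, k := k, f := f,
                     asg := asg, st := st, kd := kd, tgt := tgt, tree := tree, r := r, y := y,
                     Y := Y } ∧
        μ.net.Feasible μ.p f asg Y ∧
        ((∀ u < μ.p, ∃ j < μ.m, μ.job j = u) → ok = 1) ∧
        ((¬ ∀ u < μ.p, ∃ j < μ.m, μ.job j = u) → ok = 0) := by
  have e1 : 1 % W = 1 := Nat.mod_eq_of_lt (by omega)
  have hML : 1 ≤ (μ.m + 1) * (L + 1) := Nat.mul_pos (by omega) (by omega)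
  have hM : (μ.m + 1) ≤ (μ.m + 1) * (L + 1) := Nat.le_mul_of_pos_right _ (by omega)
  have hPML : (μ.m + 1) * (L + 1) ≤ (μ.p + 1) * ((μ.m + 1) * (L + 1)) :=
    Nat.le_mul_of_pos_left _ (by omega)
  refine Ends.seq (T₁ := 4) (T₂ := (μ.p + 1) * (1400 * ((μ.m + 1) * (L + 1))))
    (R := fun ν => ν = { μ with ok := 1, u := 0 }) ?_ ?_ ?_
  · exact Ends.of_exec (μ' := { μ with ok := 1, u := 0 }) ⟨trivial, trivial⟩
      (by simp [Program.exec, WExp.eval, e1]) (by decide) rfl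
  swap
  · have h1 : (μ.p + 1) * (1400 * ((μ.m + 1) * (L + 1))) =
        1400 * ((μ.p + 1) * ((μ.m + 1) * (L + 1))) := by ring
    have h2 : 2000 * (μ.p + 1) * (μ.m + 1) * (L + 1) =
        2000 * ((μ.p + 1) * ((μ.m + 1) * (L + 1))) := by ring
    rw [h1, h2]
    omega
  rintro _ rfl
  refine Ends.while (T₁ := 1200 * (μ.m + 1) * (L + 1) + 60 * (μ.m + 1) + 60 * (μ.m + 1) + 4)
    (n := μ.p) (fun n ν => ∃ i x u ok z t e k f asg st kd tgt tree r y Y,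
        ν = { μ with i := i, x := x, u := u, ok := ok, z := z, t := t, e := e, k := k, f := f,
                     asg := asg, st := st, kd := kd, tgt := tgt, tree := tree, r := r, y := y,
                     Y := Y } ∧
        n + u = μ.p ∧ y μ.m = 0 ∧ μ.net.Feasible u f asg Y ∧
        ((∀ v < u, ∃ j < μ.m, μ.job j = v) → ok = 1) ∧
        ((¬ ∀ v < u, ∃ j < μ.m, μ.job j = v) → ok = 0)) ?_ ?_ ?_ ?_
  · rintro n _ ⟨i, x, u, ok, z, t, e, k, f, asg, st, kd, tgt, tree, r, y, Y, rfl, hn, hy0, hfeas,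
      hok1, hok0⟩ hb
    replace hb : u < μ.p := by simpa [BExp.eval, WExp.eval] using hb
    have e2 : (u + 1) % W = u + 1 := Nat.mod_eq_of_lt (by omega)
    refine Ends.seq (T₂ := 60 * (μ.m + 1) + 60 * (μ.m + 1) + 4)
      (search_ends (μ := { μ with
        i := i, x := x, u := u, ok := ok, z := z, t := t, e := e, k := k,
        f := f, asg := asg, st := st, kd := kd, tgt := tgt, tree := tree, r := r, y := y, Y := Y })
        hW hL hm hN hb.le hy0 hfeas) ?_ (by simp only; omega)
    rintro _ ⟨i, x, z, t, k, r, st, kd, tgt, tree, y, Y, τ, rfl, hy0, hfeas, hs⟩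
    refine Ends.seq (T₂ := 60 * (μ.m + 1) + 4)
      (findEdge_ends (μ := { μ with
        i := i, x := x, u := u, ok := ok, z := z, t := t, e := e,
        k := k, f := f, asg := asg, st := st, kd := kd, tgt := tgt, tree := tree, r := r, y := y,
        Y := Y }) (by simp only; omega)) ?_ (by simp only; omega)
    rintro _ ⟨i, e, rfl, he⟩
    refine Ends.seq (T₂ := 4)
      (augment_ends (τ := τ) (μ := { μ with
        i := i, x := x, u := u, ok := ok, z := z, t := t, e := e,
        k := k, f := f, asg := asg, st := st, kd := kd, tgt := tgt, tree := tree, r := r, y := y,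
        Y := Y }) hW hN hb.le hfeas hs he) ?_ le_rfl
    rintro _ ⟨x, f', asg', ok', rfl, hfeas', ho1, ho0⟩
    simp only at ho1 ho0
    refine Ends.of_exec (μ' := { μ with
      i := i, x := x, u := u + 1, ok := ok', z := z, t := t, e := e, k := k, f := f', asg := asg', st := st, kd := kd, tgt := tgt, tree := tree, r := r,
      y := y, Y := Y }) trivial (by simp [Program.exec, WExp.eval, e1, e2]) (by decide) ?_
    refine ⟨n - 1, by omega, _, _, _, _, _, _, _, _, _, _, _, _, _, _, _, _, _, rfl, by omega, hy0,
      hfeas', ?_, ?_⟩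
    · intro hall
      rw [ho1 (hall u (by omega))]
      exact hok1 fun v hv => hall v (by omega)
    · intro hall
      by_cases hc : ∃ j < μ.m, μ.job j = u
      · rw [ho1 hc]
        refine hok0 fun hall' => hall fun v hv => ?_
        rcases (Nat.lt_succ_iff.1 hv).lt_or_eq with hv | rfl
        · exact hall' v hv
        · exact hc
      · exact ho0 hc
  · refine ⟨_, _, _, _, _, _, _, _, _, _, _, _, _, _, _, _, _, rfl, by omega, by rw [hy], ?_,
      by simp, by simp⟩
    rw [hf, hY]
    exact .zero hN _
  · refine Nat.mul_le_mul_left _ ?_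
    have : (BExp.lt vU vP).size + 1 ≤ 10 := by decide
    have h1 : 1200 * (μ.m + 1) * (L + 1) = 1200 * ((μ.m + 1) * (L + 1)) := by ring
    rw [h1]
    omega
  · rintro n _ ⟨i, x, u, ok, z, t, e, k, f, asg, st, kd, tgt, tree, r, y, Y, rfl, hn, hy0, hfeas,
      hok1, hok0⟩ hb
    replace hb : μ.p ≤ u := by simpa [BExp.eval, WExp.eval] using hb
    obtain rfl : u = μ.p := by omega
    exact ⟨_, _, _, _, _, _, _, _, _, _, _, _, _, _, _, _, _, rfl, hfeas, hok1, hok0⟩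

/-! ### Verification of the sorting and of the output -/

theorem initHeads_ends {μ : Mem} (hW : 4 * (μ.p + μ.q + μ.m) + 9 ≤ W) :
    Ends W initHeads μ (30 * (μ.q + 1)) fun ν => ∃ i nx, ν = { μ with i := i, nx := nx } ∧
      ∀ v < μ.q, nx (μ.m + 1 + v) = μ.m := by
  have e1 : 1 % W = 1 := Nat.mod_eq_of_lt (by omega)
  have e2 : (μ.m + 1) % W = μ.m + 1 := Nat.mod_eq_of_lt (by omega)
  refine Ends.seq (T₁ := 2) (T₂ := 25 * (μ.q + 1)) (R := fun ν => ν = { μ with i := 0 })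
    ?_ ?_ (by omega)
  · exact Ends.of_exec (μ' := { μ with i := 0 }) trivial (by simp [Program.exec, WExp.eval])
      (by decide) rfl
  rintro _ rfl
  refine Ends.while (T₁ := 15) (n := μ.q) (fun n ν => ∃ i nx, ν = { μ with i := i, nx := nx } ∧
    n + i = μ.q ∧ ∀ v < i, nx (μ.m + 1 + v) = μ.m) ?_ ?_ ?_ ?_
  · rintro n _ ⟨i, nx, rfl, hn, h⟩ hb
    replace hb : i < μ.q := by simpa [BExp.eval, WExp.eval] using hb
    have e3 : (i + 1) % W = i + 1 := Nat.mod_eq_of_lt (by omega)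
    have e4 : (μ.m + 1 + i) % W = μ.m + 1 + i := Nat.mod_eq_of_lt (by omega)
    refine Ends.of_exec (μ' := { μ with i := i + 1, nx := update nx (μ.m + 1 + i) μ.m })
      ⟨trivial, trivial⟩ (by simp [Program.exec, WExp.eval, e1, e2, e3, e4]) (by decide)
      ⟨n - 1, by omega, _, _, rfl, by omega, fun v hv => ?_⟩
    by_cases hvi : v = i
    · subst hvi; simp
    · rw [Function.update_of_ne (by omega)]; exact h v (by omega)
  · exact ⟨_, _, rfl, by omega, by simp⟩
  · rw [mul_comm]
    exact Nat.mul_le_mul_right _ (by decide)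
  · rintro n _ ⟨i, nx, rfl, hn, h⟩ hb
    replace hb : μ.q ≤ i := by simpa [BExp.eval, WExp.eval] using hb
    obtain rfl : i = μ.q := by omega
    exact ⟨_, _, rfl, h⟩

/-- The weight `0` of the sink ends the walk at the end of the list. -/
theorem walk_ends {μ : Mem} {h n : ℕ} {A B : List ℕ} (hc : IsChain μ.m μ.nx μ.pv h (A ++ B))
    (hx : μ.x = A.getLastD h) (hA : ∀ a ∈ A, μ.w μ.i ≤ μ.w a)
    (hsort : (A ++ B).Pairwise fun a b => μ.w b ≤ μ.w a) (hB : B.length ≤ n) (hw : μ.w μ.m = 0)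
    (hwi : 0 ≤ μ.w μ.i) :
    Ends W walk μ (20 * (n + 1)) fun ν => ∃ x A' B', ν = { μ with x := x } ∧ A ++ B = A' ++ B' ∧
      x = A'.getLastD h ∧ (∀ a ∈ A', μ.w μ.i ≤ μ.w a) ∧ ∀ b ∈ B', μ.w b ≤ μ.w μ.i := by
  refine Ends.while (T₁ := 5) (n := n) (fun k ν => ∃ x A' B', ν = { μ with x := x } ∧
    A ++ B = A' ++ B' ∧ x = A'.getLastD h ∧ (∀ a ∈ A', μ.w μ.i ≤ μ.w a) ∧ B'.length ≤ k)
    ?_ ?_ ?_ ?_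
  · rintro k _ ⟨x, A', B', rfl, hAB, hx, hA', hk⟩ hb
    replace hb : μ.w μ.i < μ.w (μ.nx x) := by simpa [BExp.eval, WExp.eval, RExp.eval] using hb
    rw [hAB] at hc
    have hc' := hc.drop
    rw [← hx] at hc'
    cases B' with
    | nil => rw [hc'.nx_eq, List.headD_nil, hw] at hb; exact absurd hwi hb.not_ge
    | cons b B' =>
      rw [hc'.1] at hb
      simp only [List.length_cons] at hk
      refine Ends.of_exec (μ' := { μ with x := b }) trivial
        (by simp [Program.exec, WExp.eval, hc'.1]) (by decide)
        ⟨k - 1, by omega, b, A' ++ [b], B', rfl, by simp [hAB], by simp, ?_, by omega⟩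
      intro a ha
      rcases List.mem_append.1 ha with ha | ha
      · exact hA' a ha
      · rw [List.mem_singleton.1 ha]; exact hb.le
  · exact ⟨_, A, B, rfl, rfl, hx, hA, hB⟩
  · rw [mul_comm]
    exact Nat.mul_le_mul_right _ (by decide)
  · rintro k _ ⟨x, A', B', rfl, hAB, hx, hA', hk⟩ hb
    replace hb : μ.w (μ.nx x) ≤ μ.w μ.i := by simpa [BExp.eval, WExp.eval, RExp.eval] using hb
    refine ⟨x, A', B', rfl, hAB, hx, hA', ?_⟩
    rw [hAB] at hc hsort
    have hc' := hc.drop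
    rw [← hx] at hc'
    cases B' with
    | nil => simp
    | cons b B' =>
      rw [hc'.1] at hb
      intro a ha
      rcases List.mem_cons.1 ha with rfl | ha
      · exact hb
      · exact ((List.pairwise_cons.1 (List.pairwise_append.1 hsort).2.1).1 a ha).trans hb

section Insert

variable {p q : ℕ} {G : WeightedGraph (Fin p) (Fin q)} {l : List (Fin p × Fin q)}

/-- A chain has at most one edge for each job. -/
theorem chain_length_le {job mach nx pv : ℕ → ℕ} {w : ℕ → ℝ} {n : ℕ} {L : ℕ → List ℕ}
    (h : InputNet G l job mach w) (hL : Chains l.length q n mach nx pv w L) (hn : n ≤ l.length)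
    {v : ℕ} (hv : v < q) : (L v).length ≤ p := by
  have hmem := hL.mem v hv
  rw [← List.toFinset_card_of_nodup (hL.nodup v hv), ← Finset.card_range p]
  refine Finset.card_le_card_of_injOn job ?_ ?_
  · intro i hi
    have := (hmem i).1 (by simpa using hi)
    simpa using h.job_lt (by omega : i < l.length)
  · intro i hi j hj hij
    have h1 := (hmem i).1 (by simpa using hi)
    have h2 := (hmem j).1 (by simpa using hj)
    exact h.inj (by omega) (by omega) hij (h1.2.trans h2.2.symm)

theorem insertAll_ends {μ : Mem} (hW : 4 * (μ.p + μ.q + μ.m) + 9 ≤ W)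
    (hG : InputNet G l μ.job μ.mach μ.w) (hm : μ.m = l.length) (hp : μ.p = p) (hq : μ.q = q)
    (h0 : ∀ v < μ.q, μ.nx (μ.m + 1 + v) = μ.m) :
    Ends W insertAll μ (100 * ((μ.m + 1) * (μ.p + 1))) fun ν => ∃ i x nx pv L,
      ν = { μ with i := i, x := x, nx := nx, pv := pv } ∧
      Chains μ.m μ.q μ.m μ.mach nx pv μ.w L := by
  have e1 : 1 % W = 1 := Nat.mod_eq_of_lt (by omega)
  have e2 : (μ.m + 1) % W = μ.m + 1 := Nat.mod_eq_of_lt (by omega)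
  have hpos : 1 ≤ (μ.m + 1) * (μ.p + 1) := Nat.mul_pos (by omega) (by omega)
  refine Ends.seq (T₁ := 2) (T₂ := (μ.m + 1) * (90 * (μ.p + 1)))
    (R := fun ν => ν = { μ with i := 0 }) ?_ ?_ ?_
  · exact Ends.of_exec (μ' := { μ with i := 0 }) trivial (by simp [Program.exec, WExp.eval])
      (by decide) rfl
  swap
  · have : (μ.m + 1) * (90 * (μ.p + 1)) = 90 * ((μ.m + 1) * (μ.p + 1)) := by ring
    omega
  rintro _ rfl
  refine Ends.while (T₁ := 20 * (μ.p + 1) + 50) (n := μ.m) (fun n ν => ∃ i x nx pv L,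
      ν = { μ with i := i, x := x, nx := nx, pv := pv } ∧ n + i = μ.m ∧
      Chains μ.m μ.q i μ.mach nx pv μ.w L) ?_ ?_ ?_ ?_
  · rintro n _ ⟨i, x, nx, pv, L, rfl, hn, h⟩ hb
    replace hb : i < μ.m := by simpa [BExp.eval, WExp.eval] using hb
    have hil : i < l.length := by omega
    have hv : μ.mach i < μ.q := hq ▸ hG.mach_lt hil
    have e3 : (i + 1) % W = i + 1 := Nat.mod_eq_of_lt (by omega)
    have e4 : (μ.m + 1 + μ.mach i) % W = μ.m + 1 + μ.mach i := Nat.mod_eq_of_lt (by omega)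
    refine Ends.seq (T₁ := 10) (T₂ := 20 * (μ.p + 1) + 40)
      (R := fun ν => ν = { μ with i := i, x := μ.m + 1 + μ.mach i, nx := nx, pv := pv })
      ?_ ?_ (by omega)
    · exact Ends.of_exec (μ' := { μ with i := i, x := μ.m + 1 + μ.mach i, nx := nx, pv := pv })
        trivial (by simp [Program.exec, WExp.eval, e1, e2, e4]) (by decide) rfl
    rintro _ rfl
    have hlen : (L (μ.mach i)).length ≤ μ.p := by
      rw [hp]
      rw [hm, hq] at h
      exact chain_length_le hG h (by omega) (hq ▸ hv)
    refine Ends.seq (T₁ := 20 * (μ.p + 1)) (T₂ := 40)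
      (walk_ends (μ := { μ with i := i, x := μ.m + 1 + μ.mach i, nx := nx, pv := pv })
        (A := []) (B := L (μ.mach i)) (h.chain _ hv) rfl (by simp) (h.sorted _ hv) hlen
        (by simp only [hm]; exact hG.w_end) (hG.w_nonneg hil)) ?_ le_rfl
    rintro _ ⟨x, A, B, rfl, hAB, hx, hA, hB⟩
    have hxi : i ≠ x := by
      rw [hx]
      rcases List.eq_nil_or_concat A with rfl | ⟨A', b, rfl⟩
      · simp only [List.getLastD_nil]; omega
      · rw [List.concat_eq_append, List.getLastD_concat]
        rintro rfl
        have := ((h.mem _ hv i).1 (by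
          rw [List.nil_append] at hAB
          rw [hAB]; simp)).1
        omega
    refine Ends.of_exec (μ' := { μ with
      i := i + 1, x := x, nx := update (update nx i (nx x)) x i,
      pv := update (update pv (nx x) i) i x }) ?_ ?_ (by decide) ?_
    · exact ⟨trivial, trivial, trivial, trivial, trivial⟩
    · simp [link, Program.exec, WExp.eval, e1, e3]
    · exact ⟨n - 1, by omega, _, _, _, _, _, rfl, by omega, h.insert hb hv hAB hx hA hB⟩
  · exact ⟨_, _, _, _, _, rfl, by omega, .empty h0⟩
  · refine Nat.mul_le_mul_left _ ?_
    have : (BExp.lt vI vM).size + 1 ≤ 10 := by decide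
    omega
  · rintro n _ ⟨i, x, nx, pv, L, rfl, hn, h⟩ hb
    replace hb : μ.m ≤ i := by simpa [BExp.eval, WExp.eval] using hb
    obtain rfl : i = μ.m := by omega
    exact ⟨_, _, _, _, _, rfl, h⟩

end Insert

theorem output_ends {μ : Mem} (hW : 4 * μ.p + 9 ≤ W) :
    Ends W output μ (40 * (μ.p + 1)) fun ν => ∃ u out,
      ν = { μ with p := μ.ok, u := u, out := out } ∧
      ∀ j < μ.p, out j = μ.mach (μ.asg j) := by
  have e1 : 1 % W = 1 := Nat.mod_eq_of_lt (by omega)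
  refine Ends.seq (T₁ := 2) (T₂ := 35 * (μ.p + 1)) (R := fun ν => ν = { μ with u := 0 })
    ?_ ?_ (by omega)
  · exact Ends.of_exec (μ' := { μ with u := 0 }) trivial (by simp [Program.exec, WExp.eval])
      (by decide) rfl
  rintro _ rfl
  refine Ends.seq (T₁ := 30 * (μ.p + 1)) (T₂ := 2)
    (R := fun ν => ∃ u out, ν = { μ with u := u, out := out } ∧
      ∀ j < μ.p, out j = μ.mach (μ.asg j)) ?_ ?_ (by omega)
  · refine Ends.while (T₁ := 20) (n := μ.p) (fun n ν => ∃ u out,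
      ν = { μ with u := u, out := out } ∧ n + u = μ.p ∧ ∀ j < u, out j = μ.mach (μ.asg j))
      ?_ ?_ ?_ ?_
    · rintro n _ ⟨u, out, rfl, hn, h⟩ hb
      replace hb : u < μ.p := by simpa [BExp.eval, WExp.eval] using hb
      have e2 : (u + 1) % W = u + 1 := Nat.mod_eq_of_lt (by omega)
      refine Ends.of_exec (μ' := { μ with
        u := u + 1, out := update out u (μ.mach (μ.asg u)) }) ⟨trivial, trivial⟩
        (by simp [Program.exec, WExp.eval, e1, e2]) (by decide)
        ⟨n - 1, by omega, _, _, rfl, by omega, fun j hj => ?_⟩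
      by_cases hju : j = u
      · subst hju; simp
      · rw [Function.update_of_ne hju]; exact h j (by omega)
    · exact ⟨_, _, rfl, by omega, by simp⟩
    · rw [mul_comm]
      exact Nat.mul_le_mul_right _ (by decide)
    · rintro n _ ⟨u, out, rfl, hn, h⟩ hb
      replace hb : μ.p ≤ u := by simpa [BExp.eval, WExp.eval] using hb
      obtain rfl : u = μ.p := by omega
      exact ⟨_, _, rfl, h⟩
  · rintro _ ⟨u, out, rfl, h⟩
    exact Ends.of_exec (μ' := { μ with p := μ.ok, u := u, out := out }) trivial
      (by simp [Program.exec, WExp.eval]) (by decide) ⟨_, _, rfl, h⟩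

/-! ### The whole algorithm -/

variable {p q : ℕ} {G : WeightedGraph (Fin p) (Fin q)} {l : List (Fin p × Fin q)}

/-- The input, in terms of the named cells. -/
noncomputable def inputMem (G : WeightedGraph (Fin p) (Fin q)) (l : List (Fin p × Fin q)) :
    Mem where
  p := p
  q := q
  m := l.length
  i := 0
  x := 0
  u := 0
  ok := 0
  z := 0
  t := 0
  e := 0
  k := 0
  job i := if h : i < l.length then (l[i].1 : ℕ) else 0
  mach i := if h : i < l.length then (l[i].2 : ℕ) else 0
  out _ := 0
  nx _ := 0
  pv _ := 0
  f _ := 0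
  asg _ := 0
  st _ := 0
  kd _ := 0
  tgt _ := 0
  tree _ := 0
  r := 0
  w i := if h : i < l.length then G.weight l[i] else 0
  y _ := 0
  Y _ := 0

theorem inputState_eq : inputState G l = (inputMem G l).toState := by
  simp only [inputState, Mem.toState, State.mk.injEq]
  refine ⟨?_, ?_, ?_, ?_⟩
  · funext n
    rcases n with _ | _ | _ | _ | _ | _ | _ | _ | _ | _ | _ | n <;> simp [inputMem]
  · funext n
    rcases n with _ | n <;> simp [inputMem]
  · funext n
    rcases n with _ | _ | _ | _ | _ | _ | _ | _ | _ | _ | _ | n <;> funext i <;> simp [inputMem]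
  · funext n
    rcases n with _ | _ | _ | n <;> funext i <;> simp [inputMem]

theorem inputNet (h : l.Nodup) (h' : l.toFinset = G.edges) :
    InputNet G l (inputMem G l).job (inputMem G l).mach (inputMem G l).w where
  nodup := h
  edges := h'
  job_eq i hi := by simp [inputMem, hi]
  mach_eq i hi := by simp [inputMem, hi]
  w_eq i hi := by simp [inputMem, hi]
  w_end := by simp [inputMem]

theorem main_ends {W L : ℕ} (hl : l.Nodup) (hl' : l.toFinset = G.edges)
    (hW : 4 * (p + q + l.length) + 9 ≤ W) (hL : l.length ≤ 2 ^ L) (hm : 1 ≤ l.length) :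
    Ends W main (inputMem G l)
      (30 * (q + 1) + (100 * ((l.length + 1) * (p + 1)) +
        (2000 * (p + 1) * (l.length + 1) * (L + 1) + 40 * (p + 1))))
      fun ν => Solves G ν.toState := by
  have hG := inputNet hl hl'
  refine Ends.seq (T₂ := 100 * ((l.length + 1) * (p + 1)) +
      (2000 * (p + 1) * (l.length + 1) * (L + 1) + 40 * (p + 1)))
    (initHeads_ends (μ := inputMem G l) hW) ?_ le_rfl
  rintro _ ⟨i, nx, rfl, hheads⟩
  refine Ends.seq (T₂ := 2000 * (p + 1) * (l.length + 1) * (L + 1) + 40 * (p + 1))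
    (insertAll_ends (μ := { inputMem G l with i := i, nx := nx }) hW hG rfl rfl rfl hheads) ?_ le_rfl
  rintro _ ⟨i, x, nx, pv, C, rfl, hC⟩
  have hN := hC.good (fun i hi => hG.mach_lt hi) (fun i hi => hG.w_nonneg hi) hG.w_end
    (inputMem G l).job
  refine Ends.seq (T₂ := 40 * (p + 1))
    (assignAll_ends (L := L) (μ := { inputMem G l with i := i, x := x, nx := nx, pv := pv })
      (by simp only [inputMem]; omega) hL hm hN rfl rfl rfl) ?_ le_rfl
  rintro _ ⟨i, x, u, ok, z, t, e, k, f, asg, st, kd, tgt, tree, r, y, Y, rfl, hy, hok1, hok0⟩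
  refine (output_ends (by simp only [inputMem]; omega)).mono le_rfl ?_
  rintro _ ⟨u, out, rfl, hout⟩
  have hsolve : (∀ u < p, ∃ i < l.length, (inputMem G l).job i = u) →
      G.IsOptimal (outputEdges p q (Mem.toState { inputMem G l with
        p := ok, i := i, x := x, u := u, ok := ok, z := z, t := t, e := e, k := k, out := out,
        nx := nx, pv := pv, f := f, asg := asg, st := st, kd := kd, tgt := tgt, tree := tree,
        r := r, y := y, Y := Y })) := fun hall => hG.isOptimal hC hy hall hout
  constructor
  · rintro ⟨M, hM⟩
    have hall : ∀ u < p, ∃ i < l.length, (inputMem G l).job i = u := by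
      intro u hu
      obtain ⟨i, hi, hiu, -⟩ := hG.exists_unique_index hM hu
      exact ⟨i, hi, hiu⟩
    exact ⟨hok1 hall, hsolve hall⟩
  · intro hM
    exact hok0 fun hall => hM ⟨_, (hsolve hall).1⟩

/-- The running time in terms of the logarithm of the number of vertices. -/
theorem time_le {p q n m : ℕ} (hn : n = p + q) (hp : 1 ≤ p) (hq : 1 ≤ q) (hm : 1 ≤ m) :
    ((30 * (q + 1) + (100 * ((m + 1) * (p + 1)) + (2000 * (p + 1) * (m + 1) *
      (2 * (Nat.log 2 n + 1) + 1) + 40 * (p + 1))) : ℕ) : ℝ) ≤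
      40000 * ((n : ℝ) * (m : ℝ) * Real.log (n : ℝ)) := by
  set K := Nat.log 2 n with hK
  have hn2 : 2 ≤ n := by omega
  have h1 : q + 1 ≤ n * m := (by omega : q + 1 ≤ n).trans (Nat.le_mul_of_pos_right _ hm)
  have h2 : p + 1 ≤ n * m := (by omega : p + 1 ≤ n).trans (Nat.le_mul_of_pos_right _ hm)
  have h3 : (m + 1) * (p + 1) ≤ 2 * (n * m) := by
    calc (m + 1) * (p + 1) ≤ (2 * m) * n := Nat.mul_le_mul (by omega) (by omega)
      _ = 2 * (n * m) := by ring
  have h4 : 2000 * (p + 1) * (m + 1) * (2 * (K + 1) + 1) ≤ 4000 * (n * m * (2 * K + 3)) := by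
    calc 2000 * (p + 1) * (m + 1) * (2 * (K + 1) + 1)
        = 2000 * ((m + 1) * (p + 1)) * (2 * K + 3) := by ring
      _ ≤ 2000 * (2 * (n * m)) * (2 * K + 3) := by gcongr
      _ = 4000 * (n * m * (2 * K + 3)) := by ring
  have h5 : n * m ≤ n * m * (2 * K + 3) := Nat.le_mul_of_pos_right _ (by omega)
  have h6 : 30 * (q + 1) + (100 * ((m + 1) * (p + 1)) + (2000 * (p + 1) * (m + 1) *
      (2 * (K + 1) + 1) + 40 * (p + 1))) ≤ 4300 * (n * m * (2 * K + 3)) := by omega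
  have hlog2 : (0.6931471803 : ℝ) < Real.log 2 := Real.log_two_gt_d9
  have h7 : Real.log 2 ≤ Real.log n := Real.log_le_log (by norm_num) (by exact_mod_cast hn2)
  have h8 : (K : ℝ) * Real.log 2 ≤ Real.log n := by
    rw [← Real.log_pow]
    refine Real.log_le_log (by positivity) ?_
    exact_mod_cast Nat.pow_log_le_self 2 (by omega)
  have h9 : 4300 * (2 * (K : ℝ) + 3) ≤ 40000 * Real.log n := by
    have : (K : ℝ) * 0.6931471803 ≤ Real.log n :=
      (mul_le_mul_of_nonneg_left hlog2.le (Nat.cast_nonneg K)).trans h8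
    nlinarith
  calc ((30 * (q + 1) + (100 * ((m + 1) * (p + 1)) + (2000 * (p + 1) * (m + 1) *
      (2 * (K + 1) + 1) + 40 * (p + 1))) : ℕ) : ℝ)
      ≤ ((4300 * (n * m * (2 * K + 3)) : ℕ) : ℝ) := by exact_mod_cast h6
    _ = (n : ℝ) * m * (4300 * (2 * (K : ℝ) + 3)) := by push_cast; ring
    _ ≤ (n : ℝ) * m * (40000 * Real.log n) := by gcongr
    _ = 40000 * ((n : ℝ) * (m : ℝ) * Real.log (n : ℝ)) := by ring

end Code

end SemiMatching

theorem mainTheorem2 :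
    ∃ (P : SemiMatching.Program) (C : ℝ) (k : ℕ),
      ∀ (p q n m : ℕ) (G : SemiMatching.WeightedGraph (Fin p) (Fin q))
        (l : List (Fin p × Fin q)),
        l.Nodup → l.toFinset = G.edges → n = p + q → m = G.edges.card → 1 ≤ m →
        ∀ W : ℕ, (n + m) ^ k ≤ W →
          ∃ (t : ℕ) (s : SemiMatching.State),
            SemiMatching.Run W P (SemiMatching.inputState G l) t s ∧
            (t : ℝ) ≤ C * ((n : ℝ) * (m : ℝ) * Real.log (n : ℝ)) ∧
            SemiMatching.Solves G s := by
  refine ⟨SemiMatching.Code.main, 40000, 6, ?_⟩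
  intro p q n m G l hl hl' hn hm hm1 W hW
  have hlen : l.length = m := by rw [hm, ← hl', List.toFinset_card_of_nodup hl]
  obtain ⟨e, -⟩ : G.edges.Nonempty := Finset.card_pos.1 (by omega)
  have hp : 1 ≤ p := Nat.one_le_iff_ne_zero.2 (by rintro rfl; exact e.1.elim0)
  have hq : 1 ≤ q := Nat.one_le_iff_ne_zero.2 (by rintro rfl; exact e.2.elim0)
  have hmpq : m ≤ p * q := by
    rw [hm]
    exact (Finset.card_le_univ _).trans (by simp)
  have hbig : 4 * (p + q + l.length) + 9 ≤ W := by
    refine le_trans ?_ hW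
    -- since `n + m ≥ 3`, the sixth power exceeds any small multiple of `n + m`
    have h3 : 3 ^ 5 ≤ (n + m) ^ 5 := Nat.pow_le_pow_left (by omega) 5
    have h6 : (n + m) * 3 ^ 5 ≤ (n + m) ^ 6 := by
      rw [pow_succ' _ 5]
      exact Nat.mul_le_mul_left _ h3
    omega
  -- the height of the tournament tree is at most twice the binary logarithm of `n`
  have hL : l.length ≤ 2 ^ (2 * (Nat.log 2 n + 1)) := by
    have h1 : n < 2 ^ (Nat.log 2 n + 1) := Nat.lt_pow_succ_log_self (by norm_num) n
    calc l.length ≤ p * q := by rw [hlen]; exact hmpq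
      _ ≤ 2 ^ (Nat.log 2 n + 1) * 2 ^ (Nat.log 2 n + 1) :=
        Nat.mul_le_mul (by omega) (by omega)
      _ = 2 ^ (2 * (Nat.log 2 n + 1)) := by rw [two_mul, pow_add _ (Nat.log 2 n + 1)]
  obtain ⟨t, ν, hrun, ht, hsol⟩ := SemiMatching.Code.main_ends hl hl' hbig hL (by omega)
  refine ⟨t, ν.toState, ?_, ?_, hsol⟩
  · rw [SemiMatching.Code.inputState_eq]; exact hrun
  · rw [hlen] at ht
    exact (Nat.cast_le.2 ht).trans (SemiMatching.Code.time_le hn hp hq hm1)
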